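/- Let $\mathbb{L}$ be a skew field with an involution $\sigma$ (an anti-automorphism with $\sigma^2=\mathrm{id}$; $\sigma=\mathrm{id}$ is allowed if $\mathbb{L}$ is commutative) and put $\mathbb{L}_\sigma=\{t-t^\sigma\mid t\in\mathbb{L}\}$. Let $V_0$ be a right vector space over $\mathbb{L}$ (of arbitrary dimension), let $g_0:V_0\times V_0\to\mathbb{L}$ be biadditive with $g_0(vk,w\ell)=k^\sigma g_0(v,w)\ell$, put $f_0(v,w)=g_0(v,w)+g_0(w,v)^\sigma$, and suppose that $\mathfrak q_0(v)=g_0(v,v)+\mathbb{L}_\sigma$ is anisotropic on $V_0$, that is, $\mathfrak q_0(v)=0$ only for $v=0$. Let $n\ge 3$, let $V=V_0\oplus\bigoplus_{i=1}^n(e_{-i}\mathbb{L}\oplus e_i\mathbb{L})$, and for $v=v_0+\sum_i(e_{-i}x_{-i}+e_ix_i)$ and $w=w_0+\sum_i(e_{-i}y_{-i}+e_iy_i)$ put $$\mathfrak q(v)=\sum_{i=1}^n x_{-i}^\sigma x_i+\mathfrak q_0(v_0)\in\mathbb{L}/\mathbb{L}_\sigma,\qquad f(v,w)=\sum_{i=1}^n(x_{-i}^\sigma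 y_i+x_i^\sigma y_{-i})+f_0(v_0,w_0).$$ Let $\Delta$ be the polar space of rank $n$ whose points are the $1$-spaces of $V$ on which $\mathfrak q$ vanishes, two points $\langle v\rangle,\langle w\rangle$ being collinear iff $f(v,w)=0$; its singular subspaces are the subspaces of $V$ on which $\mathfrak q$ vanishes. Suppose that $\Delta$ is thick, that is, $\sigma\ne\mathrm{id}$ or $V_0\neq0$. Two singular subspaces $U,W$ are opposite if $\dim U=\dim W$ and no point of $U$ is collinear to all points of $W$; the perspectivity $U\barwedge W$ maps each subspace $S\subseteq U$ to $S^\perp\cap W$. For a maximal singular subspace $M$, the special projectivity group $\Pi^+(M)$ is the group of all self-projectivities of $M$ that are compositions of an even number of perspectivities between successively opposite subspaces. A homology of $M$ with axis a hyperplane $H$, centre a point $\langle c\rangle\not\subseteq H$ and factor $d\in\mathbb{L}\setminus\{0\}$ is the collineation of the projective space $M$ induced by the linear map that fixes $H$ pointwise and maps $c$ to $cd$. For $v_0,w_0\in V_0$ and $t,u\in\mathbb{L}$ put $g_1=g_0(v_0,v_0)+t-t^\sigma$, $g_2=g_0(w_0,w_0)+u-u^\sigma$ and $$D(v_0,w_0,t,u)=g_2g_1+f_0(w_0,v_0)+1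 .$$ The norm set is $\{D(v_0,w_0,t,u)\mid v_0,w_0\in V_0,\ t,u\in\mathbb{L}\}$. Then the following hold. (a) Suppose that none of the following holds: $|\mathbb{L}|=2$; $|\mathbb{L}|=3$ and $\dim V_0=1$; $|\mathbb{L}|=4$ and $V_0=0$. Then, for every maximal singular subspace $M$ of $\Delta$, the group $\Pi^+(M)$ is equal to the group generated by all homologies of $M$ (with arbitrary axis and centre) whose factor is a nonzero element of the norm set. (b) Let $j\in\{1,\dots,n\}$ and suppose that $D=D(v_0,w_0,t,u)\ne0$. Then $M_1=\langle e_{-1},\dots,e_{-n}\rangle$, $M_2=\langle e_1,\dots,e_n\rangle$, $M_3=\langle e_{-j}+v_0-e_jg_1,\ e_{-i}\ (i\ne j)\rangle$ and $M_4=\langle e_j+w_0-e_{-j}g_2^\sigma,\ e_i\ (i\neq j)\rangle$ are maximal singular subspaces, $M_1$ is opposite $M_2$, $M_2$ is opposite $M_3$, $M_3$ is opposite $M_4$, $M_4$ is opposite $M_1$, and the self-projectivity $M_1\barwedge M_2\barwedge M_3\barwedge M_4\barwedge M_1$ is the homology of $M_1$ with axis $\langle e_{-i}\mid i\ne j\rangle$,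 centre $\langle e_{-j}\rangle$ and factor $D$ (with respect to the vector $e_{-j}$). -/

import Mathlib

open scoped RightActions

/-! ### Pseudo-quadratic forms

`L` is a skew field, its involution `σ` (an anti-automorphism with `σ ∘ σ = id`, possibly the
identity when `L` is commutative) is `star`.  A right vector space over `L` is a module over `Lᵐᵒᵖ`,
and `v <• k` is the vector `v k`. -/

/-- A `(σ, id)`-linear form `g : V × V → L` on the right vector space `V`. -/
structure SigmaForm (L V : Type*) [DivisionRing L] [StarRing L] [AddCommGroup V]
    [Module Lᵐᵒᵖ V] where
  toFun : V → V → L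
  add_left : ∀ u v w, toFun (u + v) w = toFun u w + toFun v w
  add_right : ∀ u v w, toFun u (v + w) = toFun u v + toFun u w
  smul_smul : ∀ (v w : V) (k l : L), toFun (v <• k) (w <• l) = star k * toFun v w * l

/-- The additive group `L_σ = {t - t^σ | t ∈ L}`. -/
def traceGroup (L : Type*) [DivisionRing L] [StarRing L] : AddSubgroup L where
  carrier := {x | ∃ t : L, x = t - star t}
  zero_mem' := ⟨0, by simp⟩
  add_mem' := by
    rintro _ _ ⟨s, rfl⟩ ⟨t, rfl⟩
    exact ⟨s + t, by rw [star_add]; abel⟩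
  neg_mem' := by
    rintro _ ⟨t, rfl⟩
    exact ⟨-t, by rw [star_neg]; abel⟩

namespace SigmaForm

variable {L V : Type*} [DivisionRing L] [StarRing L] [AddCommGroup V] [Module Lᵐᵒᵖ V]

/-- The associated Hermitian form `f(v, w) = g(v, w) + g(w, v)^σ`. -/
def herm (g : SigmaForm L V) (v w : V) : L := g.toFun v w + star (g.toFun w v)

/-- The pseudo-quadratic form `q(v) = g(v, v) + L_σ`. -/
def quad (g : SigmaForm L V) (v : V) : L ⧸ traceGroup L := QuotientAddGroup.mk (g.toFun v v)

/-- `q` is anisotropic: it vanishes only at the zero vector. -/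
def Anisotropic (g : SigmaForm L V) : Prop := ∀ v : V, g.quad v = 0 → v = 0

theorem herm_add_right (g : SigmaForm L V) (u v w : V) :
    g.herm u (v + w) = g.herm u v + g.herm u w := by
  simp only [herm, g.add_left, g.add_right, star_add]; abel

theorem herm_smul_right (g : SigmaForm L V) (v w : V) (l : L) :
    g.herm v (w <• l) = g.herm v w * l := by
  have h1 := g.smul_smul v w 1 l
  have h2 := g.smul_smul w v l 1
  simp only [MulOpposite.op_one, one_smul, star_one, one_mul, mul_one] at h1 h2
  simp only [herm, h1, h2, star_mul, star_star, add_mul]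

theorem star_herm (g : SigmaForm L V) (v w : V) : star (g.herm v w) = g.herm w v := by
  simp only [herm, star_add, star_star]; abel

theorem herm_eq_zero_comm (g : SigmaForm L V) {v w : V} (h : g.herm v w = 0) :
    g.herm w v = 0 := by
  rw [← g.star_herm, h, star_zero]

/-- `f(v, ·)` as a linear map. -/
def hermRight (g : SigmaForm L V) (v : V) : V →ₗ[Lᵐᵒᵖ] L where
  toFun := g.herm v
  map_add' := g.herm_add_right v
  map_smul' c w := by
    have := g.herm_smul_right v w c.unop
    simpa using this

/-! ### The polar space of a pseudo-quadratic form

Its points are the `1`-spaces of `V` on which `q` vanishes, its lines are the `2`-spaces all of whose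
points are points of the polar space; two points `⟨v⟩`, `⟨w⟩` are collinear if and only if
`f(v, w) = 0`.  Its singular subspaces are the subspaces of `V` on which `q` vanishes. -/

/-- The subspace `S^⊥` of all vectors that are perpendicular to all of `S`. -/
def perp (g : SigmaForm L V) (S : Submodule Lᵐᵒᵖ V) : Submodule Lᵐᵒᵖ V where
  carrier := {w | ∀ s ∈ S, g.herm s w = 0}
  zero_mem' := fun s _ => (g.hermRight s).map_zero
  add_mem' := by
    intro a b ha hb s hs
    rw [herm_add_right, ha s hs, hb s hs, add_zero]
  smul_mem' := by
    intro c w hw s hs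
    have h := (g.hermRight s).map_smul c w
    have h' : g.hermRight s w = 0 := hw s hs
    rw [h', smul_zero] at h
    exact h

/-- `U` is a singular subspace: all its points are points of the polar space. -/
def IsSingular (g : SigmaForm L V) (U : Submodule Lᵐᵒᵖ V) : Prop := ∀ v ∈ U, g.quad v = 0

/-- `U` is a maximal singular subspace. -/
def IsMaximalSingular (g : SigmaForm L V) (U : Submodule Lᵐᵒᵖ V) : Prop :=
  Maximal g.IsSingular U

/-- Two (finite-dimensional) singular subspaces are opposite if they have the same dimension and no
point of the first one is collinear to all points of the second one. -/
structure Opposite (g : SigmaForm L V) (U W : Submodule Lᵐᵒᵖ V) : Prop where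
  singular_left : g.IsSingular U
  singular_right : g.IsSingular W
  finite_left : Module.Finite Lᵐᵒᵖ U
  finite_right : Module.Finite Lᵐᵒᵖ W
  finrank_eq : Module.finrank Lᵐᵒᵖ U = Module.finrank Lᵐᵒᵖ W
  not_collinear : ∀ u ∈ U, u ≠ 0 → ∃ w ∈ W, g.herm u w ≠ 0

/-- The perspectivity from `U` to `W`, which maps a subspace `S` of `U` to `S^⊥ ∩ W`. -/
def perspectivity (g : SigmaForm L V) (U W : Submodule Lᵐᵒᵖ V) (S : Submodule Lᵐᵒᵖ U) :
    Submodule Lᵐᵒᵖ W :=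
  (g.perp (S.map U.subtype)).comap W.subtype

/-- `φ` is a projectivity from `U` to `W` that is a composition of `k` perspectivities between
opposite singular subspaces. -/
inductive IsProjectivity (g : SigmaForm L V) : ℕ → (U W : Submodule Lᵐᵒᵖ V) →
    (Submodule Lᵐᵒᵖ U → Submodule Lᵐᵒᵖ W) → Prop
  | refl (U : Submodule Lᵐᵒᵖ V) : IsProjectivity g 0 U U id
  | step {k : ℕ} {U W W' : Submodule Lᵐᵒᵖ V} {φ : Submodule Lᵐᵒᵖ U → Submodule Lᵐᵒᵖ W} :
      IsProjectivity g k U W φ → g.Opposite W W' →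
        IsProjectivity g (k + 1) U W' (g.perspectivity W W' ∘ φ)

/-! Perspectivities between opposite subspaces are inverse to each other; hence the even
self-projectivities form a group. -/

theorem finrank_right_space {L : Type*} [DivisionRing L] (k : ℕ) : Module.finrank Lᵐᵒᵖ (Fin k → L) = k := by
  have h1 : Module.finrank Lᵐᵒᵖ L = 1 :=
    finrank_eq_one (1 : L) one_ne_zero (fun w => ⟨MulOpposite.op w, by simp⟩)
  have : Module.Finite Lᵐᵒᵖ L := Module.finite_of_finrank_eq_succ h1
  rw [Module.finrank_pi_fintype]
  simp [h1]

theorem finrank_le_perp_add (g : SigmaForm L V) (T U : Submodule Lᵐᵒᵖ V)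
    [Module.Finite Lᵐᵒᵖ T] [Module.Finite Lᵐᵒᵖ U] :
    Module.finrank Lᵐᵒᵖ U ≤
      Module.finrank Lᵐᵒᵖ (g.perp T ⊓ U : Submodule Lᵐᵒᵖ V) + Module.finrank Lᵐᵒᵖ T := by
  have hL : Module.finrank Lᵐᵒᵖ L = 1 :=
    finrank_eq_one (1 : L) one_ne_zero (fun w => ⟨MulOpposite.op w, by simp⟩)
  have : Module.Finite Lᵐᵒᵖ L := Module.finite_of_finrank_eq_succ hL
  let b := Module.finBasis Lᵐᵒᵖ T
  let Φ : U →ₗ[Lᵐᵒᵖ] (Fin (Module.finrank Lᵐᵒᵖ T) → L) :=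
    LinearMap.pi (fun i => (g.hermRight (b i : V)).comp U.subtype)
  have h1 := LinearMap.finrank_range_add_finrank_ker Φ
  have h2 : Module.finrank Lᵐᵒᵖ (LinearMap.range Φ) ≤ Module.finrank Lᵐᵒᵖ T := by
    refine (Submodule.finrank_le _).trans ?_
    rw [finrank_right_space]
  have h3 : (LinearMap.ker Φ).map U.subtype ≤ g.perp T ⊓ U := by
    rintro _ ⟨u, hu, rfl⟩
    refine ⟨?_, u.2⟩
    have hu' : ∀ i, g.herm (b i : V) (u : V) = 0 := fun i => congrFun (LinearMap.mem_ker.1 hu) i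
    have hle : T ≤ LinearMap.ker (g.hermRight (u : V)) := by
      have hs : Submodule.span Lᵐᵒᵖ (Set.range fun i => (b i : V)) = T := by
        have := congrArg (Submodule.map T.subtype) b.span_eq
        rw [Submodule.map_span, Submodule.map_top, Submodule.range_subtype, ← Set.range_comp] at this
        exact this
      rw [← hs, Submodule.span_le]
      rintro _ ⟨i, rfl⟩
      exact g.herm_eq_zero_comm (hu' i)
    intro s hs
    exact g.herm_eq_zero_comm (LinearMap.mem_ker.1 (hle hs))
  have h4 : Module.finrank Lᵐᵒᵖ (LinearMap.ker Φ) ≤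
      Module.finrank Lᵐᵒᵖ (g.perp T ⊓ U : Submodule Lᵐᵒᵖ V) := by
    have : Module.Finite Lᵐᵒᵖ (g.perp T ⊓ U : Submodule Lᵐᵒᵖ V) :=
      Submodule.finiteDimensional_of_le inf_le_right
    rw [(Submodule.equivMapOfInjective U.subtype U.injective_subtype _).finrank_eq]
    exact Submodule.finrank_mono h3
  omega

theorem finrank_perp_le (g : SigmaForm L V) {U W T : Submodule Lᵐᵒᵖ V} (h : g.Opposite U W)
    (hT : T ≤ W) : Module.finrank Lᵐᵒᵖ (g.perp T ⊓ U : Submodule Lᵐᵒᵖ V) + Module.finrank Lᵐᵒᵖ T ≤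
      Module.finrank Lᵐᵒᵖ U := by
  have := h.finite_left
  have := h.finite_right
  have : Module.Finite Lᵐᵒᵖ T := Submodule.finiteDimensional_of_le hT
  obtain ⟨C, hC⟩ := Submodule.exists_isCompl (T.submoduleOf W)
  set T' : Submodule Lᵐᵒᵖ V := C.map W.subtype with hT'
  have hT'W : T' ≤ W := Submodule.map_subtype_le W C
  have : Module.Finite Lᵐᵒᵖ T' := Submodule.finiteDimensional_of_le hT'W
  have hdim : Module.finrank Lᵐᵒᵖ T + Module.finrank Lᵐᵒᵖ T' = Module.finrank Lᵐᵒᵖ W := by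
    rw [← Submodule.finrank_add_eq_of_isCompl hC, (Submodule.submoduleOfEquivOfLe hT).finrank_eq,
      hT', ← (Submodule.equivMapOfInjective W.subtype W.injective_subtype C).finrank_eq]
  have hsup : W ≤ T ⊔ T' := by
    intro w hw
    have hm : (⟨w, hw⟩ : W) ∈ T.submoduleOf W ⊔ C := by rw [hC.sup_eq_top]; trivial
    obtain ⟨a, ha, c, hc, hac⟩ := Submodule.mem_sup.1 hm
    exact Submodule.mem_sup.2 ⟨a, ha, c, ⟨c, hc, rfl⟩, congrArg Subtype.val hac⟩
  have h1 := g.finrank_le_perp_add T' U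
  have hbot : (g.perp T ⊓ U) ⊓ (g.perp T' ⊓ U) = ⊥ := by
    rw [eq_bot_iff]
    rintro u ⟨⟨hu1, huU⟩, hu2, -⟩
    by_contra hne
    obtain ⟨w, hw, hw0⟩ := h.not_collinear u huU hne
    obtain ⟨a, ha, c, hc, rfl⟩ := Submodule.mem_sup.1 (hsup hw)
    apply hw0
    rw [herm_add_right, g.herm_eq_zero_comm (hu1 a ha), g.herm_eq_zero_comm (hu2 c hc), add_zero]
  have : Module.Finite Lᵐᵒᵖ (g.perp T ⊓ U : Submodule Lᵐᵒᵖ V) :=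
    Submodule.finiteDimensional_of_le inf_le_right
  have : Module.Finite Lᵐᵒᵖ (g.perp T' ⊓ U : Submodule Lᵐᵒᵖ V) :=
    Submodule.finiteDimensional_of_le inf_le_right
  have h2 := Submodule.finrank_sup_add_finrank_inf_eq (g.perp T ⊓ U) (g.perp T' ⊓ U)
  rw [hbot, finrank_bot] at h2
  have h3 : Module.finrank Lᵐᵒᵖ ((g.perp T ⊓ U) ⊔ (g.perp T' ⊓ U) : Submodule Lᵐᵒᵖ V) ≤
      Module.finrank Lᵐᵒᵖ U := Submodule.finrank_mono (sup_le inf_le_right inf_le_right)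
  have := h.finrank_eq
  omega

theorem Opposite.symm {g : SigmaForm L V} {U W : Submodule Lᵐᵒᵖ V} (h : g.Opposite U W) :
    g.Opposite W U := by
  refine ⟨h.singular_right, h.singular_left, h.finite_right, h.finite_left, h.finrank_eq.symm, ?_⟩
  intro w hw hne
  by_contra hcon
  push Not at hcon
  have := h.finite_left
  have := h.finite_right
  have hT : Submodule.span Lᵐᵒᵖ {w} ≤ W := by
    rw [Submodule.span_le]; simpa using hw
  have h1 := g.finrank_perp_le h hT
  rw [finrank_span_singleton hne] at h1
  have h2 : U ≤ g.perp (Submodule.span Lᵐᵒᵖ {w}) ⊓ U := by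
    refine le_inf ?_ le_rfl
    intro u hu s hs
    have : Submodule.span Lᵐᵒᵖ {w} ≤ LinearMap.ker (g.hermRight u) := by
      rw [Submodule.span_le]
      exact Set.singleton_subset_iff.2 (LinearMap.mem_ker.2 (g.herm_eq_zero_comm (hcon u hu)))
    exact g.herm_eq_zero_comm (LinearMap.mem_ker.1 (this hs))
  have : Module.Finite Lᵐᵒᵖ (g.perp (Submodule.span Lᵐᵒᵖ {w}) ⊓ U : Submodule Lᵐᵒᵖ V) :=
    Submodule.finiteDimensional_of_le inf_le_right
  have h3 := Submodule.finrank_mono h2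
  omega

theorem perspectivity_perspectivity (g : SigmaForm L V) {U W : Submodule Lᵐᵒᵖ V}
    (h : g.Opposite U W) (S : Submodule Lᵐᵒᵖ U) :
    g.perspectivity W U (g.perspectivity U W S) = S := by
  have := h.finite_left
  have := h.finite_right
  set S' : Submodule Lᵐᵒᵖ V := S.map U.subtype with hS'
  have hS'U : S' ≤ U := Submodule.map_subtype_le U S
  have : Module.Finite Lᵐᵒᵖ S' := Submodule.finiteDimensional_of_le hS'U
  set T : Submodule Lᵐᵒᵖ V := (g.perspectivity U W S).map W.subtype with hT
  have hT' : T = g.perp S' ⊓ W := by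
    rw [hT, perspectivity, Submodule.map_comap_subtype, inf_comm]
  have hTW : T ≤ W := Submodule.map_subtype_le W _
  have : Module.Finite Lᵐᵒᵖ T := Submodule.finiteDimensional_of_le hTW
  have h1 := g.finrank_le_perp_add S' W
  have h2 := g.finrank_perp_le h hTW
  rw [← hT'] at h1
  have h3 : S' ≤ g.perp T ⊓ U := by
    refine le_inf ?_ hS'U
    intro s hs t ht
    rw [hT'] at ht
    exact g.herm_eq_zero_comm (ht.1 s hs)
  have : Module.Finite Lᵐᵒᵖ (g.perp T ⊓ U : Submodule Lᵐᵒᵖ V) :=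
    Submodule.finiteDimensional_of_le inf_le_right
  have h4 : S' = g.perp T ⊓ U := by
    refine Submodule.eq_of_le_of_finrank_le h3 ?_
    have := h.finrank_eq
    omega
  apply Submodule.map_injective_of_injective U.injective_subtype
  rw [← hS', h4, perspectivity, Submodule.map_comap_subtype, inf_comm]

theorem IsProjectivity.comp {g : SigmaForm L V} {k l : ℕ} {U W X : Submodule Lᵐᵒᵖ V}
    {φ : Submodule Lᵐᵒᵖ U → Submodule Lᵐᵒᵖ W} {ψ : Submodule Lᵐᵒᵖ W → Submodule Lᵐᵒᵖ X}
    (hφ : g.IsProjectivity k U W φ) (hψ : g.IsProjectivity l W X ψ) :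
    g.IsProjectivity (k + l) U X (ψ ∘ φ) := by
  induction hψ with
  | refl => exact hφ
  | step _ hop ih => exact (ih hφ).step hop

theorem IsProjectivity.exists_inverse {g : SigmaForm L V} {k : ℕ} {U W : Submodule Lᵐᵒᵖ V}
    {φ : Submodule Lᵐᵒᵖ U → Submodule Lᵐᵒᵖ W} (hφ : g.IsProjectivity k U W φ) :
    ∃ ψ, g.IsProjectivity k W U ψ ∧ Function.LeftInverse ψ φ := by
  induction hφ with
  | refl U => exact ⟨id, .refl U, fun _ => rfl⟩
  | step _ hop ih =>
    obtain ⟨ψ, hψ, hl⟩ := ih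
    refine ⟨ψ ∘ g.perspectivity _ _, ?_, ?_⟩
    · have := (IsProjectivity.step (.refl _) hop.symm).comp hψ
      rw [Nat.add_comm] at this
      simpa [Nat.add_comm] using this
    · intro S
      simp [perspectivity_perspectivity g hop, hl S]

/-- The special projectivity group `Π⁺(M)`: all self-projectivities of `M` that are compositions
of an even number of perspectivities, as automorphisms of the projective space `M` (that is, of its
lattice of subspaces). -/
def specialProjectivityGroup (g : SigmaForm L V) (M : Submodule Lᵐᵒᵖ V) :
    Subgroup (Submodule Lᵐᵒᵖ M ≃o Submodule Lᵐᵒᵖ M) where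
  carrier := {φ | ∃ k : ℕ, g.IsProjectivity (2 * k) M M φ}
  one_mem' := ⟨0, .refl M⟩
  mul_mem' := by
    rintro φ ψ ⟨k, hk⟩ ⟨l, hl⟩
    refine ⟨l + k, ?_⟩
    rw [Nat.mul_add]
    exact hl.comp hk
  inv_mem' := by
    rintro φ ⟨k, hk⟩
    obtain ⟨ψ, hψ, hl⟩ := hk.exists_inverse
    refine ⟨k, ?_⟩
    have : ψ = (φ⁻¹ : Submodule Lᵐᵒᵖ M ≃o Submodule Lᵐᵒᵖ M) := by
      funext S
      have := hl (φ⁻¹ S)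
      rwa [show φ (φ⁻¹ S) = S from φ.apply_symm_apply S] at this
    rwa [← this]

end SigmaForm

/-! ### Homologies -/

/-- The map `φ` on the subspaces of the right vector space `M` is the homology with axis the
hyperplane `H`, centre `⟨c⟩` (a point outside `H`) and factor `d ≠ 0`: it is induced by the linear
automorphism that fixes `H` pointwise and maps `c` to `c d`.  (Replacing the vector `c` by `c r`
replaces `d` by `r⁻¹ d r`.) -/
def IsHomology {L M : Type*} [DivisionRing L] [AddCommGroup M] [Module Lᵐᵒᵖ M]
    (H : Submodule Lᵐᵒᵖ M) (c : M) (d : L) (φ : Submodule Lᵐᵒᵖ M → Submodule Lᵐᵒᵖ M) : Prop :=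
  IsCoatom H ∧ c ∉ H ∧ d ≠ 0 ∧ ∃ h : M ≃ₗ[Lᵐᵒᵖ] M,
    (∀ x ∈ H, h x = x) ∧ h c = c <• d ∧ ∀ S, φ S = S.map (h : M →ₗ[Lᵐᵒᵖ] M)

/-- All homologies of the projective space `M` with a factor in `N`. -/
def homologiesWithFactorIn {L : Type*} [DivisionRing L] (N : Set L) (M : Type*) [AddCommGroup M]
    [Module Lᵐᵒᵖ M] : Set (Submodule Lᵐᵒᵖ M ≃o Submodule Lᵐᵒᵖ M) :=
  {φ | ∃ H : Submodule Lᵐᵒᵖ M, ∃ c : M, ∃ d ∈ N, IsHomology H c d φ}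

/-! ### The standard form -/

section StandardForm

variable {L V₀ : Type*} [DivisionRing L] [StarRing L] [AddCommGroup V₀] [Module Lᵐᵒᵖ V₀]

/-- The space `V = V₀ ⊕ L^{2n}`; the vector `v₀ + ∑ e_{-i} x_{-i} + ∑ e_i x_i` is the triple
consisting of `v₀`, of the family of all `x_{-i}` and of the family of all `x_i`. -/
abbrev StdSpace (L V₀ : Type*) (n : ℕ) : Type _ := V₀ × (Fin n → L) × (Fin n → L)

/-- The form on `V₀ ⊕ L^{2n}` with
`q(v) = ∑ x_{-i}^σ x_i + q₀(v₀)` and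
`f(v, w) = ∑ (x_{-i}^σ y_i + x_i^σ y_{-i}) + f₀(v₀, w₀)`. -/
def stdForm (n : ℕ) (g₀ : SigmaForm L V₀) : SigmaForm L (StdSpace L V₀ n) where
  toFun v w := ∑ i, star (v.2.1 i) * w.2.2 i + g₀.toFun v.1 w.1
  add_left u v w := by
    simp only [Prod.fst_add, Prod.snd_add, Pi.add_apply, star_add, add_mul,
      Finset.sum_add_distrib, g₀.add_left]
    abel
  add_right u v w := by
    simp only [Prod.fst_add, Prod.snd_add, Pi.add_apply, mul_add,
      Finset.sum_add_distrib, g₀.add_right]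
    abel
  smul_smul v w k l := by
    simp only [Prod.smul_fst, Prod.smul_snd, Pi.smul_apply, MulOpposite.smul_eq_mul_unop,
      MulOpposite.unop_op, star_mul, g₀.smul_smul, mul_add, add_mul, Finset.mul_sum,
      Finset.sum_mul, mul_assoc]

/-- `D(v₀, w₀, t, u) = (g₀(w₀, w₀) + u - u^σ)(g₀(v₀, v₀) + t - t^σ) + f₀(w₀, v₀) + 1`. -/
def normD (g₀ : SigmaForm L V₀) (v₀ w₀ : V₀) (t u : L) : L :=
  (g₀.toFun w₀ w₀ + u - star u) * (g₀.toFun v₀ v₀ + t - star t) + g₀.herm w₀ v₀ + 1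

/-- The norm set `{D(v₀, w₀, t, u) | v₀, w₀ ∈ V₀, t, u ∈ L}`. -/
def normSet (g₀ : SigmaForm L V₀) : Set L :=
  {d | ∃ v₀ w₀ t u, d = normD g₀ v₀ w₀ t u}

variable (L V₀) in
/-- The basis vector `e_{-i}`. -/
def eNeg {n : ℕ} (i : Fin n) : StdSpace L V₀ n := (0, Pi.single i 1, 0)

variable (L V₀) in
/-- The basis vector `e_i`. -/
def ePos {n : ℕ} (i : Fin n) : StdSpace L V₀ n := (0, 0, Pi.single i 1)

variable (L V₀) in
/-- `M₁ = ⟨e_{-1}, …, e_{-n}⟩`. -/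
def stdM₁ (n : ℕ) : Submodule Lᵐᵒᵖ (StdSpace L V₀ n) :=
  Submodule.span Lᵐᵒᵖ (Set.range (eNeg L V₀))

variable (L V₀) in
/-- `M₂ = ⟨e_1, …, e_n⟩`. -/
def stdM₂ (n : ℕ) : Submodule Lᵐᵒᵖ (StdSpace L V₀ n) :=
  Submodule.span Lᵐᵒᵖ (Set.range (ePos L V₀))

/-- `M₃`, spanned by `e_{-j} + v₀ - e_j g₁`, with `g₁ = g₀(v₀, v₀) + t - t^σ`, and by all `e_{-i}`
with `i ≠ j`. -/
def stdM₃ {n : ℕ} (g₀ : SigmaForm L V₀) (j : Fin n) (v₀ : V₀) (t : L) :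
    Submodule Lᵐᵒᵖ (StdSpace L V₀ n) :=
  Submodule.span Lᵐᵒᵖ
    (insert (v₀, Pi.single j 1, Pi.single j (-(g₀.toFun v₀ v₀ + t - star t)))
      (eNeg L V₀ '' {i | i ≠ j}))

/-- `M₄`, spanned by `e_j + w₀ - e_{-j} g₂^σ`, with `g₂ = g₀(w₀, w₀) + u - u^σ`, and by all `e_i`
with `i ≠ j`. -/
def stdM₄ {n : ℕ} (g₀ : SigmaForm L V₀) (j : Fin n) (w₀ : V₀) (u : L) :
    Submodule Lᵐᵒᵖ (StdSpace L V₀ n) :=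
  Submodule.span Lᵐᵒᵖ
    (insert (w₀, Pi.single j (-star (g₀.toFun w₀ w₀ + u - star u)), Pi.single j 1)
      (ePos L V₀ '' {i | i ≠ j}))

variable (L V₀) in
/-- `e_{-j}` as a vector of `M₁`. -/
def stdCentre {n : ℕ} (j : Fin n) : stdM₁ L V₀ n :=
  ⟨eNeg L V₀ j, Submodule.subset_span ⟨j, rfl⟩⟩

variable (L V₀) in
/-- The hyperplane `⟨e_{-i} | i ≠ j⟩` of `M₁`. -/
def stdAxis {n : ℕ} (j : Fin n) : Submodule Lᵐᵒᵖ (stdM₁ L V₀ n) :=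
  Submodule.span Lᵐᵒᵖ (stdCentre L V₀ '' {i | i ≠ j})

end StandardForm

open scoped Pointwise
open Module Submodule

/-! The theorem rests on a description of the norm set: its nonzero elements are exactly the
products of two nonzero values of the anisotropic form, where a value of `v` is any representative
in `L` of the class of `v` in `L / L_σ`. In one direction, for `z ≠ 0` the element `z x + f(w, v) +
1` equals `z (z⁻¹ + x + z⁻¹ f(w, v))`, and the second factor is a value of `w (z⁻¹)^σ + v`. The
converse is `exists_normForm`. The same set of values is visible at every maximal singular subspace
`M`, as the values on `M^⊥` (`HasRank.valueSet_eq`), so that part (a) can be proved for any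
nondegenerate form of finite rank with two different nonzero values (`IsRich`).

Upper bound. The perspectivities from `U` to `Y` and from `Y` to `W` compose to a map induced by a
linear isomorphism, the `transfer`, which is characterised by preserving the pairing with `Y`.
Modulo the group generated by homologies with products of two values as factors, two consecutive
transfers can be replaced by one (`exists_congrHomology_transfer`). Since that group is stable under
conjugation by linear isomorphisms, this reduces every even self-projectivity to a transfer from `M`
to `M`, which is the identity. The replacement moves the intermediate subspace step by step through
adjacent maximal singular subspaces. Each step changes the map by a homology or an elation whose
factor is a cross ratio of four points of the rank one polar space `U^⊥ / U`, with `U` submaximal;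
`crossRatio_mem` shows that such a cross ratio is a product of two values. Elations are quotients of
homologies as soon as some factor differs from `1`. The moves need subspaces opposite three given
ones, hence four maximal singular subspaces through each submaximal one. Two different nonzero
values supply both requirements, and they exist outside the three excluded cases
(`values_nontrivial`).

Lower bound and part (b). Given an axis `A` and a centre `c` in `M`, a frame consisting of an
opposite subspace `B + ⟨y⟩` with `y ⟂ A`, `c ⟂ B` and `f(y, c) = 1` lets the four perspectivities be
computed directly (`IsFrame.homology`): the vector `c` goes to `p = c + v - y x` and then to `c D`,
where `D = f(q, p)` and `q = y + w - c z^σ`. -/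

theorem finrank_right_scalars {L : Type*} [DivisionRing L] : Module.finrank Lᵐᵒᵖ L = 1 :=
  finrank_eq_one (1 : L) one_ne_zero (fun w => ⟨MulOpposite.op w, by simp⟩)

instance finite_right_scalars {L : Type*} [DivisionRing L] : Module.Finite Lᵐᵒᵖ L :=
  Module.finite_of_finrank_eq_succ finrank_right_scalars

/-! ### The trace group -/

section TraceGroup

variable {L : Type*} [DivisionRing L] [StarRing L]

theorem sub_star_mem_traceGroup (t : L) : t - star t ∈ traceGroup L := ⟨t, rfl⟩

theorem conj_mem_traceGroup {x : L} (hx : x ∈ traceGroup L) (d : L) :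
    star d * x * d ∈ traceGroup L := by
  obtain ⟨t, rfl⟩ := hx
  refine ⟨star d * t * d, ?_⟩
  simp only [star_mul, star_star, mul_sub, sub_mul, mul_assoc]

theorem star_eq_neg_of_mem_traceGroup {x : L} (hx : x ∈ traceGroup L) : star x = -x := by
  obtain ⟨t, rfl⟩ := hx
  simp

/-- The trace group is a proper subgroup. -/
theorem exists_notMem_traceGroup : ∃ x : L, x ∉ traceGroup L := by
  by_contra! h
  -- Trace elements are skew. If `L_σ = L`, then `1 = -1` and `t^σ = -t = t`, so that `1 = t - t^σ =
  -- 0`.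
  have h1 : (1 : L) = -1 := by simpa using star_eq_neg_of_mem_traceGroup (h 1)
  obtain ⟨t, ht⟩ := h 1
  have h2 := star_eq_neg_of_mem_traceGroup (h t)
  have h3 : t = -t := by
    calc t = t * 1 := (mul_one t).symm
      _ = t * (-1) := by rw [← h1]
      _ = -t := by simp
  rw [h2, ← h3, sub_self] at ht
  exact one_ne_zero ht

end TraceGroup

/-! ### Values of the pseudo-quadratic form and singular subspaces -/

namespace SigmaForm

variable {L V : Type*} [DivisionRing L] [StarRing L] [AddCommGroup V] [Module Lᵐᵒᵖ V]
variable (g : SigmaForm L V)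

@[simp] theorem herm_zero_right (v : V) : g.herm v 0 = 0 := (g.hermRight v).map_zero

@[simp] theorem herm_zero_left (v : V) : g.herm 0 v = 0 := by rw [← g.star_herm]; simp

theorem herm_add_left (u v w : V) : g.herm (u + v) w = g.herm u w + g.herm v w := by
  rw [← g.star_herm, herm_add_right, star_add, star_herm, star_herm]

theorem herm_neg_right (v w : V) : g.herm v (-w) = -g.herm v w := (g.hermRight v).map_neg w

theorem herm_neg_left (v w : V) : g.herm (-v) w = -g.herm v w := by
  rw [← g.star_herm, herm_neg_right, star_neg, star_herm]

theorem herm_sub_right (u v w : V) : g.herm u (v - w) = g.herm u v - g.herm u w :=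
  (g.hermRight u).map_sub v w

theorem herm_sub_left (u v w : V) : g.herm (u - v) w = g.herm u w - g.herm v w := by
  rw [sub_eq_add_neg, herm_add_left, herm_neg_left, sub_eq_add_neg]

theorem herm_smul_left (v w : V) (l : L) : g.herm (v <• l) w = star l * g.herm v w := by
  rw [← g.star_herm, herm_smul_right, star_mul, star_herm]

/-- The scalar `x` represents the value of the pseudo-quadratic form at `v`. -/
def IsValue (v : V) (x : L) : Prop := x - g.toFun v v ∈ traceGroup L

variable {g}

theorem isValue_toFun (v : V) : g.IsValue v (g.toFun v v) := by simp [IsValue]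

theorem isValue_toFun_add (v : V) (t : L) : g.IsValue v (g.toFun v v + t - star t) := by
  have := sub_star_mem_traceGroup t
  rwa [IsValue, show g.toFun v v + t - star t - g.toFun v v = t - star t by abel]

theorem IsValue.eq_add {v : V} {x : L} (h : g.IsValue v x) :
    ∃ t, x = g.toFun v v + t - star t := by
  obtain ⟨t, ht⟩ := h
  exact ⟨t, by rw [add_sub_assoc, ← ht]; abel⟩

theorem toFun_zero : g.toFun 0 0 = 0 := by simpa using g.smul_smul 0 0 0 0

theorem isValue_zero_iff {x : L} : g.IsValue 0 x ↔ x ∈ traceGroup L := by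
  simp [IsValue, toFun_zero]

theorem quad_eq_zero_iff {v : V} : g.quad v = 0 ↔ g.IsValue v 0 := by
  rw [quad, QuotientAddGroup.eq_zero_iff, IsValue, zero_sub, neg_mem_iff]

theorem IsValue.congr {v : V} {x y : L} (h : g.IsValue v x) (hxy : y - x ∈ traceGroup L) :
    g.IsValue v y := by
  have := add_mem hxy h
  rwa [show y - x + (x - g.toFun v v) = y - g.toFun v v by abel] at this

theorem IsValue.sub_mem {v : V} {x y : L} (h : g.IsValue v x) (h' : g.IsValue v y) :
    y - x ∈ traceGroup L := by
  have := AddSubgroup.sub_mem _ h' h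
  rwa [show y - g.toFun v v - (x - g.toFun v v) = y - x by abel] at this

theorem IsValue.star {v : V} {x : L} (h : g.IsValue v x) : g.IsValue v (star x) := by
  refine h.congr ?_
  have := neg_mem (sub_star_mem_traceGroup x)
  rwa [neg_sub] at this

/-- The expansion of `g(v + w, v + w)` contains `g(w, v)` where `f(v, w)` contains `g(w, v)^σ`; the
two differ by a trace element. -/
theorem IsValue.add {v w : V} {x y : L} (hv : g.IsValue v x) (hw : g.IsValue w y) :
    g.IsValue (v + w) (x + y + g.herm v w) := by
  have := add_mem (add_mem hv hw) (neg_mem (sub_star_mem_traceGroup (g.toFun w v)))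
  rw [IsValue]
  convert this using 1
  simp only [g.add_left, g.add_right, herm]
  abel

theorem IsValue.smul {v : V} {x : L} (hv : g.IsValue v x) (d : L) :
    g.IsValue (v <• d) (Star.star d * x * d) := by
  have := conj_mem_traceGroup hv d
  rw [IsValue]
  convert this using 1
  rw [g.smul_smul]
  simp only [mul_sub, sub_mul]

theorem IsValue.neg {v : V} {x : L} (hv : g.IsValue v x) : g.IsValue (-v) x := by
  simpa using hv.smul (-1)

theorem IsValue.herm_self {v : V} {x : L} (hv : g.IsValue v x) : g.herm v v = x + Star.star x := by
  obtain ⟨t, rfl⟩ := hv.eq_add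
  simp only [herm, star_add, star_sub, star_star]
  abel

/-- Adding a singular vector perpendicular to `v` does not change the values. -/
theorem IsValue.add_of_herm_eq_zero {v w : V} {x : L} (hv : g.IsValue v x) (hw : g.quad w = 0)
    (h : g.herm v w = 0) : g.IsValue (v + w) x := by
  simpa [h] using hv.add (quad_eq_zero_iff.1 hw)

theorem quad_add {v w : V} (hv : g.quad v = 0) (hw : g.quad w = 0) (h : g.herm v w = 0) :
    g.quad (v + w) = 0 :=
  quad_eq_zero_iff.2 ((quad_eq_zero_iff.1 hv).add_of_herm_eq_zero hw h)

theorem quad_smul {v : V} (hv : g.quad v = 0) (a : Lᵐᵒᵖ) : g.quad (a • v) = 0 := by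
  simpa [quad_eq_zero_iff] using (quad_eq_zero_iff.1 hv).smul a.unop

theorem quad_neg {v : V} (hv : g.quad v = 0) : g.quad (-v) = 0 :=
  quad_eq_zero_iff.2 (quad_eq_zero_iff.1 hv).neg

@[simp] theorem quad_zero : g.quad 0 = 0 := by
  simp [quad_eq_zero_iff, isValue_zero_iff, zero_mem]

/-! ### Singular subspaces -/

theorem IsSingular.mono {S T : Submodule Lᵐᵒᵖ V} (hT : g.IsSingular T) (h : S ≤ T) :
    g.IsSingular S := fun v hv => hT v (h hv)

/-- If `f(v, w) ≠ 0`, then scaling `w` makes `f(v, w)` an arbitrary `x`, and the vanishing of the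
form at `v`, `w` and `v + w` puts `x` into `L_σ`, which is a proper subgroup. -/
theorem IsSingular.herm_eq_zero {S : Submodule Lᵐᵒᵖ V} (hS : g.IsSingular S) {v w : V}
    (hv : v ∈ S) (hw : w ∈ S) : g.herm v w = 0 := by
  by_contra hne
  obtain ⟨x, hx⟩ := exists_notMem_traceGroup (L := L)
  apply hx
  have h1 := (quad_eq_zero_iff.1 (hS v hv)).add
    (quad_eq_zero_iff.1 (hS _ (S.smul_mem (MulOpposite.op ((g.herm v w)⁻¹ * x)) hw)))
  have h2 := quad_eq_zero_iff.1 (hS _ (S.add_mem hv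
    (S.smul_mem (MulOpposite.op ((g.herm v w)⁻¹ * x)) hw)))
  have h3 := h2.sub_mem h1
  rwa [herm_smul_right, mul_inv_cancel_left₀ hne, sub_zero, zero_add, zero_add] at h3

theorem mem_perp_iff {S : Submodule Lᵐᵒᵖ V} {w : V} : w ∈ g.perp S ↔ ∀ s ∈ S, g.herm s w = 0 :=
  Iff.rfl

theorem IsSingular.le_perp {S : Submodule Lᵐᵒᵖ V} (hS : g.IsSingular S) : S ≤ g.perp S :=
  fun _ hw _ hs => hS.herm_eq_zero hs hw

theorem perp_antitone {S T : Submodule Lᵐᵒᵖ V} (h : S ≤ T) : g.perp T ≤ g.perp S :=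
  fun _ hw s hs => hw s (h hs)

theorem le_perp_comm {S T : Submodule Lᵐᵒᵖ V} (h : S ≤ g.perp T) : T ≤ g.perp S :=
  fun t ht _ hs => g.herm_eq_zero_comm (h hs t ht)

theorem mem_perp_span_singleton {v w : V} : w ∈ g.perp (Lᵐᵒᵖ ∙ v) ↔ g.herm v w = 0 := by
  refine ⟨fun h => h v (Submodule.mem_span_singleton_self v), fun h s hs => ?_⟩
  obtain ⟨a, rfl⟩ := Submodule.mem_span_singleton.1 hs
  have := g.herm_smul_left v w a.unop
  rw [h, mul_zero] at this
  simpa using this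

theorem perp_sup (S T : Submodule Lᵐᵒᵖ V) : g.perp (S ⊔ T) = g.perp S ⊓ g.perp T := by
  refine le_antisymm (le_inf (perp_antitone le_sup_left) (perp_antitone le_sup_right)) ?_
  intro w ⟨h1, h2⟩ _ hs
  obtain ⟨a, ha, b, hb, rfl⟩ := Submodule.mem_sup.1 hs
  rw [herm_add_left, h1 a ha, h2 b hb, add_zero]

theorem isSingular_sup {S T : Submodule Lᵐᵒᵖ V} (hS : g.IsSingular S) (hT : g.IsSingular T)
    (h : T ≤ g.perp S) : g.IsSingular (S ⊔ T) := by
  intro v hv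
  obtain ⟨a, ha, b, hb, rfl⟩ := Submodule.mem_sup.1 hv
  exact quad_add (hS a ha) (hT b hb) (h hb a ha)

theorem isSingular_span_singleton {v : V} (h : g.quad v = 0) : g.IsSingular (Lᵐᵒᵖ ∙ v) := by
  intro w hw
  obtain ⟨a, rfl⟩ := Submodule.mem_span_singleton.1 hw
  exact quad_smul h a

theorem isSingular_sup_span_singleton {S : Submodule Lᵐᵒᵖ V} (hS : g.IsSingular S) {v : V}
    (h : g.quad v = 0) (hv : v ∈ g.perp S) : g.IsSingular (S ⊔ Lᵐᵒᵖ ∙ v) :=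
  isSingular_sup hS (isSingular_span_singleton h) ((Submodule.span_singleton_le_iff_mem _ _).2 hv)

theorem IsMaximalSingular.mem_of_mem_perp {M : Submodule Lᵐᵒᵖ V} (hM : g.IsMaximalSingular M)
    {v : V} (h : g.quad v = 0) (hv : v ∈ g.perp M) : v ∈ M :=
  (hM.le_of_ge (isSingular_sup_span_singleton hM.1 h hv) le_sup_left)
    (Submodule.mem_sup_right (Submodule.mem_span_singleton_self v))

/-- The dimension of the perpendicular space of `T` in `S` if `T` meets `S` in a subspace
perpendicular to `S`. -/
theorem finrank_add_le_perp_add {S T : Submodule Lᵐᵒᵖ V} (hS : g.IsSingular S)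
    [Module.Finite Lᵐᵒᵖ S] [Module.Finite Lᵐᵒᵖ T] :
    Module.finrank Lᵐᵒᵖ S + Module.finrank Lᵐᵒᵖ (T ⊓ S : Submodule Lᵐᵒᵖ V) ≤
      Module.finrank Lᵐᵒᵖ (g.perp T ⊓ S : Submodule Lᵐᵒᵖ V) + Module.finrank Lᵐᵒᵖ T := by
  -- Since `S` is totally isotropic, `T ⊓ S` imposes no condition on vectors of `S`; only a
  -- complement of it in `T` counts.
  obtain ⟨C, hC⟩ := Submodule.exists_isCompl ((T ⊓ S).submoduleOf T)
  have hle : T ⊓ S ≤ T := inf_le_left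
  set T' : Submodule Lᵐᵒᵖ V := C.map T.subtype with hT'
  have hT'T : T' ≤ T := Submodule.map_subtype_le T C
  have : Module.Finite Lᵐᵒᵖ T' := Submodule.finiteDimensional_of_le hT'T
  have hdim : Module.finrank Lᵐᵒᵖ (T ⊓ S : Submodule Lᵐᵒᵖ V) + Module.finrank Lᵐᵒᵖ T' =
      Module.finrank Lᵐᵒᵖ T := by
    rw [← Submodule.finrank_add_eq_of_isCompl hC, (Submodule.submoduleOfEquivOfLe hle).finrank_eq,
      hT', ← (Submodule.equivMapOfInjective T.subtype T.injective_subtype C).finrank_eq]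
  have hsup : T ≤ (T ⊓ S) ⊔ T' := by
    intro w hw
    have hm : (⟨w, hw⟩ : T) ∈ (T ⊓ S).submoduleOf T ⊔ C := by rw [hC.sup_eq_top]; trivial
    obtain ⟨a, ha, c, hc, hac⟩ := Submodule.mem_sup.1 hm
    exact Submodule.mem_sup.2 ⟨a, ha, c, ⟨c, hc, rfl⟩, congrArg Subtype.val hac⟩
  have h1 := g.finrank_le_perp_add T' S
  have h2 : g.perp T' ⊓ S ≤ g.perp T ⊓ S := by
    rintro v ⟨hv, hvS⟩
    refine ⟨perp_antitone hsup ?_, hvS⟩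
    rw [perp_sup]
    exact ⟨fun _ hs => hS.herm_eq_zero hs.2 hvS, hv⟩
  have : Module.Finite Lᵐᵒᵖ (g.perp T ⊓ S : Submodule Lᵐᵒᵖ V) :=
    Submodule.finiteDimensional_of_le inf_le_right
  have h3 := Submodule.finrank_mono h2
  omega

/-- By maximality, vectors of `S` perpendicular to `M` lie in `M`; the dimension count above then
compares `S` with `M`. Hence all maximal singular subspaces have the same dimension. -/
theorem IsMaximalSingular.finrank_le {M S : Submodule Lᵐᵒᵖ V} (hM : g.IsMaximalSingular M)
    (hS : g.IsSingular S) [Module.Finite Lᵐᵒᵖ M] [Module.Finite Lᵐᵒᵖ S] :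
    Module.finrank Lᵐᵒᵖ S ≤ Module.finrank Lᵐᵒᵖ M := by
  have h1 := finrank_add_le_perp_add (T := M) hS
  have h2 : g.perp M ⊓ S ≤ M ⊓ S := fun v hv => ⟨hM.mem_of_mem_perp (hS v hv.2) hv.1, hv.2⟩
  have : Module.Finite Lᵐᵒᵖ (M ⊓ S : Submodule Lᵐᵒᵖ V) :=
    Submodule.finiteDimensional_of_le inf_le_right
  have h3 := Submodule.finrank_mono h2
  omega

variable (g) in
/-- The values of `f(b, ·)` for the vectors `b` of a basis of `T`. -/
noncomputable def pairing (T : Submodule Lᵐᵒᵖ V) [Module.Finite Lᵐᵒᵖ T] :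
    V →ₗ[Lᵐᵒᵖ] (Fin (Module.finrank Lᵐᵒᵖ T) → L) :=
  LinearMap.pi fun i => g.hermRight (Module.finBasis Lᵐᵒᵖ T i : V)

theorem ker_pairing (T : Submodule Lᵐᵒᵖ V) [Module.Finite Lᵐᵒᵖ T] :
    LinearMap.ker (g.pairing T) = g.perp T := by
  ext v
  rw [LinearMap.mem_ker]
  refine ⟨fun hv => ?_, fun hv => funext fun i => hv _ (Module.finBasis Lᵐᵒᵖ T i).2⟩
  have hv' : ∀ i, g.herm (Module.finBasis Lᵐᵒᵖ T i : V) v = 0 := fun i => congrFun hv i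
  have hs : Submodule.span Lᵐᵒᵖ (Set.range fun i => (Module.finBasis Lᵐᵒᵖ T i : V)) = T := by
    have := congrArg (Submodule.map T.subtype) (Module.finBasis Lᵐᵒᵖ T).span_eq
    rw [Submodule.map_span, Submodule.map_top, Submodule.range_subtype, ← Set.range_comp] at this
    exact this
  have hle : T ≤ g.perp (Lᵐᵒᵖ ∙ v) := by
    conv_lhs => rw [← hs]
    rw [Submodule.span_le]
    rintro _ ⟨i, rfl⟩
    exact mem_perp_span_singleton.2 (g.herm_eq_zero_comm (hv' i))
  exact (Submodule.span_singleton_le_iff_mem _ _).1 (le_perp_comm hle)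

theorem pairing_eq_iff {T : Submodule Lᵐᵒᵖ V} [Module.Finite Lᵐᵒᵖ T] {v w : V} :
    g.pairing T v = g.pairing T w ↔ ∀ t ∈ T, g.herm t v = g.herm t w := by
  rw [← sub_eq_zero, ← map_sub, ← LinearMap.mem_ker, ker_pairing, mem_perp_iff]
  simp_rw [herm_sub_right, sub_eq_zero]

/-- Pairing with `M` sends `S` to a finite-dimensional space, and the kernel `S ⊓ M^⊥` lies in `M`.
-/
theorem IsMaximalSingular.finite_of_isSingular {M S : Submodule Lᵐᵒᵖ V}
    (hM : g.IsMaximalSingular M) (hS : g.IsSingular S) [Module.Finite Lᵐᵒᵖ M] :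
    Module.Finite Lᵐᵒᵖ S := by
  rw [Module.Finite.iff_fg]
  refine Submodule.fg_of_fg_map_of_fg_inf_ker (g.pairing M) ?_ ?_
  · exact Module.Finite.iff_fg.1 inferInstance
  · rw [ker_pairing]
    have : S ⊓ g.perp M ≤ M := fun v hv => hM.mem_of_mem_perp (hS v hv.1) hv.2
    exact Module.Finite.iff_fg.1 (Submodule.finiteDimensional_of_le this)

end SigmaForm

section LinearAlgebra

variable {K V : Type*} [DivisionRing K] [AddCommGroup V] [Module K V]

theorem Submodule.eq_sup_span_singleton {U M : Submodule K V} [Module.Finite K M] (hU : U ≤ M)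
    (h : finrank K M ≤ finrank K U + 1) {c : V} (hc : c ∈ M) (hcU : c ∉ U) : M = U ⊔ K ∙ c := by
  have hle : U ⊔ K ∙ c ≤ M := sup_le hU ((span_singleton_le_iff_mem _ _).2 hc)
  have : Module.Finite K (U ⊔ K ∙ c : Submodule K V) := finiteDimensional_of_le hle
  have hlt : finrank K U < finrank K (U ⊔ K ∙ c : Submodule K V) := by
    refine finrank_lt_finrank_of_lt (lt_of_le_of_ne le_sup_left fun he => hcU ?_)
    rw [he]
    exact mem_sup_right (mem_span_singleton_self c)
  exact (eq_of_le_of_finrank_le hle (by omega)).symm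

theorem Submodule.finrank_sup_span_singleton_le (U : Submodule K V) [Module.Finite K U] (c : V) :
    finrank K (U ⊔ K ∙ c : Submodule K V) ≤ finrank K U + 1 :=
  (finrank_add_le_finrank_add_finrank _ _).trans
    (Nat.add_le_add_left ((finrank_span_le_card {c}).trans (by simp)) _)

theorem Submodule.finrank_sup_span_singleton_eq (U : Submodule K V) [Module.Finite K U] {c : V}
    (hc : c ∉ U) : finrank K (U ⊔ K ∙ c : Submodule K V) = finrank K U + 1 := by
  refine le_antisymm (finrank_sup_span_singleton_le U c) (finrank_lt_finrank_of_lt ?_)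
  refine lt_of_le_of_ne le_sup_left fun he => hc ?_
  rw [he]
  exact mem_sup_right (mem_span_singleton_self c)

end LinearAlgebra

/-! ### Polar spaces of finite rank: opposition, adjacency, invariance of the values -/

namespace SigmaForm

variable {L V : Type*} [DivisionRing L] [StarRing L] [AddCommGroup V] [Module Lᵐᵒᵖ V]
variable {g : SigmaForm L V} {n : ℕ}

variable (g n) in
/-- The polar space of `g` is nondegenerate, of finite rank `n`. -/
structure HasRank : Prop where
  exists_maximal : ∃ M, g.IsMaximalSingular M ∧ Module.Finite Lᵐᵒᵖ M ∧ finrank Lᵐᵒᵖ M = n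
  nondegenerate : ∀ v, g.quad v = 0 → (∀ w, g.herm v w = 0) → v = 0

namespace HasRank

variable (h : g.HasRank n)
include h

theorem finite {S : Submodule Lᵐᵒᵖ V} (hS : g.IsSingular S) : Module.Finite Lᵐᵒᵖ S := by
  obtain ⟨M, hM, hfin, -⟩ := h.exists_maximal
  exact hM.finite_of_isSingular hS

theorem finrank_le {S : Submodule Lᵐᵒᵖ V} (hS : g.IsSingular S) : finrank Lᵐᵒᵖ S ≤ n := by
  obtain ⟨M, hM, hfin, rfl⟩ := h.exists_maximal
  have := hM.finite_of_isSingular hS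
  exact hM.finrank_le hS

theorem finrank_eq {M : Submodule Lᵐᵒᵖ V} (hM : g.IsMaximalSingular M) : finrank Lᵐᵒᵖ M = n := by
  refine (h.finrank_le hM.1).antisymm ?_
  obtain ⟨N, hN, hfin, rfl⟩ := h.exists_maximal
  have := h.finite hM.1
  exact hM.finrank_le hN.1

theorem isMaximalSingular {M : Submodule Lᵐᵒᵖ V} (hM : g.IsSingular M)
    (hn : n ≤ finrank Lᵐᵒᵖ M) : g.IsMaximalSingular M := by
  refine ⟨hM, fun S hS hMS => ?_⟩
  have := h.finite hS
  exact (eq_of_le_of_finrank_le hMS ((h.finrank_le hS).trans hn)).ge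

/-- A singular point collinear to all points of a maximal singular subspace lies in it, so the
points of `M` obstructing opposition are exactly those of the intersection. -/
theorem opposite_iff {M N : Submodule Lᵐᵒᵖ V} (hM : g.IsMaximalSingular M)
    (hN : g.IsMaximalSingular N) : g.Opposite M N ↔ Disjoint M N := by
  constructor
  · intro hMN
    rw [disjoint_def]
    intro v hv hvN
    by_contra hne
    obtain ⟨w, hw, hw0⟩ := hMN.not_collinear v hv hne
    exact hw0 (hN.1.herm_eq_zero hvN hw)
  · intro hd
    refine ⟨hM.1, hN.1, h.finite hM.1, h.finite hN.1, by rw [h.finrank_eq hM, h.finrank_eq hN], ?_⟩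
    intro u hu hne
    by_contra! hcon
    exact hne (disjoint_def.1 hd u hu
      (hN.mem_of_mem_perp (hM.1 u hu) fun s hs => g.herm_eq_zero_comm (hcon s hs)))

theorem isMaximalSingular_right {M N : Submodule Lᵐᵒᵖ V} (hM : g.IsMaximalSingular M)
    (hMN : g.Opposite M N) : g.IsMaximalSingular N :=
  h.isMaximalSingular hMN.singular_right (by rw [← hMN.finrank_eq, h.finrank_eq hM])

theorem eq_sup_span_singleton {U M : Submodule Lᵐᵒᵖ V} (hM : g.IsMaximalSingular M) (hU : U ≤ M)
    (hn : finrank Lᵐᵒᵖ U + 1 = n) {c : V} (hc : c ∈ M) (hcU : c ∉ U) : M = U ⊔ Lᵐᵒᵖ ∙ c := by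
  have := h.finite hM.1
  exact Submodule.eq_sup_span_singleton hU (by rw [hn, h.finrank_eq hM]) hc hcU

theorem isMaximalSingular_sup_span_singleton {U : Submodule Lᵐᵒᵖ V} (hU : g.IsSingular U)
    (hn : finrank Lᵐᵒᵖ U + 1 = n) {c : V} (hc : g.quad c = 0) (hcU : c ∈ g.perp U) (hcn : c ∉ U) :
    g.IsMaximalSingular (U ⊔ Lᵐᵒᵖ ∙ c) := by
  have := h.finite hU
  exact h.isMaximalSingular (isSingular_sup_span_singleton hU hc hcU)
    (by rw [finrank_sup_span_singleton_eq U hcn, hn])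

theorem herm_ne_zero {U M : Submodule Lᵐᵒᵖ V} (hM : g.IsMaximalSingular M) (hU : U ≤ M)
    (hn : finrank Lᵐᵒᵖ U + 1 = n) {b c : V} (hb : b ∈ M) (hbU : b ∉ U) (hc : g.quad c = 0)
    (hcU : c ∈ g.perp U) (hcM : c ∉ M) : g.herm b c ≠ 0 := by
  intro h0
  apply hcM
  refine hM.mem_of_mem_perp hc ?_
  rw [h.eq_sup_span_singleton hM hU hn hb hbU, perp_sup]
  exact ⟨hcU, mem_perp_span_singleton.2 h0⟩

/-- The unique maximal singular subspace through the submaximal singular subspace `U` that is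
nearest to `X`. -/
theorem isMaximalSingular_sup_perp_inf {U X : Submodule Lᵐᵒᵖ V} (hU : g.IsSingular U)
    (hn : finrank Lᵐᵒᵖ U + 1 = n) (hX : g.IsMaximalSingular X) :
    g.IsMaximalSingular (U ⊔ g.perp U ⊓ X) := by
  have hs : g.IsSingular (U ⊔ g.perp U ⊓ X) :=
    isSingular_sup hU (hX.1.mono inf_le_right) inf_le_left
  have := h.finite hU
  have := h.finite hX.1
  by_cases hle : g.perp U ⊓ X ≤ U
  · have h1 := finrank_add_le_perp_add (T := U) hX.1
    have h2 : g.perp U ⊓ X ≤ U ⊓ X := le_inf hle inf_le_right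
    have : Module.Finite Lᵐᵒᵖ (U ⊓ X : Submodule Lᵐᵒᵖ V) := finiteDimensional_of_le inf_le_right
    have h3 := Submodule.finrank_mono h2
    have := h.finrank_eq hX
    omega
  · obtain ⟨x, hx, hxU⟩ := SetLike.not_le_iff_exists.1 hle
    have hM := h.isMaximalSingular_sup_span_singleton hU hn (hX.1 x hx.2) hx.1 hxU
    rwa [← hM.eq_of_le hs (sup_le_sup_left ((span_singleton_le_iff_mem _ _).2 hx) _)]

/-- A point of `N ⊓ X` outside `U` spans `N` together with `U` and lies in `U^⊥ ⊓ X`. So all but one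
of the maximal singular subspaces through `U` meet `X` inside `U`; this is the source of general
position. -/
theorem inf_le_of_ne {U X N : Submodule Lᵐᵒᵖ V} (hn : finrank Lᵐᵒᵖ U + 1 = n)
    (hX : g.IsMaximalSingular X) (hN : g.IsMaximalSingular N) (hUN : U ≤ N)
    (hne : N ≠ U ⊔ g.perp U ⊓ X) : N ⊓ X ≤ U := by
  rintro x ⟨hxN, hxX⟩
  by_contra hxU
  have hx : x ∈ g.perp U := perp_antitone hUN (hN.1.le_perp hxN)
  apply hne
  refine hN.eq_of_le
    (h.isMaximalSingular_sup_perp_inf (hN.1.mono hUN) hn hX).1 ?_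
  rw [h.eq_sup_span_singleton hN hUN hn hxN hxU]
  exact sup_le_sup_left ((span_singleton_le_iff_mem _ _).2 (mem_inf.2 ⟨hx, hxX⟩)) _

/-- If `M ≠ N`, then some maximal singular subspace adjacent to `N` is nearer to `M`. -/
theorem exists_adjacent_nearer {M N : Submodule Lᵐᵒᵖ V} (hM : g.IsMaximalSingular M)
    (hN : g.IsMaximalSingular N) (hne : M ≠ N) :
    ∃ P, g.IsMaximalSingular P ∧ finrank Lᵐᵒᵖ (P ⊓ N : Submodule Lᵐᵒᵖ V) + 1 = n ∧
      finrank Lᵐᵒᵖ (N ⊓ M : Submodule Lᵐᵒᵖ V) < finrank Lᵐᵒᵖ (P ⊓ M : Submodule Lᵐᵒᵖ V) := by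
  obtain ⟨c, hcM, hcN⟩ := SetLike.not_le_iff_exists.1 fun hle => hne (hM.eq_of_le hN.1 hle)
  have := h.finite hN.1
  have := h.finite hM.1
  -- The new subspace is spanned by `c` and the part of `N` collinear to `c`. It contains `N ⊓ M`
  -- because `M ≤ c^⊥`, and it gains the point `c` of `M`.
  set U := g.perp (Lᵐᵒᵖ ∙ c) ⊓ N with hU
  have hUs : g.IsSingular U := hN.1.mono inf_le_right
  have := h.finite hUs
  have hcU : c ∉ U := fun hc => hcN hc.2
  have hcp : c ∈ g.perp U := fun u hu =>
    g.herm_eq_zero_comm (hu.1 c (mem_span_singleton_self c))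
  have h1 := g.finrank_le_perp_add (Lᵐᵒᵖ ∙ c) N
  have hc0 : c ≠ 0 := fun h0 => hcN (by rw [h0]; exact N.zero_mem)
  rw [finrank_span_singleton hc0, h.finrank_eq hN, ← hU] at h1
  have hPs := isSingular_sup_span_singleton hUs (hM.1 c hcM) hcp
  have h2 := h.finrank_le hPs
  rw [finrank_sup_span_singleton_eq U hcU] at h2
  set P := U ⊔ Lᵐᵒᵖ ∙ c with hP
  have hPm : g.IsMaximalSingular P := h.isMaximalSingular_sup_span_singleton hUs (by omega)
    (hM.1 c hcM) hcp hcU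
  have hcP : c ∈ P := mem_sup_right (mem_span_singleton_self c)
  have hUle : U ≤ P ⊓ N := le_inf le_sup_left inf_le_right
  have : Module.Finite Lᵐᵒᵖ P := h.finite hPs
  have : Module.Finite Lᵐᵒᵖ (P ⊓ N : Submodule Lᵐᵒᵖ V) := finiteDimensional_of_le inf_le_right
  have : Module.Finite Lᵐᵒᵖ (P ⊓ M : Submodule Lᵐᵒᵖ V) := finiteDimensional_of_le inf_le_right
  have h3 := Submodule.finrank_mono hUle
  have h4 : finrank Lᵐᵒᵖ (P ⊓ N : Submodule Lᵐᵒᵖ V) < finrank Lᵐᵒᵖ P :=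
    finrank_lt_finrank_of_lt (lt_of_le_of_ne inf_le_left fun he => hcN
      ((inf_eq_left.1 he) hcP))
  rw [h.finrank_eq hPm] at h4
  refine ⟨P, hPm, by omega, finrank_lt_finrank_of_lt (lt_of_le_of_ne (le_inf ?_ inf_le_right) ?_)⟩
  · exact fun x hx => hUle ⟨mem_perp_span_singleton.2 (hM.1.herm_eq_zero hcM hx.2), hx.1⟩ |>.1
  · intro he
    have : c ∈ N ⊓ M := he ▸ ⟨hcP, hcM⟩
    exact hcN this.1

/-- Induction on the distance to a fixed maximal singular subspace. -/
theorem induction_on_adjacent {M : Submodule Lᵐᵒᵖ V} (hM : g.IsMaximalSingular M)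
    {p : Submodule Lᵐᵒᵖ V → Prop} (self : p M)
    (step : ∀ P N, g.IsMaximalSingular P → g.IsMaximalSingular N →
      finrank Lᵐᵒᵖ (P ⊓ N : Submodule Lᵐᵒᵖ V) + 1 = n → p P → p N)
    {N : Submodule Lᵐᵒᵖ V} (hN : g.IsMaximalSingular N) : p N := by
  induction hk : n - finrank Lᵐᵒᵖ (N ⊓ M : Submodule Lᵐᵒᵖ V) using Nat.strong_induction_on
    generalizing N with
  | _ k ih =>
    by_cases hne : M = N
    · exact hne ▸ self
    · obtain ⟨P, hP, hPN, hlt⟩ := h.exists_adjacent_nearer hM hN hne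
      refine step P N hP hN hPN (ih _ ?_ hP rfl)
      have := h.finite hM.1
      have := Submodule.finrank_mono (inf_le_right : P ⊓ M ≤ M)
      rw [h.finrank_eq hM] at this
      omega

end HasRank

variable (g) in
/-- The nonzero values of the pseudo-quadratic form on the perpendicular space of `M`. -/
def valueSet (M : Submodule Lᵐᵒᵖ V) : Set L := {x | x ≠ 0 ∧ ∃ v ∈ g.perp M, g.IsValue v x}

/-- With `c` in `M` but not in `N`, a multiple of `c` added to `v` makes it perpendicular to `N`.
The value does not change, since `c` is singular and perpendicular to `v`. -/
theorem HasRank.valueSet_subset_of_adjacent (h : g.HasRank n) {M N : Submodule Lᵐᵒᵖ V}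
    (hM : g.IsMaximalSingular M) (hN : g.IsMaximalSingular N)
    (hMN : finrank Lᵐᵒᵖ (M ⊓ N : Submodule Lᵐᵒᵖ V) + 1 = n) : g.valueSet M ⊆ g.valueSet N := by
  rintro x ⟨hx0, v, hv, hvx⟩
  refine ⟨hx0, ?_⟩
  have hne : ∀ {A B : Submodule Lᵐᵒᵖ V}, g.IsMaximalSingular A →
      finrank Lᵐᵒᵖ (A ⊓ B : Submodule Lᵐᵒᵖ V) + 1 = n → ∃ c ∈ A, c ∉ B := by
    intro A B hA hAB
    refine SetLike.not_le_iff_exists.1 fun hle => ?_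
    rw [inf_eq_left.2 hle, h.finrank_eq hA] at hAB
    omega
  obtain ⟨c, hcM, hcN⟩ := hne hM hMN
  obtain ⟨d, hdN, hdM⟩ := hne hN (by rwa [inf_comm])
  have hdU : d ∉ M ⊓ N := fun hd => hdM hd.1
  have hdc := h.herm_ne_zero hN inf_le_right hMN hdN hdU (hM.1 c hcM)
    (perp_antitone inf_le_left (hM.1.le_perp hcM)) hcN
  refine ⟨v + c <• (-((g.herm d c)⁻¹ * g.herm d v)), ?_, ?_⟩
  · rw [h.eq_sup_span_singleton hN inf_le_right hMN hdN hdU, perp_sup]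
    refine ⟨add_mem (perp_antitone inf_le_left hv)
      (smul_mem _ _ (perp_antitone inf_le_left (hM.1.le_perp hcM))), ?_⟩
    rw [SetLike.mem_coe, mem_perp_span_singleton, herm_add_right, herm_smul_right, mul_neg,
      mul_inv_cancel_left₀ hdc, add_neg_cancel]
  · refine hvx.add_of_herm_eq_zero (quad_smul (hM.1 c hcM) _) ?_
    rw [herm_smul_right, g.herm_eq_zero_comm (hv c hcM), zero_mul]

theorem HasRank.valueSet_eq (h : g.HasRank n) {M N : Submodule Lᵐᵒᵖ V}
    (hM : g.IsMaximalSingular M) (hN : g.IsMaximalSingular N) : g.valueSet M = g.valueSet N := by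
  refine h.induction_on_adjacent hM (p := fun N => g.valueSet M = g.valueSet N) rfl ?_ hN
  intro P N hP hN hPN ih
  rw [ih]
  refine Set.Subset.antisymm (h.valueSet_subset_of_adjacent hP hN hPN)
    (h.valueSet_subset_of_adjacent hN hP (by rwa [inf_comm]))

end SigmaForm

theorem Submodule.exists_hyperplane_notMem {K V : Type*} [DivisionRing K] [AddCommGroup V]
    [Module K V] {X : Submodule K V} [Module.Finite K X] {x : V} (hx : x ∈ X) (hx0 : x ≠ 0) :
    ∃ U ≤ X, x ∉ U ∧ finrank K U + 1 = finrank K X := by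
  obtain ⟨C, hC⟩ := Submodule.exists_isCompl (K ∙ (⟨x, hx⟩ : X))
  have h0 : (⟨x, hx⟩ : X) ≠ 0 := fun h => hx0 (congrArg Subtype.val h)
  refine ⟨C.map X.subtype, map_subtype_le X C, ?_, ?_⟩
  · rintro ⟨y, hy, hyx⟩
    have : y = ⟨x, hx⟩ := Subtype.ext hyx
    exact h0 (disjoint_def.1 hC.disjoint _ (mem_span_singleton_self _) (this ▸ hy))
  · rw [← Submodule.finrank_add_eq_of_isCompl hC, finrank_span_singleton h0, add_comm,
      ← (Submodule.equivMapOfInjective X.subtype X.injective_subtype C).finrank_eq]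

/-! ### Hyperbolic partners and general position -/

namespace SigmaForm

variable {L V : Type*} [DivisionRing L] [StarRing L] [AddCommGroup V] [Module Lᵐᵒᵖ V]
variable {g : SigmaForm L V} {n : ℕ}

/-- Otherwise `f(c, ·)` vanishes on `U^⊥`, the kernel of the pairing with the finite-dimensional
`U`. It then factors through this pairing and equals `f(s, ·)` for some `s ∈ U`, and nondegeneracy
gives `c = s ∈ U`. -/
theorem exists_herm_ne_zero (hnd : ∀ v, g.quad v = 0 → (∀ w, g.herm v w = 0) → v = 0)
    {M U : Submodule Lᵐᵒᵖ V} (hM : g.IsSingular M) (hU : U ≤ M) [Module.Finite Lᵐᵒᵖ U] {c : V}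
    (hc : c ∈ M) (hcU : c ∉ U) : ∃ x ∈ g.perp U, g.herm c x ≠ 0 := by
  by_contra! hcon
  have hker : LinearMap.ker (g.pairing U) ≤ LinearMap.ker (g.hermRight c) := by
    rw [ker_pairing]
    exact hcon
  obtain ⟨ψ, hψ⟩ := LinearMap.exists_extend
    ((LinearMap.ker (g.pairing U)).liftQ (g.hermRight c) hker ∘ₗ
      (g.pairing U).quotKerEquivRange.symm.toLinearMap)
  have hψ' : ∀ x, ψ (g.pairing U x) = g.herm c x := by
    intro x
    have := LinearMap.congr_fun hψ ⟨g.pairing U x, x, rfl⟩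
    rw [LinearMap.comp_apply] at this
    refine this.trans ?_
    have h2 : (g.pairing U).quotKerEquivRange.symm ⟨g.pairing U x, x, rfl⟩ =
        Submodule.Quotient.mk x := by
      rw [LinearEquiv.symm_apply_eq]
      rfl
    simp only [LinearMap.comp_apply, LinearEquiv.coe_coe]
    rw [h2]
    rfl
  -- The coefficients are those of the functional `ψ` on the pairing with the basis; the involution
  -- compensates the semilinearity of `f` in its first argument.
  set s : V := ∑ i, (finBasis Lᵐᵒᵖ U i : V) <• star (ψ (Pi.single i 1)) with hs
  have hsU : s ∈ U := sum_mem fun i _ => U.smul_mem _ (finBasis Lᵐᵒᵖ U i).2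
  have hsum : ∀ x, g.herm c x = g.herm s x := by
    intro x
    rw [← hψ' x, ← g.star_herm, hs]
    have h1 : g.pairing U x = ∑ i, (Pi.single i 1 : Fin _ → L) <• (g.pairing U x i) := by
      funext j
      simp [Finset.sum_apply, Pi.single_apply]
    have h2 : g.herm x (∑ i, (finBasis Lᵐᵒᵖ U i : V) <• star (ψ (Pi.single i 1))) =
        ∑ i, g.herm x (finBasis Lᵐᵒᵖ U i : V) * star (ψ (Pi.single i 1)) := by
      change g.hermRight x _ = _
      rw [map_sum]
      exact Finset.sum_congr rfl fun i _ => g.herm_smul_right _ _ _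
    conv_lhs => rw [h1]
    rw [h2, map_sum, star_sum]
    refine Finset.sum_congr rfl fun i _ => ?_
    rw [map_smul, star_mul, star_star, star_herm]
    rfl
  have h0 : c - s = 0 := hnd _ (hM _ (sub_mem hc (hU hsU))) fun w => by
    rw [herm_sub_left, hsum, sub_self]
  exact hcU (sub_eq_zero.1 h0 ▸ hsU)

/-- A hyperbolic partner of a singular vector. -/
theorem exists_hyperbolic_partner (hnd : ∀ v, g.quad v = 0 → (∀ w, g.herm v w = 0) → v = 0)
    {M U : Submodule Lᵐᵒᵖ V} (hM : g.IsSingular M) (hU : U ≤ M) [Module.Finite Lᵐᵒᵖ U] {c : V}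
    (hc : c ∈ M) (hcU : c ∉ U) : ∃ d ∈ g.perp U, g.quad d = 0 ∧ g.herm c d = 1 := by
  obtain ⟨x, hxU, hx⟩ := exists_herm_ne_zero hnd hM hU hc hcU
  set y := x <• (g.herm c x)⁻¹ with hy
  have hcy : g.herm c y = 1 := by rw [hy, herm_smul_right, mul_inv_cancel₀ hx]
  have hyc : g.herm y c = 1 := by rw [← star_herm, hcy, star_one]
  have hyU : y ∈ g.perp U := (g.perp U).smul_mem _ hxU
  -- As `f(y, c) = 1`, subtracting `c g(y, y)` cancels the value `g(y, y)` and leaves `f(c, y)`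
  -- unchanged.
  refine ⟨y + c <• (-g.toFun y y), add_mem hyU (smul_mem _ _
    (perp_antitone hU (hM.le_perp hc))), ?_, ?_⟩
  · rw [quad_eq_zero_iff]
    have := (isValue_toFun (g := g) y).add ((quad_eq_zero_iff.1 (hM c hc)).smul (-g.toFun y y))
    simpa [herm_smul_right, herm_neg_right, hyc] using this
  · rw [herm_add_right, hcy, herm_smul_right, hM.herm_eq_zero hc hc, zero_mul, add_zero]

variable (g n) in
/-- The polar space of `g` is nondegenerate, of rank `n`, and there are at least four maximal
singular subspaces through a submaximal one, not all of them with the same nonzero values. -/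
structure IsRich : Prop extends HasRank g n where
  nontrivial_valueSet : ∀ M, g.IsMaximalSingular M → (g.valueSet M).Nontrivial

/-- A submaximal singular subspace is contained in at least four maximal ones. -/
theorem IsRich.exists_ne (h : g.IsRich n) {U N : Submodule Lᵐᵒᵖ V} (hN : g.IsMaximalSingular N)
    (hUN : U ≤ N) (hn : finrank Lᵐᵒᵖ U + 1 = n) (A B C : Submodule Lᵐᵒᵖ V) :
    ∃ P, g.IsMaximalSingular P ∧ U ≤ P ∧ P ≠ A ∧ P ≠ B ∧ P ≠ C := by
  classical
  have hUs := hN.1.mono hUN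
  have := h.finite hUs
  obtain ⟨c, hcN, hcU⟩ := SetLike.not_le_iff_exists.1 (show ¬ N ≤ U from fun hle => by
    rw [le_antisymm hUN hle, h.finrank_eq hN] at hn
    omega)
  obtain ⟨d, hdU, hd, hcd⟩ := exists_hyperbolic_partner h.nondegenerate hN.1 hUN hcN hcU
  have hdc : g.herm d c = 1 := by rw [← star_herm, hcd, star_one]
  have hcp := perp_antitone hUN (hN.1.le_perp hcN)
  -- In the rank one space `U^⊥ / U`, a value `x` at `v ⟂ N` gives the singular vector `d + v' - c
  -- x`, where `v'` is `v` made perpendicular to the hyperbolic pair `c`, `d`.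
  have hpt : ∀ x, (∃ v ∈ g.perp N, g.IsValue v x) → ∃ w ∈ g.perp U, g.quad w = 0 ∧
      g.herm c w = 1 ∧ g.herm d w = -x := by
    rintro x ⟨v, hv, hvx⟩
    set v' := v + c <• (-g.herm d v) with hv'
    have hcv : g.herm c v' = 0 := by
      rw [hv', herm_add_right, herm_smul_right, hN.1.herm_eq_zero hcN hcN, hv c hcN, zero_mul,
        add_zero]
    have hdv : g.herm d v' = 0 := by
      rw [hv', herm_add_right, herm_smul_right, hdc, one_mul, add_neg_cancel]
    have hv'x : g.IsValue v' x := hvx.add_of_herm_eq_zero (quad_smul (hN.1 c hcN) _) (by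
      rw [herm_smul_right, g.herm_eq_zero_comm (hv c hcN), zero_mul])
    refine ⟨d + v' + c <• (-x), ?_, ?_, ?_, ?_⟩
    · exact add_mem (add_mem hdU (add_mem (perp_antitone hUN hv) (smul_mem _ _ hcp)))
        (smul_mem _ _ hcp)
    · rw [quad_eq_zero_iff]
      have h1 := ((quad_eq_zero_iff.1 hd).add hv'x).add
        ((quad_eq_zero_iff.1 (hN.1 c hcN)).smul (-x))
      simpa [herm_smul_right, herm_neg_right, herm_add_left, hdc, hdv, g.herm_eq_zero_comm hcv] using h1
    · simp [herm_smul_right, herm_neg_right, herm_add_right, hcd, hcv, hN.1.herm_eq_zero hcN hcN]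
    · have hdd : g.herm d d = 0 := by simpa using (quad_eq_zero_iff.1 hd).herm_self
      simp [herm_smul_right, herm_neg_right, herm_add_right, hdc, hdv, hdd]
  have hmax : ∀ w ∈ g.perp U, g.quad w = 0 → g.herm c w = 1 →
      g.IsMaximalSingular (U ⊔ Lᵐᵒᵖ ∙ w) ∧ U ⊔ Lᵐᵒᵖ ∙ w ≠ N := by
    intro w hwU hw hcw
    refine ⟨h.isMaximalSingular_sup_span_singleton hUs hn hw hwU fun hwU' => ?_, fun he => ?_⟩
    · rw [hN.1.herm_eq_zero hcN (hUN hwU')] at hcw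
      exact zero_ne_one hcw
    · rw [hN.1.herm_eq_zero hcN (he ▸ mem_sup_right (mem_span_singleton_self w))] at hcw
      exact zero_ne_one hcw
  -- With the normalisation `f(c, w) = 1`, the scalar `f(d, w) = -x` depends only on the subspace `U
  -- ⊔ ⟨w⟩`, so different values give different subspaces.
  have hne : ∀ w w' x x', g.herm c w = 1 → g.herm d w = -x → g.herm c w' = 1 →
      g.herm d w' = -x' → x ≠ x' → U ⊔ Lᵐᵒᵖ ∙ w ≠ U ⊔ Lᵐᵒᵖ ∙ w' := by
    intro w w' x x' h1 h2 h3 h4 hxx he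
    obtain ⟨u, hu, y, hy, hyw⟩ := mem_sup.1 (he ▸ mem_sup_right (mem_span_singleton_self w) :
      w ∈ U ⊔ Lᵐᵒᵖ ∙ w')
    obtain ⟨a, rfl⟩ := mem_span_singleton.1 hy
    have h5 := g.herm_smul_right c w' a.unop
    have h6 := g.herm_smul_right d w' a.unop
    rw [MulOpposite.op_unop] at h5 h6
    rw [← hyw, herm_add_right, hN.1.herm_eq_zero hcN (hUN hu), h5, h3, zero_add, one_mul] at h1
    rw [← hyw, herm_add_right, g.herm_eq_zero_comm (hdU u hu), h6, h4, h1, zero_add, mul_one,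
      neg_inj] at h2
    exact hxx h2.symm
  obtain ⟨x, ⟨hx0, hx⟩, y, ⟨hy0, hy⟩, hxy⟩ := h.nontrivial_valueSet N hN
  obtain ⟨w₀, a0, a1, a2, a3⟩ := hpt 0 ⟨0, zero_mem _, quad_eq_zero_iff.1 quad_zero⟩
  obtain ⟨w₁, b0, b1, b2, b3⟩ := hpt x hx
  obtain ⟨w₂, c0, c1, c2, c3⟩ := hpt y hy
  -- Four distinct candidates, coming from `c` itself and the values `0`, `x`, `y`, cannot all be
  -- among three excluded subspaces.
  obtain ⟨P, hP, hP'⟩ := Finset.exists_mem_notMem_of_card_lt_card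
    (s := {A, B, C}) (t := {N, U ⊔ Lᵐᵒᵖ ∙ w₀, U ⊔ Lᵐᵒᵖ ∙ w₁, U ⊔ Lᵐᵒᵖ ∙ w₂}) (by
      refine lt_of_le_of_lt Finset.card_le_three ?_
      rw [Finset.card_insert_of_notMem, Finset.card_insert_of_notMem,
        Finset.card_insert_of_notMem, Finset.card_singleton]
      · norm_num
      · simpa using hne _ _ _ _ b2 b3 c2 c3 hxy
      · simpa using ⟨hne _ _ _ _ a2 a3 b2 b3 hx0.symm, hne _ _ _ _ a2 a3 c2 c3 hy0.symm⟩
      · simpa using ⟨(hmax _ a0 a1 a2).2.symm, (hmax _ b0 b1 b2).2.symm, (hmax _ c0 c1 c2).2.symm⟩)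
  simp only [Finset.mem_insert, Finset.mem_singleton, not_or] at hP hP'
  refine ⟨P, ?_, ?_, hP'⟩
  · rcases hP with rfl | rfl | rfl | rfl
    exacts [hN, (hmax _ a0 a1 a2).1, (hmax _ b0 b1 b2).1, (hmax _ c0 c1 c2).1]
  · rcases hP with rfl | rfl | rfl | rfl
    exacts [hUN, le_sup_left, le_sup_left, le_sup_left]

theorem IsRich.exists_inf_le (h : g.IsRich n) {U N : Submodule Lᵐᵒᵖ V}
    (hN : g.IsMaximalSingular N) (hUN : U ≤ N) (hn : finrank Lᵐᵒᵖ U + 1 = n)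
    {A B C : Submodule Lᵐᵒᵖ V} (hA : g.IsMaximalSingular A) (hB : g.IsMaximalSingular B)
    (hC : g.IsMaximalSingular C) :
    ∃ P, g.IsMaximalSingular P ∧ U ≤ P ∧ P ⊓ A ≤ U ∧ P ⊓ B ≤ U ∧ P ⊓ C ≤ U := by
  obtain ⟨P, hP, hUP, h1, h2, h3⟩ := h.exists_ne hN hUN hn (U ⊔ g.perp U ⊓ A)
    (U ⊔ g.perp U ⊓ B) (U ⊔ g.perp U ⊓ C)
  exact ⟨P, hP, hUP, h.inf_le_of_ne hn hA hP hUP h1, h.inf_le_of_ne hn hB hP hUP h2,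
    h.inf_le_of_ne hn hC hP hUP h3⟩

/-- A maximal singular subspace `X` that is opposite `A` and `B` and whose intersection with `C` is
at most a point can be replaced by an adjacent one that is opposite `A`, `B` and `C`. -/
theorem IsRich.exists_adjacent_disjoint (h : g.IsRich n) {X A B C : Submodule Lᵐᵒᵖ V}
    (hX : g.IsMaximalSingular X) (hA : g.IsMaximalSingular A) (hB : g.IsMaximalSingular B)
    (hC : g.IsMaximalSingular C) (hXA : Disjoint X A) (hXB : Disjoint X B)
    (hXC : finrank Lᵐᵒᵖ (X ⊓ C : Submodule Lᵐᵒᵖ V) ≤ 1) :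
    ∃ Y, g.IsMaximalSingular Y ∧ n ≤ finrank Lᵐᵒᵖ (X ⊓ Y : Submodule Lᵐᵒᵖ V) + 1 ∧
      Disjoint Y A ∧ Disjoint Y B ∧ Disjoint Y C := by
  have := h.finite hX.1
  by_cases h0 : X ⊓ C = ⊥
  · exact ⟨X, hX, by rw [inf_idem, h.finrank_eq hX]; omega, hXA, hXB, disjoint_iff.2 h0⟩
  obtain ⟨x, hx, hx0⟩ := (Submodule.ne_bot_iff _).1 h0
  -- The hyperplane `U` of `X` avoids the unique point of `X ⊓ C`. A subspace through `U` that meets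
  -- `A`, `B`, `C` only inside `U` is then disjoint from all three.
  obtain ⟨U, hU, hxU, hn⟩ := exists_hyperplane_notMem hx.1 hx0
  rw [h.finrank_eq hX] at hn
  obtain ⟨Y, hY, hUY, h1, h2, h3⟩ := h.exists_inf_le hX hU hn hA hB hC
  have hfin : Module.Finite Lᵐᵒᵖ (X ⊓ Y : Submodule Lᵐᵒᵖ V) := finiteDimensional_of_le inf_le_left
  have hfin : Module.Finite Lᵐᵒᵖ (X ⊓ C : Submodule Lᵐᵒᵖ V) := finiteDimensional_of_le inf_le_left
  have hmono := Submodule.finrank_mono (le_inf hU hUY)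
  refine ⟨Y, hY, by omega, ?_, ?_, ?_⟩
  · exact disjoint_iff_inf_le.2 ((le_inf (h1.trans hU) inf_le_right).trans hXA.le_bot)
  · exact disjoint_iff_inf_le.2 ((le_inf (h2.trans hU) inf_le_right).trans hXB.le_bot)
  · rw [disjoint_def]
    intro y hyY hyC
    have hyU : y ∈ U := h3 ⟨hyY, hyC⟩
    have hspan : X ⊓ C = Lᵐᵒᵖ ∙ x := by
      refine (eq_of_le_of_finrank_le ((span_singleton_le_iff_mem _ _).2 hx) ?_).symm
      rwa [finrank_span_singleton hx0]
    have hy : y ∈ Lᵐᵒᵖ ∙ x := hspan ▸ mem_inf.2 ⟨hU hyU, hyC⟩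
    obtain ⟨a, rfl⟩ := mem_span_singleton.1 hy
    by_contra hne
    have ha : a ≠ 0 := fun ha => hne (by rw [ha, zero_smul])
    exact hxU ((smul_mem_iff U ha).1 hyU)

/-- Starting from `M` itself, `X` is rotated about a hyperplane missing a point of `X ⊓ M`, which
strictly shrinks the intersection. -/
theorem IsRich.exists_disjoint (h : g.IsRich n) {M : Submodule Lᵐᵒᵖ V}
    (hM : g.IsMaximalSingular M) : ∃ X, g.IsMaximalSingular X ∧ Disjoint X M := by
  suffices ∀ k X, g.IsMaximalSingular X → finrank Lᵐᵒᵖ (X ⊓ M : Submodule Lᵐᵒᵖ V) ≤ k →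
      ∃ X, g.IsMaximalSingular X ∧ Disjoint X M from this _ M hM le_rfl
  intro k
  induction k with
  | zero =>
    intro X hX hk
    have := h.finite hM.1
    have : Module.Finite Lᵐᵒᵖ (X ⊓ M : Submodule Lᵐᵒᵖ V) := finiteDimensional_of_le inf_le_right
    exact ⟨X, hX, disjoint_iff.2 (finrank_eq_zero.1 (Nat.le_zero.1 hk))⟩
  | succ k ih =>
    intro X hX hk
    by_cases h0 : X ⊓ M = ⊥
    · exact ⟨X, hX, disjoint_iff.2 h0⟩
    have := h.finite hX.1
    have : Module.Finite Lᵐᵒᵖ (X ⊓ M : Submodule Lᵐᵒᵖ V) := finiteDimensional_of_le inf_le_left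
    obtain ⟨x, hx, hx0⟩ := (Submodule.ne_bot_iff _).1 h0
    obtain ⟨U, hU, hxU, hn⟩ := exists_hyperplane_notMem hx.1 hx0
    rw [h.finrank_eq hX] at hn
    obtain ⟨Y, hY, hUY, h1, -, -⟩ := h.exists_inf_le hX hU hn hM hM hM
    refine ih Y hY ?_
    have hlt : Y ⊓ M < X ⊓ M := lt_of_le_of_ne (le_inf (h1.trans hU) inf_le_right)
      fun he => hxU (h1 (he ▸ hx))
    have := finrank_lt_finrank_of_lt hlt
    omega

end SigmaForm

/-! ### The linear group generated by homologies -/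

section HomologyGroup

variable {L M M' : Type*} [DivisionRing L] [AddCommGroup M] [Module Lᵐᵒᵖ M]
  [AddCommGroup M'] [Module Lᵐᵒᵖ M']

theorem IsCoatom.sup_span_singleton_eq_top {A : Submodule Lᵐᵒᵖ M} (hA : IsCoatom A) {c : M}
    (hc : c ∉ A) : A ⊔ Lᵐᵒᵖ ∙ c = ⊤ := by
  refine hA.2 _ (lt_of_le_of_ne le_sup_left fun he => hc ?_)
  rw [he]
  exact mem_sup_right (mem_span_singleton_self c)

theorem isCoatom_of_sup_span_singleton_eq_top {A : Submodule Lᵐᵒᵖ M} {c : M} (hc : c ∉ A)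
    (h : A ⊔ Lᵐᵒᵖ ∙ c = ⊤) : IsCoatom A := by
  have := covBy_span_singleton_sup hc
  rw [sup_comm, h] at this
  exact covBy_top_iff.1 this

theorem LinearMap.ext_of_sup_span_singleton_eq_top {A : Submodule Lᵐᵒᵖ M} {c : M}
    (h : A ⊔ Lᵐᵒᵖ ∙ c = ⊤) {φ ψ : M →ₗ[Lᵐᵒᵖ] M'} (hA : ∀ x ∈ A, φ x = ψ x) (hc : φ c = ψ c) :
    φ = ψ := by
  refine LinearMap.eqLocus_eq_top.1 (eq_top_iff.2 ?_)
  rw [← h]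
  exact sup_le hA ((span_singleton_le_iff_mem _ _).2 hc)

theorem exists_homology {A : Submodule Lᵐᵒᵖ M} (hA : IsCoatom A) {c : M} (hc : c ∉ A) {d : L}
    (hd : d ≠ 0) : ∃ h : M ≃ₗ[Lᵐᵒᵖ] M, (∀ x ∈ A, h x = x) ∧ h c = c <• d := by
  have key : ∀ e : L, ∃ h : M →ₗ[Lᵐᵒᵖ] M, (∀ x ∈ A, h x = x) ∧ h c = c <• e := by
    intro e
    obtain ⟨h, h1, h2⟩ := LinearMap.exists_extend_of_notMem A.subtype hc (c <• e)
    exact ⟨h, fun x hx => LinearMap.congr_fun h1 ⟨x, hx⟩, h2⟩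
  obtain ⟨h, h1, h2⟩ := key d
  obtain ⟨k, k1, k2⟩ := key d⁻¹
  have htop := hA.sup_span_singleton_eq_top hc
  refine ⟨LinearEquiv.ofLinearMap h k ?_ ?_, h1, h2⟩
  · refine LinearMap.ext_of_sup_span_singleton_eq_top htop (fun x hx => ?_) ?_
    · simp [k1 x hx, h1 x hx]
    · simp [k2, h2, smul_smul, hd]
  · refine LinearMap.ext_of_sup_span_singleton_eq_top htop (fun x hx => ?_) ?_
    · simp [k1 x hx, h1 x hx]
    · simp [k2, h2, smul_smul, hd]

/-- The group of linear automorphisms generated by all linear homologies with a factor in `N`. -/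
def homologyGroup (N : Set L) (M : Type*) [AddCommGroup M] [Module Lᵐᵒᵖ M] :
    Subgroup (M ≃ₗ[Lᵐᵒᵖ] M) :=
  Subgroup.closure {h | ∃ A : Submodule Lᵐᵒᵖ M, ∃ c : M, ∃ d ∈ N,
    IsCoatom A ∧ c ∉ A ∧ (∀ x ∈ A, h x = x) ∧ h c = c <• d}

/-- Conjugation transports axis and centre and keeps the factor. This makes congruence modulo
homologies compatible with composition on both sides. -/
theorem conj_mem_homologyGroup {N : Set L} (R : M' ≃ₗ[Lᵐᵒᵖ] M) {h : M ≃ₗ[Lᵐᵒᵖ] M}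
    (hh : h ∈ homologyGroup N M) : (R ≪≫ₗ h) ≪≫ₗ R.symm ∈ homologyGroup N M' := by
  induction hh using Subgroup.closure_induction with
  | mem h hh =>
    obtain ⟨A, c, d, hd, hA, hc, h1, h2⟩ := hh
    refine Subgroup.subset_closure ⟨A.map R.symm.toLinearMap, R.symm c, d, hd, ?_, ?_, ?_, ?_⟩
    · exact (OrderIso.isCoatom_iff (orderIsoMapComap R.symm) A).2 hA
    · rintro ⟨x, hx, hxc⟩
      exact hc (R.symm.injective hxc ▸ hx)
    · rintro _ ⟨x, hx, rfl⟩
      simp [h1 x hx]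
    · simp [h2]
  | one =>
    have : (R ≪≫ₗ (1 : M ≃ₗ[Lᵐᵒᵖ] M)) ≪≫ₗ R.symm = 1 := by ext; simp
    rw [this]
    exact one_mem _
  | mul h k _ _ ih ik =>
    have : (R ≪≫ₗ (h * k)) ≪≫ₗ R.symm = ((R ≪≫ₗ h) ≪≫ₗ R.symm) * ((R ≪≫ₗ k) ≪≫ₗ R.symm) := by
      ext; simp
    rw [this]
    exact mul_mem ih ik
  | inv h _ ih =>
    have : (R ≪≫ₗ h⁻¹) ≪≫ₗ R.symm = ((R ≪≫ₗ h) ≪≫ₗ R.symm)⁻¹ := by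
      rw [eq_inv_iff_mul_eq_one]
      ext
      simp
    rw [this]
    exact inv_mem ih

/-- For `d ≠ 1` the centre can be moved by a vector of the axis to become an eigenvector. For `d =
1` the map is an elation or the identity, and it is a quotient of two homologies with the same axis
and the same factor different from `1`. -/
theorem mem_homologyGroup_of_isCoatom {N : Set L} (h0 : (0 : L) ∉ N) (h1 : ∃ d ∈ N, d ≠ 1)
    {A : Submodule Lᵐᵒᵖ M} (hA : IsCoatom A) {c : M} (hc : c ∉ A) {h : M ≃ₗ[Lᵐᵒᵖ] M}
    (hfix : ∀ x ∈ A, h x = x) {d : L} (hd : d ∈ N) (hcd : h c - c <• d ∈ A) :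
    h ∈ homologyGroup N M := by
  have shift : ∀ a ∈ A, c + a ∉ A := fun a ha hca => hc (by simpa using sub_mem hca ha)
  by_cases hd1 : d = 1
  · subst hd1
    obtain ⟨d, hd, hd1⟩ := h1
    have hd0 : d - 1 ≠ 0 := sub_ne_zero.2 hd1
    set a := h c - c <• (1 : L) with ha
    have hca : h c = c + a := by simp [ha]
    obtain ⟨k₁, hk₁, hkc₁⟩ := exists_homology hA hc (fun h => h0 (h ▸ hd))
    -- The homology with centre `c + a (d - 1)⁻¹` and factor `d` maps `c` to `c d + a`; the inverse
    -- of the homology with centre `c` takes this to `c + a`.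
    have hc' := shift (a <• (d - 1)⁻¹) (A.smul_mem _ hcd)
    obtain ⟨k₂, hk₂, hkc₂⟩ := exists_homology hA hc' (fun h => h0 (h ▸ hd))
    have hkc₂' : k₂ c = c <• d + a := by
      have h2 : k₂ (c + a <• (d - 1)⁻¹) = k₂ c + a <• (d - 1)⁻¹ := by
        rw [map_add, hk₂ _ (A.smul_mem _ hcd)]
      rw [← add_left_inj (a <• (d - 1)⁻¹), ← h2, hkc₂, smul_add, add_assoc, add_right_inj, smul_smul,
        ← MulOpposite.op_mul]
      have : (d - 1)⁻¹ * d = 1 + (d - 1)⁻¹ := by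
        have := inv_mul_cancel₀ hd0
        rw [mul_sub, mul_one, sub_eq_iff_eq_add] at this
        exact this
      rw [this, MulOpposite.op_add, add_smul, MulOpposite.op_one, one_smul]
    have he : h = k₁⁻¹ * k₂ := by
      rw [eq_inv_mul_iff_mul_eq]
      refine LinearEquiv.toLinearMap_injective
        (LinearMap.ext_of_sup_span_singleton_eq_top (hA.sup_span_singleton_eq_top hc) ?_ ?_)
      · intro x hx
        simp [hfix x hx, hk₁ x hx, hk₂ x hx]
      · simp [hca, hkc₁, hkc₂', hk₁ a hcd]
    rw [he]
    exact mul_mem (inv_mem (Subgroup.subset_closure ⟨A, c, d, hd, hA, hc, hk₁, hkc₁⟩))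
      (Subgroup.subset_closure ⟨A, _, d, hd, hA, hc', hk₂, hkc₂⟩)
  · have hd0 : d - 1 ≠ 0 := sub_ne_zero.2 hd1
    refine Subgroup.subset_closure ⟨A, c + (h c - c <• d) <• (d - 1)⁻¹, d, hd, hA,
      shift _ (A.smul_mem _ hcd), hfix, ?_⟩
    set a := h c - c <• d with ha
    have hca : h c = c <• d + a := by simp [ha]
    rw [map_add, hfix _ (A.smul_mem _ hcd), hca, smul_add, add_assoc, add_right_inj, smul_smul,
      ← MulOpposite.op_mul]
    have : (d - 1)⁻¹ * d = 1 + (d - 1)⁻¹ := by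
      have := inv_mul_cancel₀ hd0
      rw [mul_sub, mul_one, sub_eq_iff_eq_add] at this
      exact this
    rw [this, MulOpposite.op_add, add_smul, MulOpposite.op_one, one_smul]

/-- The dual criterion: `h - 1` has rank at most one, so unless `h = 1` its fixed space is a
hyperplane. If `p` lies in it, then `d = 1` and `h` is an elation; otherwise `p` is the centre of a
homology. -/
theorem mem_homologyGroup_of_sub_mem {N : Set L} (h0 : (0 : L) ∉ N) (h1 : ∃ d ∈ N, d ≠ 1)
    {h : M ≃ₗ[Lᵐᵒᵖ] M} {p : M} (hp : p ≠ 0) (hsub : ∀ x, h x - x ∈ Lᵐᵒᵖ ∙ p) {d : L} (hd : d ∈ N)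
    (hpd : h p = p <• d) : h ∈ homologyGroup N M := by
  by_cases hone : ∀ x, h x = x
  · rw [show h = 1 from LinearEquiv.ext hone]
    exact one_mem _
  push Not at hone
  obtain ⟨c, hc⟩ := hone
  set A : Submodule Lᵐᵒᵖ M := LinearMap.ker (h.toLinearMap - LinearMap.id) with hA
  have hmem : ∀ x, x ∈ A ↔ h x = x := fun x => by simp [hA, sub_eq_zero]
  have hcA : c ∉ A := fun h => hc ((hmem c).1 h)
  obtain ⟨l, hl⟩ := mem_span_singleton.1 (hsub c)
  have hl0 : l ≠ 0 := by
    rintro rfl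
    rw [zero_smul, eq_comm, sub_eq_zero] at hl
    exact hc hl
  have htop : A ⊔ Lᵐᵒᵖ ∙ c = ⊤ := by
    rw [eq_top_iff]
    intro x _
    obtain ⟨m, hm⟩ := mem_span_singleton.1 (hsub x)
    refine mem_sup.2 ⟨x - (m * l⁻¹) • c, ?_, (m * l⁻¹) • c, mem_span_singleton.2 ⟨_, rfl⟩, by simp⟩
    rw [hmem, map_sub, map_smul, ← sub_eq_zero]
    have : h x - (m * l⁻¹) • h c - (x - (m * l⁻¹) • c) = (h x - x) - (m * l⁻¹) • (h c - c) := by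
      rw [smul_sub]; abel
    rw [this, ← hm, ← hl, smul_smul, mul_assoc, inv_mul_cancel₀ hl0, mul_one, sub_self]
  have hAc := isCoatom_of_sup_span_singleton_eq_top hcA htop
  have hfix : ∀ x ∈ A, h x = x := fun x hx => (hmem x).1 hx
  by_cases hpA : p ∈ A
  · have hd1 : d = 1 := by
      rw [hfix p hpA] at hpd
      by_contra hne
      have h2 : p <• (d - 1) = 0 := by
        rw [MulOpposite.op_sub, sub_smul, ← hpd, MulOpposite.op_one, one_smul, sub_self]
      rcases smul_eq_zero.1 h2 with h3 | h3
      · exact hne (sub_eq_zero.1 (MulOpposite.op_eq_zero_iff _ |>.1 h3))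
      · exact hp h3
    subst hd1
    refine mem_homologyGroup_of_isCoatom h0 h1 hAc hcA hfix hd ?_
    rw [MulOpposite.op_one, one_smul, ← hl]
    exact A.smul_mem _ hpA
  · exact mem_homologyGroup_of_isCoatom h0 h1 hAc hpA hfix hd (by rw [hpd, sub_self]; exact zero_mem _)

end HomologyGroup

/-! ### Transfers and cross ratios -/

namespace SigmaForm

variable {L V : Type*} [DivisionRing L] [StarRing L] [AddCommGroup V] [Module Lᵐᵒᵖ V]
variable {g : SigmaForm L V} {n : ℕ} {U U' U'' W : Submodule Lᵐᵒᵖ V}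

/-! ### Linear maps that induce perspectivities -/

theorem Opposite.eq_zero {u : V} (h : g.Opposite U W) (hu : u ∈ U)
    (hp : ∀ w ∈ W, g.herm w u = 0) : u = 0 := by
  by_contra hne
  obtain ⟨w, hw, hw0⟩ := h.not_collinear u hu hne
  exact hw0 (g.herm_eq_zero_comm (hp w hw))

/-- The duality between opposite subspaces, in coordinates. -/
noncomputable def Opposite.pairingEquiv (h : g.Opposite U W) :
    U ≃ₗ[Lᵐᵒᵖ] (Fin (finrank Lᵐᵒᵖ W) → L) :=
  haveI := h.finite_left
  haveI := h.finite_right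
  LinearMap.linearEquivOfInjective ((g.pairing W).comp U.subtype) (by
    rw [← LinearMap.ker_eq_bot, LinearMap.ker_comp, ker_pairing, eq_bot_iff]
    intro u hu
    exact Subtype.ext (h.eq_zero u.2 hu)) (by rw [finrank_right_space, h.finrank_eq])

theorem Opposite.pairingEquiv_eq_iff (h₁ : g.Opposite U W) (h₂ : g.Opposite U' W) (x : U)
    (y : U') : h₁.pairingEquiv x = h₂.pairingEquiv y ↔
      ∀ w ∈ W, g.herm w (x : V) = g.herm w (y : V) :=
  haveI := h₁.finite_right
  pairing_eq_iff

/-- The linear map from `U` to `U'` that induces the composition of the perspectivities from `U` to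
`W` and from `W` to `U'`. -/
noncomputable def transfer (h₁ : g.Opposite U W) (h₂ : g.Opposite U' W) : U ≃ₗ[Lᵐᵒᵖ] U' :=
  h₁.pairingEquiv ≪≫ₗ h₂.pairingEquiv.symm

theorem transfer_eq_iff (h₁ : g.Opposite U W) (h₂ : g.Opposite U' W) {x : U} {y : U'} :
    transfer h₁ h₂ x = y ↔ ∀ w ∈ W, g.herm w (y : V) = g.herm w (x : V) := by
  rw [transfer, LinearEquiv.trans_apply, LinearEquiv.symm_apply_eq, eq_comm,
    Opposite.pairingEquiv_eq_iff]

theorem herm_transfer (h₁ : g.Opposite U W) (h₂ : g.Opposite U' W) (x : U) {w : V} (hw : w ∈ W) :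
    g.herm w (transfer h₁ h₂ x : V) = g.herm w (x : V) :=
  (transfer_eq_iff h₁ h₂).1 rfl w hw

theorem transfer_self (h₁ h₂ : g.Opposite U W) : transfer h₁ h₂ = LinearEquiv.refl Lᵐᵒᵖ U :=
  LinearEquiv.ext fun _ => (transfer_eq_iff h₁ h₂).2 fun _ _ => rfl

theorem transfer_symm (h₁ : g.Opposite U W) (h₂ : g.Opposite U' W) :
    (transfer h₁ h₂).symm = transfer h₂ h₁ := rfl

theorem transfer_trans (h₁ : g.Opposite U W) (h₂ : g.Opposite U' W) (h₃ : g.Opposite U'' W) :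
    transfer h₁ h₂ ≪≫ₗ transfer h₂ h₃ = transfer h₁ h₃ :=
  LinearEquiv.ext fun x => ((transfer_eq_iff h₁ h₃).2 fun w hw => by
    rw [LinearEquiv.trans_apply, herm_transfer _ _ _ hw, herm_transfer _ _ _ hw]).symm

/-- Since `θ` preserves the pairing with `W`, the subspaces `S` and `θ(S)` have the same
perpendicular space in `W`, and the perspectivity from `U'` to `W` is undone by the one back. -/
theorem perspectivity_comp_perspectivity (h₂ : g.Opposite U' W)
    {θ : U ≃ₗ[Lᵐᵒᵖ] U'} (hθ : ∀ x : U, ∀ w ∈ W, g.herm w (θ x : V) = g.herm w (x : V))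
    (S : Submodule Lᵐᵒᵖ U) :
    g.perspectivity W U' (g.perspectivity U W S) = S.map (θ : U →ₗ[Lᵐᵒᵖ] U') := by
  have : g.perspectivity U W S = g.perspectivity U' W (S.map (θ : U →ₗ[Lᵐᵒᵖ] U')) := by
    ext w
    constructor
    · rintro hw _ ⟨_, ⟨x, hx, rfl⟩, rfl⟩
      have := hw (x : V) ⟨x, hx, rfl⟩
      exact g.herm_eq_zero_comm ((hθ x w w.2).trans (g.herm_eq_zero_comm this))
    · rintro hw _ ⟨x, hx, rfl⟩
      have := hw (θ x : V) ⟨θ x, ⟨x, hx, rfl⟩, rfl⟩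
      exact g.herm_eq_zero_comm ((hθ x w w.2).symm.trans (g.herm_eq_zero_comm this))
  rw [this, perspectivity_perspectivity g h₂]

/-! ### Values and cross ratios -/

theorem star_mem_valueSet {M : Submodule Lᵐᵒᵖ V} {x : L} (hx : x ∈ g.valueSet M) :
    star x ∈ g.valueSet M := by
  obtain ⟨h0, v, hv, hvx⟩ := hx
  exact ⟨star_ne_zero.2 h0, v, hv, hvx.star⟩

theorem conj_mem_valueSet {M : Submodule Lᵐᵒᵖ V} {x : L} (hx : x ∈ g.valueSet M) {d : L}
    (hd : d ≠ 0) : star d * x * d ∈ g.valueSet M := by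
  obtain ⟨h0, v, hv, hvx⟩ := hx
  exact ⟨mul_ne_zero (mul_ne_zero (star_ne_zero.2 hd) h0) hd, v <• d, smul_mem _ _ hv, hvx.smul d⟩

/-- Conjugating `x` by `(x^σ)⁻¹` gives `(x^σ)⁻¹`, and the values are stable under `σ`. -/
theorem inv_mem_valueSet {M : Submodule Lᵐᵒᵖ V} {x : L} (hx : x ∈ g.valueSet M) :
    x⁻¹ ∈ g.valueSet M := by
  have h0 := hx.1
  have := star_mem_valueSet (conj_mem_valueSet hx (inv_ne_zero (star_ne_zero.2 h0)))
  simpa [star_inv₀, h0] using this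

theorem one_mem_valueSet_mul {M : Submodule Lᵐᵒᵖ V} (h : (g.valueSet M).Nonempty) :
    (1 : L) ∈ g.valueSet M * g.valueSet M := by
  obtain ⟨x, hx⟩ := h
  exact Set.mem_mul.2 ⟨x, hx, x⁻¹, inv_mem_valueSet hx, mul_inv_cancel₀ hx.1⟩

theorem zero_notMem_valueSet_mul {M : Submodule Lᵐᵒᵖ V} :
    (0 : L) ∉ g.valueSet M * g.valueSet M := by
  intro h0
  obtain ⟨x, hx, y, hy, hxy⟩ := Set.mem_mul.1 h0
  exact mul_ne_zero hx.1 hy.1 hxy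

theorem exists_ne_one_mem_valueSet_mul {M : Submodule Lᵐᵒᵖ V} (h : (g.valueSet M).Nontrivial) :
    ∃ d ∈ g.valueSet M * g.valueSet M, d ≠ 1 := by
  obtain ⟨x, hx, y, hy, hxy⟩ := h
  exact ⟨x * y⁻¹, Set.mul_mem_mul hx (inv_mem_valueSet hy), fun h1 =>
    hxy ((mul_inv_eq_one₀ hy.1).1 h1)⟩

section CrossRatio

variable {M : Submodule Lᵐᵒᵖ V} (h : g.HasRank n) (hM : g.IsMaximalSingular M)
  (hU : g.IsSingular U) (hn : finrank Lᵐᵒᵖ U + 1 = n)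
include h hM hU hn

/-- After scaling to `f(b, a') = f(b, c') = 1` and setting `l = f(a', c')`, the vector `c' - a' - b
l` is perpendicular to the maximal singular subspace `U ⊔ ⟨b⟩` and has `-l` as a value. -/
theorem HasRank.exists_herm_eq {a b c : V} (ha : a ∈ g.perp U) (hb : b ∈ g.perp U)
    (hc : c ∈ g.perp U) (ha0 : g.quad a = 0) (hb0 : g.quad b = 0) (hc0 : g.quad c = 0)
    (hab : g.herm a b ≠ 0) (hbc : g.herm b c ≠ 0) (hac : g.herm a c ≠ 0) :
    ∃ x ∈ g.valueSet M, g.herm a c = -(g.herm a b * x * g.herm b c) := by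
  have hba : g.herm b a ≠ 0 := fun h0 => hab (g.herm_eq_zero_comm h0)
  have hbU : b ∉ U := fun hbU => hba (ha b hbU)
  have hmax := h.isMaximalSingular_sup_span_singleton hU hn hb0 hb hbU
  set a' := a <• (g.herm b a)⁻¹ with ha'
  set c' := c <• (g.herm b c)⁻¹ with hc'
  set l := g.herm a' c' with hl
  have hba' : g.herm b a' = 1 := by rw [ha', herm_smul_right, mul_inv_cancel₀ hba]
  have hbc' : g.herm b c' = 1 := by rw [hc', herm_smul_right, mul_inv_cancel₀ hbc]
  have hab' : g.herm a' b = 1 := by rw [← star_herm, hba', star_one]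
  have hcb' : g.herm c' b = 1 := by rw [← star_herm, hbc', star_one]
  have hbb : g.herm b b = 0 := by simpa using (quad_eq_zero_iff.1 hb0).herm_self
  have hval : g.IsValue (c' + -a' + b <• (-l)) (-l) := by
    have ha'0 : g.quad a' = 0 := quad_smul ha0 _
    have hc'0 : g.quad c' = 0 := quad_smul hc0 _
    have h1 := (((quad_eq_zero_iff.1 hc'0).add (quad_eq_zero_iff.1 (quad_neg ha'0))).add
      ((quad_eq_zero_iff.1 hb0).smul (-l))).star
    rw [herm_smul_right, g.herm_add_left c', herm_neg_left, hab', hcb'] at h1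
    simpa [herm_neg_right, star_herm] using h1
  have hlac : g.herm a c = g.herm a b * l * g.herm b c := by
    rw [hl, ha', hc', herm_smul_left, herm_smul_right, star_inv₀, star_herm]
    simp only [mul_assoc]
    rw [inv_mul_cancel₀ hbc, mul_one, mul_inv_cancel_left₀ hab]
  have hl0 : l ≠ 0 := by
    intro h0
    rw [h0, mul_zero, zero_mul] at hlac
    exact hac hlac
  refine ⟨-l, ?_, by rw [hlac]; simp⟩
  rw [h.valueSet_eq hM hmax]
  refine ⟨neg_ne_zero.2 hl0, _, ?_, hval⟩
  rw [perp_sup]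
  refine ⟨add_mem (add_mem (smul_mem _ _ hc) (neg_mem (smul_mem _ _ ha))) (smul_mem _ _ hb), ?_⟩
  rw [SetLike.mem_coe, mem_perp_span_singleton, herm_add_right, herm_add_right, herm_neg_right,
    hba', hbc', herm_smul_right, hbb, zero_mul, add_zero, add_neg_cancel]

/-- The preceding lemma writes `f(y', y)` once through `p`, with a value `x`, and once through `p'`,
with a value `z`. Comparing the two gives the cross ratio `x (w^σ z⁻¹ w)` with `w = f(y, p')⁻¹ f(y,
p)`, and the second factor is again a value. -/
theorem HasRank.crossRatio_mem (hne : (g.valueSet M).Nonempty) {p p' y y' : V}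
    (hp : p ∈ g.perp U) (hp' : p' ∈ g.perp U)
    (hy : y ∈ g.perp U) (hy' : y' ∈ g.perp U) (hp0 : g.quad p = 0) (hp'0 : g.quad p' = 0)
    (hy0 : g.quad y = 0) (hy'0 : g.quad y' = 0) (h₁ : g.herm y p ≠ 0) (h₂ : g.herm y p' ≠ 0)
    (h₃ : g.herm y' p ≠ 0) (h₄ : g.herm y' p' ≠ 0) :
    (g.herm y' p)⁻¹ * g.herm y' p' * ((g.herm y p')⁻¹ * g.herm y p) ∈
      g.valueSet M * g.valueSet M := by
  -- If `y` and `y'` are collinear, they represent the same point modulo `U` and the cross ratio is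
  -- `1 = x x⁻¹`.
  by_cases hyy : g.herm y' y = 0
  · have hyU : y ∉ U := fun hyU => h₁ (hp y hyU)
    have hmax := h.isMaximalSingular_sup_span_singleton hU hn hy0 hy hyU
    have hmem : y' ∈ U ⊔ Lᵐᵒᵖ ∙ y := by
      refine hmax.mem_of_mem_perp hy'0 ?_
      rw [perp_sup]
      exact ⟨hy', mem_perp_span_singleton.2 (g.herm_eq_zero_comm hyy)⟩
    obtain ⟨u, hu, z, hz, rfl⟩ := mem_sup.1 hmem
    obtain ⟨a, rfl⟩ := mem_span_singleton.1 hz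
    have key : ∀ q ∈ g.perp U, g.herm (u + a • y) q = star a.unop * g.herm y q := by
      intro q hq
      rw [herm_add_left, hq u hu, zero_add]
      exact g.herm_smul_left y q a.unop
    rw [key p hp] at h₃ ⊢
    rw [key p' hp']
    have ha := left_ne_zero_of_mul h₃
    convert one_mem_valueSet_mul hne using 1
    rw [mul_inv_rev]
    simp only [mul_assoc]
    rw [inv_mul_cancel_left₀ ha, mul_inv_cancel_left₀ h₂, inv_mul_cancel₀ h₁]
  · have h₁' : g.herm p y ≠ 0 := fun h0 => h₁ (g.herm_eq_zero_comm h0)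
    have h₂' : g.herm p' y ≠ 0 := fun h0 => h₂ (g.herm_eq_zero_comm h0)
    obtain ⟨x, hx, hx1⟩ := h.exists_herm_eq hM hU hn hy' hp hy hy'0 hp0 hy0 h₃ h₁' hyy
    obtain ⟨z, hz, hz1⟩ := h.exists_herm_eq hM hU hn hy' hp' hy hy'0 hp'0 hy0 h₄ h₂' hyy
    rw [hx1, neg_inj] at hz1
    set w := (g.herm y p')⁻¹ * g.herm y p with hw
    have hw0 : w ≠ 0 := mul_ne_zero (inv_ne_zero h₂) h₁
    refine Set.mem_mul.2 ⟨x, hx, _, conj_mem_valueSet (inv_mem_valueSet hz) hw0, ?_⟩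
    have hsw : star w = g.herm p y * (g.herm p' y)⁻¹ := by
      rw [hw, star_mul, star_inv₀, star_herm, star_herm]
    have h5 : g.herm y' p' = g.herm y' p * x * g.herm p y * (g.herm p' y)⁻¹ * z⁻¹ := by
      rw [hz1, mul_inv_cancel_right₀ h₂', mul_inv_cancel_right₀ hz.1]
    rw [h5, hsw]
    simp only [mul_assoc]
    rw [inv_mul_cancel_left₀ h₃]

end CrossRatio

end SigmaForm

/-! ### Linear isomorphisms modulo homologies -/

section CongrMod

variable {L U W W' : Type*} [DivisionRing L] [AddCommGroup U] [Module Lᵐᵒᵖ U]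
  [AddCommGroup W] [Module Lᵐᵒᵖ W] [AddCommGroup W'] [Module Lᵐᵒᵖ W'] {N : Set L}

/-- Two linear isomorphisms differ by an element of the homology group. -/
def CongrHomology (N : Set L) (S T : U ≃ₗ[Lᵐᵒᵖ] W) : Prop := S ≪≫ₗ T.symm ∈ homologyGroup N U

theorem CongrHomology.refl (T : U ≃ₗ[Lᵐᵒᵖ] W) : CongrHomology N T T := by
  rw [CongrHomology, LinearEquiv.self_trans_symm]
  exact one_mem _

theorem CongrHomology.trans {S T R : U ≃ₗ[Lᵐᵒᵖ] W} (h₁ : CongrHomology N S T)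
    (h₂ : CongrHomology N T R) : CongrHomology N S R := by
  have : S ≪≫ₗ R.symm = (T ≪≫ₗ R.symm) * (S ≪≫ₗ T.symm) := by ext; simp
  rw [CongrHomology, this]
  exact mul_mem h₂ h₁

theorem CongrHomology.trans_right {S T : U ≃ₗ[Lᵐᵒᵖ] W} (h : CongrHomology N S T)
    (R : W ≃ₗ[Lᵐᵒᵖ] W') : CongrHomology N (S ≪≫ₗ R) (T ≪≫ₗ R) := by
  have : (S ≪≫ₗ R) ≪≫ₗ (T ≪≫ₗ R).symm = S ≪≫ₗ T.symm := by ext; simp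
  rwa [CongrHomology, this]

theorem CongrHomology.trans_left (R : U ≃ₗ[Lᵐᵒᵖ] W) {S T : W ≃ₗ[Lᵐᵒᵖ] W'}
    (h : CongrHomology N S T) : CongrHomology N (R ≪≫ₗ S) (R ≪≫ₗ T) := by
  have : (R ≪≫ₗ S) ≪≫ₗ (R ≪≫ₗ T).symm = (R ≪≫ₗ (S ≪≫ₗ T.symm)) ≪≫ₗ R.symm := by ext; simp
  rw [CongrHomology, this]
  exact conj_mem_homologyGroup R h

theorem orderIsoMapComap_mem_closure {T : U ≃ₗ[Lᵐᵒᵖ] U} (h0 : (0 : L) ∉ N)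
    (hT : T ∈ homologyGroup N U) :
    orderIsoMapComap T ∈ Subgroup.closure (homologiesWithFactorIn N U) := by
  induction hT using Subgroup.closure_induction with
  | mem T hT =>
    obtain ⟨A, c, d, hd, hA, hc, h1, h2⟩ := hT
    exact Subgroup.subset_closure ⟨A, c, d, hd, hA, hc, fun h => h0 (h ▸ hd), T, h1, h2,
      fun _ => rfl⟩
  | one =>
    have : orderIsoMapComap (1 : U ≃ₗ[Lᵐᵒᵖ] U) = 1 := by
      refine OrderIso.ext (funext fun S => ?_)
      exact Submodule.map_id S
    rw [this]
    exact one_mem _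
  | mul S T _ _ hS hT =>
    have : orderIsoMapComap (S * T) = orderIsoMapComap S * orderIsoMapComap T := by
      refine OrderIso.ext (funext fun X => ?_)
      exact Submodule.map_comp (T : U →ₗ[Lᵐᵒᵖ] U) (S : U →ₗ[Lᵐᵒᵖ] U) X
    rw [this]
    exact mul_mem hS hT
  | inv T _ hT =>
    have : orderIsoMapComap T⁻¹ = (orderIsoMapComap T)⁻¹ := by
      rw [eq_inv_iff_mul_eq_one]
      refine OrderIso.ext (funext fun X => ?_)
      change (X.map (T : U →ₗ[Lᵐᵒᵖ] U)).map (T.symm : U →ₗ[Lᵐᵒᵖ] U) = X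
      rw [← Submodule.map_comp, LinearEquiv.symm_comp, Submodule.map_id]
    rw [this]
    exact inv_mem hT

end CongrMod

/-! ### Closed chains of two transfers with adjacent subspaces -/

namespace SigmaForm

variable {L V : Type*} [DivisionRing L] [StarRing L] [AddCommGroup V] [Module Lᵐᵒᵖ V]
variable {g : SigmaForm L V} {n : ℕ} {M U W W' Y Y' : Submodule Lᵐᵒᵖ V}

theorem mem_of_herm_eq_zero {p y z : V} (hy : y ∈ g.perp U) (hyp : g.herm y p ≠ 0)
    (hz : z ∈ U ⊔ Lᵐᵒᵖ ∙ p) (hyz : g.herm y z = 0) : z ∈ U := by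
  obtain ⟨u, hu, x, hx, rfl⟩ := mem_sup.1 hz
  obtain ⟨a, rfl⟩ := mem_span_singleton.1 hx
  have h1 : g.herm y (a • p) = g.herm y p * a.unop := g.herm_smul_right y p a.unop
  rw [herm_add_right, g.herm_eq_zero_comm (hy u hu), zero_add, h1] at hyz
  have ha : a = 0 := (MulOpposite.unop_eq_zero_iff a).1 ((mul_eq_zero.1 hyz).resolve_left hyp)
  rwa [ha, zero_smul, add_zero]

theorem exists_mem_perp_ne_zero {X : Submodule Lᵐᵒᵖ V} [Module.Finite Lᵐᵒᵖ U]
    [Module.Finite Lᵐᵒᵖ X] (h : finrank Lᵐᵒᵖ U < finrank Lᵐᵒᵖ X) :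
    ∃ x ∈ X, x ∈ g.perp U ∧ x ≠ 0 := by
  have h1 := g.finrank_le_perp_add U X
  have h2 : g.perp U ⊓ X ≠ ⊥ := by
    intro h0
    rw [h0, finrank_bot] at h1
    omega
  obtain ⟨x, hx, hx0⟩ := (Submodule.ne_bot_iff _).1 h2
  exact ⟨x, hx.2, hx.1, hx0⟩

theorem HasRank.finrank_inf_add_one (h : g.HasRank n) (hW : g.IsMaximalSingular W)
    (hW' : g.IsMaximalSingular W') (hne : W ≠ W')
    (hadj : n ≤ finrank Lᵐᵒᵖ (W ⊓ W' : Submodule Lᵐᵒᵖ V) + 1) :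
    finrank Lᵐᵒᵖ (W ⊓ W' : Submodule Lᵐᵒᵖ V) + 1 = n := by
  have := h.finite hW.1
  have hlt : W ⊓ W' < W := lt_of_le_of_ne inf_le_left fun he =>
    hne (hW.eq_of_le hW'.1 (inf_eq_left.1 he))
  have := finrank_lt_finrank_of_lt hlt
  rw [h.finrank_eq hW] at this
  omega

theorem HasRank.exists_mem_notMem_inf (h : g.HasRank n) (hW : g.IsMaximalSingular W)
    (hn : finrank Lᵐᵒᵖ (W ⊓ W' : Submodule Lᵐᵒᵖ V) + 1 = n) : ∃ p ∈ W, p ∉ W ⊓ W' := by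
  refine SetLike.not_le_iff_exists.1 fun hle => ?_
  rw [le_antisymm inf_le_left hle, h.finrank_eq hW] at hn
  omega

section

variable (h : g.IsRich n) (hM : g.IsMaximalSingular M) (hW : g.IsMaximalSingular W)
  (h₁ : g.Opposite W Y) (h₂ : g.Opposite W' Y) (h₃ : g.Opposite W' Y') (h₄ : g.Opposite W Y')
include h hM hW

/-- Both transfers fix `W ⊓ W'` pointwise. Modulo this hyperplane a vector is determined by its
pairing with `y ∈ Y`, respectively `y' ∈ Y'`, perpendicular to it, so `p` is multiplied by a cross
ratio. -/
theorem IsRich.transfer_trans_transfer_mem_of_adjacent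
    (hadj : n ≤ finrank Lᵐᵒᵖ (W ⊓ W' : Submodule Lᵐᵒᵖ V) + 1) :
    transfer h₁ h₂ ≪≫ₗ transfer h₃ h₄ ∈ homologyGroup (g.valueSet M * g.valueSet M) W := by
  by_cases hne : W = W'
  · subst hne
    rw [transfer_self, transfer_self]
    exact one_mem _
  have hY := h.isMaximalSingular_right hW h₁
  have hY' := h.isMaximalSingular_right hW h₄
  have hW' := h.isMaximalSingular_right hY h₂.symm
  have hn := h.finrank_inf_add_one hW hW' hne hadj
  have hn' : finrank Lᵐᵒᵖ (W' ⊓ W : Submodule Lᵐᵒᵖ V) + 1 = n := by rwa [inf_comm]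
  obtain ⟨p, hpW, hpU⟩ := h.exists_mem_notMem_inf hW hn
  obtain ⟨p', hp'W, hp'U⟩ := h.exists_mem_notMem_inf hW' hn'
  rw [inf_comm] at hp'U
  set U := W ⊓ W' with hU
  have hUW : U ≤ W := inf_le_left
  have hUW' : U ≤ W' := inf_le_right
  have hWU := h.eq_sup_span_singleton hW hUW hn hpW hpU
  have hW'U := h.eq_sup_span_singleton hW' hUW' hn hp'W hp'U
  have := h.finite hY.1
  have := h.finite hY'.1
  have := h.finite (hW.1.mono hUW)
  obtain ⟨y, hyY, hy, hy0⟩ := exists_mem_perp_ne_zero (g := g) (U := U) (X := Y)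
    (by rw [h.finrank_eq hY]; omega)
  obtain ⟨y', hyY', hy', hy'0⟩ := exists_mem_perp_ne_zero (g := g) (U := U) (X := Y')
    (by rw [h.finrank_eq hY']; omega)
  have ne : ∀ {X Z : Submodule Lᵐᵒᵖ V} {q z : V}, g.IsMaximalSingular X → g.Opposite X Z → U ≤ X →
      q ∈ X → q ∉ U → z ∈ Z → z ∈ g.perp U → z ≠ 0 → g.herm z q ≠ 0 := by
    intro X Z q z hX hXZ hUX hq hqU hz hzU hz0 h0
    refine hz0 (hXZ.symm.eq_zero hz fun x hx => ?_)
    rw [h.eq_sup_span_singleton hX hUX hn hq hqU] at hx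
    have hz' : z ∈ g.perp (U ⊔ Lᵐᵒᵖ ∙ q) := by
      rw [perp_sup]
      exact ⟨hzU, mem_perp_span_singleton.2 (g.herm_eq_zero_comm h0)⟩
    exact hz' x hx
  have hyp := ne hW h₁ hUW hpW hpU hyY hy hy0
  have hyp' := ne hW' h₂ hUW' hp'W hp'U hyY hy hy0
  have hy'p := ne hW h₄ hUW hpW hpU hyY' hy' hy'0
  have hy'p' := ne hW' h₃ hUW' hp'W hp'U hyY' hy' hy'0
  have hcr := h.crossRatio_mem hM (hW.1.mono hUW) hn (h.nontrivial_valueSet M hM).nonempty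
    (perp_antitone hUW (hW.1.le_perp hpW)) (perp_antitone hUW' (hW'.1.le_perp hp'W)) hy hy'
    (hW.1 p hpW) (hW'.1 p' hp'W) (hY.1 y hyY) (hY'.1 y' hyY') hyp hyp' hy'p hy'p'
  have hfix₁ : ∀ (u : V) (hu : u ∈ U), transfer h₁ h₂ ⟨u, hUW hu⟩ = ⟨u, hUW' hu⟩ :=
    fun u hu => (transfer_eq_iff h₁ h₂).2 fun _ _ => rfl
  have hfix₂ : ∀ (u : V) (hu : u ∈ U), transfer h₃ h₄ ⟨u, hUW' hu⟩ = ⟨u, hUW hu⟩ :=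
    fun u hu => (transfer_eq_iff h₃ h₄).2 fun _ _ => rfl
  set α := (g.herm y p')⁻¹ * g.herm y p with hα
  set β := (g.herm y' p)⁻¹ * g.herm y' p' with hβ
  have hpα : (transfer h₁ h₂ ⟨p, hpW⟩ : V) - p' <• α ∈ U := by
    refine mem_of_herm_eq_zero hy hyp' (hW'U ▸ sub_mem (transfer h₁ h₂ ⟨p, hpW⟩).2
      (smul_mem _ _ hp'W)) ?_
    rw [herm_sub_right, herm_transfer h₁ h₂ _ hyY, herm_smul_right, hα, mul_inv_cancel_left₀ hyp',
      sub_self]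
  have hpβ : (transfer h₃ h₄ ⟨p', hp'W⟩ : V) - p <• β ∈ U := by
    refine mem_of_herm_eq_zero hy' hy'p (hWU ▸ sub_mem (transfer h₃ h₄ ⟨p', hp'W⟩).2
      (smul_mem _ _ hpW)) ?_
    rw [herm_sub_right, herm_transfer h₃ h₄ _ hyY', herm_smul_right, hβ, mul_inv_cancel_left₀ hy'p,
      sub_self]
  have hcA : (⟨p, hpW⟩ : W) ∉ U.submoduleOf W := fun hp => hpU hp
  have hA : IsCoatom (U.submoduleOf W) := by
    refine isCoatom_of_sup_span_singleton_eq_top hcA (eq_top_iff.2 ?_)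
    rintro ⟨x, hx⟩ -
    rw [hWU] at hx
    obtain ⟨u, hu, z, hz, rfl⟩ := mem_sup.1 hx
    obtain ⟨a, rfl⟩ := mem_span_singleton.1 hz
    exact mem_sup.2 ⟨⟨u, hUW hu⟩, hu, a • ⟨p, hpW⟩, smul_mem _ _ (mem_span_singleton_self _), rfl⟩
  refine mem_homologyGroup_of_isCoatom zero_notMem_valueSet_mul
    (exists_ne_one_mem_valueSet_mul (h.nontrivial_valueSet M hM)) hA hcA ?_ hcr ?_
  · intro x hx
    rw [LinearEquiv.trans_apply, hfix₁ x hx, hfix₂ x hx]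
  · have h5 : transfer h₁ h₂ ⟨p, hpW⟩ =
        ⟨_, hUW' hpα⟩ + (⟨p', hp'W⟩ : W') <• α := Subtype.ext (by simp)
    rw [LinearEquiv.trans_apply, h5, map_add, hfix₂ _ hpα, map_smul]
    have h6 : ((⟨_, hUW hpα⟩ + MulOpposite.op α • transfer h₃ h₄ ⟨p', hp'W⟩ -
        MulOpposite.op (β * α) • ⟨p, hpW⟩ : W) : V) =
        ((transfer h₁ h₂ ⟨p, hpW⟩ : V) - p' <• α) +
          ((transfer h₃ h₄ ⟨p', hp'W⟩ : V) - p <• β) <• α := by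
      simp only [AddSubgroupClass.coe_sub, Submodule.coe_add, Submodule.coe_smul, smul_sub,
        MulOpposite.op_mul, mul_smul]
      abel
    have h7 := add_mem hpα (U.smul_mem (MulOpposite.op α) hpβ)
    rw [← h6] at h7
    exact h7

/-- Dually, the transfers through `Y` and `Y'` agree in their pairing with `Y ⊓ Y'`, so their
difference takes values in the single point of `W'` perpendicular to it. Hence the product moves
every vector along `p`. -/
theorem IsRich.transfer_trans_transfer_mem_of_adjacent_middle
    (hadj : n ≤ finrank Lᵐᵒᵖ (Y ⊓ Y' : Submodule Lᵐᵒᵖ V) + 1) :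
    transfer h₁ h₂ ≪≫ₗ transfer h₃ h₄ ∈ homologyGroup (g.valueSet M * g.valueSet M) W := by
  by_cases hne : Y = Y'
  · subst hne
    rw [transfer_trans, transfer_self]
    exact one_mem _
  have hY := h.isMaximalSingular_right hW h₁
  have hY' := h.isMaximalSingular_right hW h₄
  have hW' := h.isMaximalSingular_right hY h₂.symm
  have hn := h.finrank_inf_add_one hY hY' hne hadj
  have hn' : finrank Lᵐᵒᵖ (Y' ⊓ Y : Submodule Lᵐᵒᵖ V) + 1 = n := by rwa [inf_comm]
  obtain ⟨y, hyY, hyU⟩ := h.exists_mem_notMem_inf hY hn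
  obtain ⟨y', hyY', hyU'⟩ := h.exists_mem_notMem_inf hY' hn'
  rw [inf_comm] at hyU'
  set U := Y ⊓ Y' with hU
  have hUY : U ≤ Y := inf_le_left
  have hUY' : U ≤ Y' := inf_le_right
  have := h.finite hW.1
  have := h.finite hW'.1
  have := h.finite (hY.1.mono hUY)
  obtain ⟨p, hpW, hp, hp0⟩ := exists_mem_perp_ne_zero (g := g) (U := U) (X := W)
    (by rw [h.finrank_eq hW]; omega)
  set p' := transfer h₄ h₃ ⟨p, hpW⟩ with hp'
  have hp'0 : p' ≠ 0 := by
    rw [hp', Ne, LinearEquiv.map_eq_zero_iff]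
    exact fun h0 => hp0 (congrArg Subtype.val h0)
  have hp'0' : (p' : V) ≠ 0 := fun h0 => hp'0 (Subtype.ext h0)
  have hp'U : (p' : V) ∈ g.perp U := fun u hu => by
    rw [hp', herm_transfer h₄ h₃ _ (hUY' hu)]
    exact hp u hu
  have hspan : ∀ z : W', (z : V) ∈ g.perp U → z ∈ Lᵐᵒᵖ ∙ p' := by
    have h5 := g.finrank_perp_le h₂ hUY
    rw [h.finrank_eq hW'] at h5
    have : Module.Finite Lᵐᵒᵖ (g.perp U ⊓ W' : Submodule Lᵐᵒᵖ V) :=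
      finiteDimensional_of_le inf_le_right
    have h6 : g.perp U ⊓ W' = Lᵐᵒᵖ ∙ (p' : V) := by
      refine (eq_of_le_of_finrank_le ((span_singleton_le_iff_mem _ _).2 (mem_inf.2 ⟨hp'U, p'.2⟩)) ?_).symm
      rw [finrank_span_singleton hp'0']
      omega
    intro z hz
    have hz' : (z : V) ∈ Lᵐᵒᵖ ∙ (p' : V) := h6 ▸ mem_inf.2 ⟨hz, z.2⟩
    obtain ⟨a, ha⟩ := mem_span_singleton.1 hz'
    exact mem_span_singleton.2 ⟨a, Subtype.ext ha⟩
  have ne : ∀ {X Z : Submodule Lᵐᵒᵖ V} {q z : V}, g.IsMaximalSingular Z → g.Opposite X Z → U ≤ Z →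
      z ∈ Z → z ∉ U → q ∈ X → q ∈ g.perp U → q ≠ 0 → g.herm z q ≠ 0 := by
    intro X Z q z hZ hXZ hUZ hz hzU hq hqU hq0 h0
    refine hq0 (hXZ.eq_zero hq fun x hx => ?_)
    rw [h.eq_sup_span_singleton hZ hUZ hn hz hzU] at hx
    have hq' : q ∈ g.perp (U ⊔ Lᵐᵒᵖ ∙ z) := by
      rw [perp_sup]
      exact ⟨hqU, mem_perp_span_singleton.2 h0⟩
    exact hq' x hx
  have hyp := ne hY h₁ hUY hyY hyU hpW hp hp0
  have hyp' := ne hY h₂ hUY hyY hyU p'.2 hp'U hp'0'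
  have hy'p := ne hY' h₄ hUY' hyY' hyU' hpW hp hp0
  have hy'p' := ne hY' h₃ hUY' hyY' hyU' p'.2 hp'U hp'0'
  have hcr := h.crossRatio_mem hM (hY.1.mono hUY) hn (h.nontrivial_valueSet M hM).nonempty
    hp hp'U (perp_antitone hUY (hY.1.le_perp hyY)) (perp_antitone hUY' (hY'.1.le_perp hyY'))
    (hW.1 p hpW) (hW'.1 p' p'.2) (hY.1 y hyY) (hY'.1 y' hyY') hyp hyp' hy'p hy'p'
  -- As `p'` is the image of `p` under the transfer through `Y'`, half of the cross ratio is `1`.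
  have h7 : g.herm y' (p' : V) = g.herm y' p := herm_transfer h₄ h₃ _ hyY'
  rw [h7, inv_mul_cancel₀ hy'p, one_mul] at hcr
  have hp'p : transfer h₃ h₄ p' = ⟨p, hpW⟩ := by
    rw [← transfer_symm h₄ h₃, hp', LinearEquiv.symm_apply_apply]
  refine mem_homologyGroup_of_sub_mem zero_notMem_valueSet_mul
    (exists_ne_one_mem_valueSet_mul (h.nontrivial_valueSet M hM)) (p := ⟨p, hpW⟩)
    (fun h0 => hp0 (congrArg Subtype.val h0)) ?_ hcr ?_
  · intro x
    have hz : ((transfer h₁ h₂ x - transfer h₄ h₃ x : W') : V) ∈ g.perp U := fun u hu => by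
      rw [AddSubgroupClass.coe_sub, herm_sub_right, herm_transfer h₁ h₂ _ (hUY hu),
        herm_transfer h₄ h₃ _ (hUY' hu), sub_self]
    obtain ⟨a, ha⟩ := mem_span_singleton.1 (hspan _ hz)
    refine mem_span_singleton.2 ⟨a, ?_⟩
    rw [← hp'p, ← map_smul, ha, map_sub, LinearEquiv.trans_apply, ← transfer_symm h₄ h₃,
      LinearEquiv.symm_apply_apply]
  · have hz : (transfer h₁ h₂ ⟨p, hpW⟩ : V) ∈ g.perp U := fun u hu => by
      rw [herm_transfer h₁ h₂ _ (hUY hu)]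
      exact hp u hu
    obtain ⟨a, ha⟩ := mem_span_singleton.1 (hspan _ hz)
    have h8 := herm_transfer h₁ h₂ ⟨p, hpW⟩ hyY
    have h9 : g.herm y (a • (p' : V)) = g.herm y (p' : V) * a.unop :=
      g.herm_smul_right y (p' : V) a.unop
    rw [← ha, Submodule.coe_smul, h9] at h8
    rw [LinearEquiv.trans_apply, ← ha, map_smul, hp'p]
    change g.herm y (p' : V) * a.unop = g.herm y p at h8
    rw [← h8, inv_mul_cancel_left₀ hyp', MulOpposite.op_unop]

end

end SigmaForm

theorem Submodule.exists_equiv_sup_span_singleton {K V : Type*} [DivisionRing K] [AddCommGroup V]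
    [Module K V] {A : Submodule K V} {p q : V} (hp : p ∉ A) (hq : q ∉ A) :
    ∃ θ : ↥(A ⊔ K ∙ p) ≃ₗ[K] ↥(A ⊔ K ∙ q), ∀ a ∈ A, ∀ (l : K) (x : ↥(A ⊔ K ∙ p)),
      (x : V) = a + l • p → (θ x : V) = a + l • q := by
  have key : ∀ p q : V, p ∉ A → ∃ θ : ↥(A ⊔ K ∙ p) →ₗ[K] ↥(A ⊔ K ∙ q), ∀ a ∈ A,
      ∀ (l : K) (x : ↥(A ⊔ K ∙ p)), (x : V) = a + l • p → (θ x : V) = a + l • q := by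
    intro p q hp
    obtain ⟨θ, h1, h2⟩ := LinearMap.exists_extend_of_notMem A.subtype hp q
    have h1' : ∀ a ∈ A, θ a = a := fun a ha => LinearMap.congr_fun h1 ⟨a, ha⟩
    have hθ : ∀ x : ↥(A ⊔ K ∙ p), (θ ∘ₗ (A ⊔ K ∙ p).subtype) x ∈ A ⊔ K ∙ q := by
      rintro ⟨x, hx⟩
      obtain ⟨a, ha, _, hs, rfl⟩ := mem_sup.1 hx
      obtain ⟨l, rfl⟩ := mem_span_singleton.1 hs
      simpa [h1' a ha, h2] using mem_sup.2 ⟨a, ha, l • q, mem_span_singleton.2 ⟨l, rfl⟩, rfl⟩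
    refine ⟨LinearMap.codRestrict _ _ hθ, fun a ha l x hx => ?_⟩
    simp [hx, h1' a ha, h2]
  obtain ⟨θ, hθ⟩ := key p q hp
  obtain ⟨η, hη⟩ := key q p hq
  refine ⟨LinearEquiv.ofLinearMap θ η ?_ ?_, fun a ha l x hx => hθ a ha l x hx⟩
  · refine LinearMap.ext fun x => Subtype.ext ?_
    obtain ⟨a, ha, _, hs, hx⟩ := mem_sup.1 x.2
    obtain ⟨l, rfl⟩ := mem_span_singleton.1 hs
    exact (hθ a ha l _ (hη a ha l x hx.symm)).trans hx
  · refine LinearMap.ext fun x => Subtype.ext ?_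
    obtain ⟨a, ha, _, hs, hx⟩ := mem_sup.1 x.2
    obtain ⟨l, rfl⟩ := mem_span_singleton.1 hs
    exact (hη a ha l _ (hθ a ha l x hx.symm)).trans hx

/-! ### Reduction of even projectivities to a single transfer -/

namespace SigmaForm

variable {L V : Type*} [DivisionRing L] [StarRing L] [AddCommGroup V] [Module Lᵐᵒᵖ V]
variable {g : SigmaForm L V} {n : ℕ} {M U W W' Y Y' : Submodule Lᵐᵒᵖ V}

/-- Inside `P`, the subspace `X ⊓ P` is disjoint from the hyperplane `P ⊓ W`. -/
theorem HasRank.finrank_inf_le_one (h : g.HasRank n) {X P : Submodule Lᵐᵒᵖ V}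
    (hP : g.IsMaximalSingular P) (hXW : Disjoint X W)
    (hPW : finrank Lᵐᵒᵖ (P ⊓ W : Submodule Lᵐᵒᵖ V) + 1 = n) :
    finrank Lᵐᵒᵖ (X ⊓ P : Submodule Lᵐᵒᵖ V) ≤ 1 := by
  have := h.finite hP.1
  have : Module.Finite Lᵐᵒᵖ (X ⊓ P : Submodule Lᵐᵒᵖ V) := finiteDimensional_of_le inf_le_right
  have : Module.Finite Lᵐᵒᵖ (P ⊓ W : Submodule Lᵐᵒᵖ V) := finiteDimensional_of_le inf_le_left
  have h1 := Submodule.finrank_sup_add_finrank_inf_eq (X ⊓ P) (P ⊓ W)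
  have h2 : (X ⊓ P) ⊓ (P ⊓ W) = ⊥ :=
    le_bot_iff.1 ((inf_le_inf inf_le_left inf_le_right).trans hXW.le_bot)
  rw [h2, finrank_bot] at h1
  have h3 : (X ⊓ P) ⊔ (P ⊓ W) ≤ P := sup_le inf_le_right inf_le_left
  have h4 := Submodule.finrank_mono h3
  rw [h.finrank_eq hP] at h4
  omega

/-- Modulo homologies, two consecutive transfers can be replaced by a single one. -/
theorem IsRich.exists_congrHomology_transfer (h : g.IsRich n) (hM : g.IsMaximalSingular M)
    (hU : g.IsMaximalSingular U) (h₁ : g.Opposite U Y) (h₂ : g.Opposite W Y)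
    (h₃ : g.Opposite W Y') (h₄ : g.Opposite W' Y') :
    ∃ Z, ∃ (a : g.Opposite U Z) (b : g.Opposite W' Z),
      CongrHomology (g.valueSet M * g.valueSet M) (transfer h₁ h₂ ≪≫ₗ transfer h₃ h₄)
        (transfer a b) := by
  induction hk : n - finrank Lᵐᵒᵖ (W ⊓ U : Submodule Lᵐᵒᵖ V) using Nat.strong_induction_on
    generalizing W Y Y' with
  | _ k ih =>
    by_cases hne : U = W
    · subst hne
      refine ⟨Y', h₃, h₄, ?_⟩
      rw [transfer_self]
      exact .refl _
    have hY := h.isMaximalSingular_right hU h₁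
    have hW := h.isMaximalSingular_right hY h₂.symm
    have hY' := h.isMaximalSingular_right hW h₃
    have hW' := h.isMaximalSingular_right hY' h₄.symm
    obtain ⟨P, hP, hPW, hlt⟩ := h.exists_adjacent_nearer hU hW hne
    have hop : ∀ {A B : Submodule Lᵐᵒᵖ V}, g.IsMaximalSingular A → g.IsMaximalSingular B →
        Disjoint B A → g.Opposite A B := fun hA hB hd => (h.opposite_iff hA hB).2 hd.symm
    have hdis : ∀ {A B : Submodule Lᵐᵒᵖ V}, g.IsMaximalSingular A → g.IsMaximalSingular B →
        g.Opposite A B → Disjoint B A := fun hA hB hd => ((h.opposite_iff hA hB).1 hd).symm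
    -- The middle subspaces `Y` and `Y'` need not be opposite `P`; equal or adjacent subspaces `X`
    -- and `X'` are opposite `P` as well, and exchanging them costs only homologies.
    obtain ⟨X, hX, hYX, hXU, hXW, hXP⟩ := h.exists_adjacent_disjoint hY hU hW hP (hdis hU hY h₁)
      (hdis hW hY h₂) (h.finrank_inf_le_one hP (hdis hW hY h₂) hPW)
    obtain ⟨X', hX', hYX', hXW', hXW₂, hXP'⟩ := h.exists_adjacent_disjoint hY' hW hW' hP
      (hdis hW hY' h₃) (hdis hW' hY' h₄) (h.finrank_inf_le_one hP (hdis hW hY' h₃) hPW)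
    have a₁ := hop hU hX hXU
    have a₂ := hop hW hX hXW
    have a₃ := hop hP hX hXP
    have b₁ := hop hW hX' hXW'
    have b₂ := hop hW' hX' hXW₂
    have b₃ := hop hP hX' hXP'
    have hfin := h.finite hU.1
    have hle := Submodule.finrank_mono (inf_le_right : P ⊓ U ≤ U)
    rw [h.finrank_eq hU] at hle
    obtain ⟨Z, a, b, hab⟩ := ih _ (by omega) a₁ a₃ b₃ b₂ rfl
    refine ⟨Z, a, b, .trans ?_ hab⟩
    have c₁ : CongrHomology (g.valueSet M * g.valueSet M) (transfer h₁ h₂) (transfer a₁ a₂) :=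
      h.transfer_trans_transfer_mem_of_adjacent_middle hM hU h₁ h₂ a₂ a₁ hYX
    have c₂ : CongrHomology (g.valueSet M * g.valueSet M) (transfer h₃ h₄) (transfer b₁ b₂) :=
      h.transfer_trans_transfer_mem_of_adjacent_middle hM hW h₃ h₄ b₂ b₁ hYX'
    -- Both transfers are factored through `P`. The loop from `P` to `W` and back is trivial modulo
    -- homologies, which leaves a chain through `P`, nearer to `U` than `W`.
    have c₃ : CongrHomology (g.valueSet M * g.valueSet M) (transfer a₃ a₂ ≪≫ₗ transfer b₁ b₃)
        (LinearEquiv.refl Lᵐᵒᵖ P) :=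
      h.transfer_trans_transfer_mem_of_adjacent hM hP a₃ a₂ b₁ b₃ (by omega)
    refine (c₁.trans_right _).trans ((c₂.trans_left _).trans ?_)
    have c₄ := (c₃.trans_left (transfer a₁ a₃)).trans_right (transfer b₃ b₂)
    rw [LinearEquiv.trans_refl] at c₄
    convert c₄ using 1
    rw [← transfer_trans a₁ a₃ a₂, ← transfer_trans b₁ b₃ b₂]
    rfl

/-- A projectivity between maximal singular subspaces is, modulo homologies, a single transfer,
possibly followed by a perspectivity. -/
theorem IsRich.exists_transfer_of_isProjectivity (h : g.IsRich n) (hM : g.IsMaximalSingular M)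
    {k : ℕ} {φ : Submodule Lᵐᵒᵖ U → Submodule Lᵐᵒᵖ W} (hφ : g.IsProjectivity k U W φ)
    (hU : g.IsMaximalSingular U) :
    (Even k → ∃ Z, ∃ (a : g.Opposite U Z) (b : g.Opposite W Z) (T : U ≃ₗ[Lᵐᵒᵖ] W),
      CongrHomology (g.valueSet M * g.valueSet M) T (transfer a b) ∧
        ∀ S, φ S = S.map (T : U →ₗ[Lᵐᵒᵖ] W)) ∧
    (¬ Even k → ∃ Z X, ∃ (a : g.Opposite U Z) (b : g.Opposite X Z) (T : U ≃ₗ[Lᵐᵒᵖ] X),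
      g.Opposite X W ∧ CongrHomology (g.valueSet M * g.valueSet M) T (transfer a b) ∧
        ∀ S, φ S = g.perspectivity X W (S.map (T : U →ₗ[Lᵐᵒᵖ] X))) := by
  induction hφ with
  | refl U =>
    refine ⟨fun _ => ?_, fun hk => (hk Even.zero).elim⟩
    -- The empty projectivity is the transfer from `U` to itself through any opposite subspace.
    obtain ⟨X, hX, hd⟩ := h.exists_disjoint hU
    have a := (h.opposite_iff hU hX).2 hd.symm
    refine ⟨X, a, a, .refl _ _, ?_, fun S => (Submodule.map_id S).symm⟩
    rw [transfer_self]
    exact .refl _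
  | step _ hop ih =>
    obtain ⟨ih₁, ih₂⟩ := ih hU
    refine ⟨fun hk => ?_, fun hk => ?_⟩
    · rw [Nat.even_add_one] at hk
      obtain ⟨Z, X, a, b, T, hX, hT, hφ⟩ := ih₂ hk
      obtain ⟨Z', a', b', hab⟩ := h.exists_congrHomology_transfer hM hU a b hX hop.symm
      refine ⟨Z', a', b', T ≪≫ₗ transfer hX hop.symm, (hT.trans_right _).trans hab, fun S => ?_⟩
      rw [Function.comp_apply, hφ, perspectivity_comp_perspectivity hop.symm
        fun x w hw => herm_transfer hX hop.symm x hw, ← Submodule.map_comp]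
      rfl
    · rw [Nat.even_add_one, not_not] at hk
      obtain ⟨Z, a, b, T, hT, hφ⟩ := ih₁ hk
      exact ⟨Z, _, a, b, T, hop, hT, fun S => by rw [Function.comp_apply, hφ]⟩

theorem IsRich.specialProjectivityGroup_le (h : g.IsRich n) (hM : g.IsMaximalSingular M) :
    g.specialProjectivityGroup M ≤
      Subgroup.closure (homologiesWithFactorIn (g.valueSet M * g.valueSet M) M) := by
  rintro φ ⟨k, hk⟩
  obtain ⟨Z, a, b, T, hT, hφ⟩ := (h.exists_transfer_of_isProjectivity hM hk hM).1 (even_two_mul k)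
  rw [transfer_self] at hT
  have he : φ = orderIsoMapComap T := OrderIso.ext (funext hφ)
  rw [he]
  exact orderIsoMapComap_mem_closure zero_notMem_valueSet_mul hT

/-! ### Homologies as projectivities -/

/-- Two opposite maximal singular subspaces `A ⊔ ⟨c⟩` and `B ⊔ ⟨y⟩` with `f(y, c) = 1`, with
`A ⟂ y` and `B ⟂ c`. -/
structure IsFrame (g : SigmaForm L V) (A B : Submodule Lᵐᵒᵖ V) (c y : V) : Prop where
  left : g.IsMaximalSingular (A ⊔ Lᵐᵒᵖ ∙ c)
  right : g.IsMaximalSingular (B ⊔ Lᵐᵒᵖ ∙ y)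
  opposite : g.Opposite (A ⊔ Lᵐᵒᵖ ∙ c) (B ⊔ Lᵐᵒᵖ ∙ y)
  herm_eq_one : g.herm y c = 1
  mem_perp_left : y ∈ g.perp A
  mem_perp_right : c ∈ g.perp B

section Frame

variable {A B : Submodule Lᵐᵒᵖ V} {c y v w : V} {x z : L}

theorem IsFrame.symm (hf : g.IsFrame A B c y) : g.IsFrame B A y c :=
  ⟨hf.right, hf.left, hf.opposite.symm, by rw [← star_herm, hf.herm_eq_one, star_one],
    hf.mem_perp_right, hf.mem_perp_left⟩

theorem IsFrame.mem_perp_self (hf : g.IsFrame A B c y) : c ∈ g.perp A :=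
  perp_antitone le_sup_left (hf.left.1.le_perp (mem_sup_right (mem_span_singleton_self c)))

theorem IsFrame.herm_self (hf : g.IsFrame A B c y) : g.herm c c = 0 :=
  hf.left.1.herm_eq_zero (mem_sup_right (mem_span_singleton_self c))
    (mem_sup_right (mem_span_singleton_self c))

theorem IsFrame.notMem (hf : g.IsFrame A B c y) : c ∉ A := fun hc => by
  have := hf.symm.herm_eq_one
  rw [hf.mem_perp_left c hc] at this
  exact zero_ne_one this

theorem IsFrame.finrank_add_one (h : g.HasRank n) (hf : g.IsFrame A B c y) :
    finrank Lᵐᵒᵖ A + 1 = n := by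
  have := h.finite (hf.left.1.mono (le_sup_left : A ≤ _))
  rw [← finrank_sup_span_singleton_eq A hf.notMem, h.finrank_eq hf.left]

theorem IsFrame.mem_perp_add (hf : g.IsFrame A B c y) (hv : v ∈ g.perp A) (x : L) :
    c + v - y <• x ∈ g.perp A :=
  sub_mem (add_mem hf.mem_perp_self hv) (smul_mem _ _ hf.mem_perp_left)

theorem IsFrame.herm_add (hf : g.IsFrame A B c y) (hv : g.herm y v = 0) (x : L) :
    g.herm y (c + v - y <• x) = 1 := by
  rw [herm_sub_right, herm_add_right, hf.herm_eq_one, hv, herm_smul_right, hf.symm.herm_self,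
    zero_mul, add_zero, sub_zero]

theorem IsFrame.isMaximalSingular (h : g.HasRank n) (hf : g.IsFrame A B c y)
    (hvA : v ∈ g.perp A) (hvc : g.herm c v = 0) (hvy : g.herm y v = 0) (hv : g.IsValue v x) :
    g.IsMaximalSingular (A ⊔ Lᵐᵒᵖ ∙ (c + v - y <• x)) := by
  refine h.isMaximalSingular_sup_span_singleton (hf.left.1.mono le_sup_left)
    (hf.finrank_add_one h) ?_ (hf.mem_perp_add hvA x) fun hmem => ?_
  · have hc0 := hf.left.1 c (mem_sup_right (mem_span_singleton_self c))
    have hy0 := hf.right.1 y (mem_sup_right (mem_span_singleton_self y))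
    have h1 := ((quad_eq_zero_iff.1 hc0).add hv).add ((quad_eq_zero_iff.1 hy0).smul (-x))
    rw [quad_eq_zero_iff]
    rw [hvc, herm_smul_right, herm_add_left, hf.symm.herm_eq_one, g.herm_eq_zero_comm hvy] at h1
    simpa [sub_eq_add_neg] using h1
  · have := hf.herm_add hvy x
    rw [g.herm_eq_zero_comm (hf.mem_perp_left _ hmem)] at this
    exact zero_ne_one this

/-- A criterion for subspaces to be opposite. -/
theorem IsFrame.opposite_of (h : g.HasRank n) (hf : g.IsFrame A B c y) {p q : V}
    (hp : g.IsMaximalSingular (A ⊔ Lᵐᵒᵖ ∙ p)) (hq : g.IsMaximalSingular (B ⊔ Lᵐᵒᵖ ∙ q))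
    (hqA : q ∈ g.perp A) (hpq : g.herm q p ≠ 0) :
    g.Opposite (A ⊔ Lᵐᵒᵖ ∙ p) (B ⊔ Lᵐᵒᵖ ∙ q) := by
  rw [h.opposite_iff hp hq, disjoint_def]
  intro r hrp hrq
  obtain ⟨a, ha, _, hs, rfl⟩ := mem_sup.1 hrp
  obtain ⟨l, rfl⟩ := mem_span_singleton.1 hs
  -- Pairing a common vector with `q` kills its `p`-component. What remains lies in `A` and is
  -- perpendicular to `B` and to `y`, so it vanishes because the frame is opposite.
  have h1 : g.herm q (a + l • p) = g.herm q p * l.unop := by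
    rw [herm_add_right, g.herm_eq_zero_comm (hqA a ha), zero_add]
    exact g.herm_smul_right q p l.unop
  rw [hq.1.herm_eq_zero (mem_sup_right (mem_span_singleton_self q)) hrq] at h1
  have hl : l = 0 := (MulOpposite.unop_eq_zero_iff l).1
    ((mul_eq_zero.1 h1.symm).resolve_left hpq)
  subst hl
  rw [zero_smul, add_zero] at hrq ⊢
  refine hf.opposite.eq_zero (mem_sup_left ha) fun s hs => ?_
  obtain ⟨b, hb, _, hs', rfl⟩ := mem_sup.1 hs
  obtain ⟨m, rfl⟩ := mem_span_singleton.1 hs'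
  rw [herm_add_left, hq.1.herm_eq_zero (mem_sup_left hb) hrq, zero_add]
  have := g.herm_smul_left y a m.unop
  rw [MulOpposite.op_unop] at this
  rw [this, g.herm_eq_zero_comm (hf.mem_perp_left a ha), mul_zero]

/-- Everything about the self-projectivity of `A ⊔ ⟨c⟩` through `B ⊔ ⟨y⟩`, `A ⊔ ⟨c + v - y x⟩` and
`B ⊔ ⟨y + w - c z^σ⟩`. -/
theorem IsFrame.homology (h : g.HasRank n) (hf : g.IsFrame A B c y)
    (hvA : v ∈ g.perp A) (hvB : v ∈ g.perp B) (hvc : g.herm c v = 0) (hvy : g.herm y v = 0)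
    (hv : g.IsValue v x) (hwA : w ∈ g.perp A) (hwB : w ∈ g.perp B) (hwc : g.herm c w = 0)
    (hwy : g.herm y w = 0) (hw : g.IsValue w z) (hD : z * x + g.herm w v + 1 ≠ 0) :
    g.IsMaximalSingular (A ⊔ Lᵐᵒᵖ ∙ (c + v - y <• x)) ∧
    g.IsMaximalSingular (B ⊔ Lᵐᵒᵖ ∙ (y + w - c <• star z)) ∧
    g.Opposite (B ⊔ Lᵐᵒᵖ ∙ y) (A ⊔ Lᵐᵒᵖ ∙ (c + v - y <• x)) ∧
    g.Opposite (A ⊔ Lᵐᵒᵖ ∙ (c + v - y <• x)) (B ⊔ Lᵐᵒᵖ ∙ (y + w - c <• star z)) ∧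
    g.Opposite (B ⊔ Lᵐᵒᵖ ∙ (y + w - c <• star z)) (A ⊔ Lᵐᵒᵖ ∙ c) ∧
    IsHomology (A.submoduleOf (A ⊔ Lᵐᵒᵖ ∙ c))
      ⟨c, mem_sup_right (mem_span_singleton_self c)⟩ (z * x + g.herm w v + 1)
      (g.perspectivity (B ⊔ Lᵐᵒᵖ ∙ (y + w - c <• star z)) (A ⊔ Lᵐᵒᵖ ∙ c) ∘
        g.perspectivity (A ⊔ Lᵐᵒᵖ ∙ (c + v - y <• x)) (B ⊔ Lᵐᵒᵖ ∙ (y + w - c <• star z)) ∘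
        g.perspectivity (B ⊔ Lᵐᵒᵖ ∙ y) (A ⊔ Lᵐᵒᵖ ∙ (c + v - y <• x)) ∘
        g.perspectivity (A ⊔ Lᵐᵒᵖ ∙ c) (B ⊔ Lᵐᵒᵖ ∙ y)) := by
  have hp := hf.isMaximalSingular h hvA hvc hvy hv
  have hq := hf.symm.isMaximalSingular h hwB hwy hwc hw.star
  have hpA := hf.mem_perp_add hvA x
  have hqB := hf.symm.mem_perp_add hwB (star z)
  have hpy := hf.herm_add hvy x
  have hqc := hf.symm.herm_add hwc (star z)
  have hpB : c + v - y <• x ∈ g.perp B :=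
    sub_mem (add_mem hf.mem_perp_right hvB) (smul_mem _ _ hf.symm.mem_perp_self)
  have hqA : y + w - c <• star z ∈ g.perp A :=
    sub_mem (add_mem hf.mem_perp_left hwA) (smul_mem _ _ hf.mem_perp_self)
  have hcB := hf.mem_perp_right
  have hyA := hf.mem_perp_left
  have hcc := hf.herm_self
  have hqp : g.herm (y + w - c <• star z) (c + v - y <• x) = z * x + g.herm w v + 1 := by
    have h1 : g.herm w y = 0 := g.herm_eq_zero_comm hwy
    have h2 : g.herm w c = 0 := g.herm_eq_zero_comm hwc
    simp only [herm_sub_left, herm_add_left, herm_smul_left, herm_sub_right, herm_add_right,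
      herm_smul_right, hf.herm_eq_one, hf.symm.herm_eq_one, hcc, hf.symm.herm_self, hvc, hvy, h1,
      h2, star_star, mul_one, zero_add, add_zero, sub_zero, mul_zero]
    rw [zero_sub, neg_mul, sub_neg_eq_add]
    abel
  set p := c + v - y <• x with hpdef
  set q := y + w - c <• star z with hqdef
  set D := z * x + g.herm w v + 1 with hDdef
  have hpA' : p ∉ A := fun hmem => by
    rw [g.herm_eq_zero_comm (hf.mem_perp_left _ hmem)] at hpy
    exact zero_ne_one hpy
  have hqc' : g.herm q c = 1 := by rw [← star_herm, hqc, star_one]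
  have o₂ : g.Opposite (A ⊔ Lᵐᵒᵖ ∙ p) (B ⊔ Lᵐᵒᵖ ∙ y) :=
    hf.opposite_of h hp hf.right hyA (by rw [hpy]; exact one_ne_zero)
  have o₃ : g.Opposite (A ⊔ Lᵐᵒᵖ ∙ p) (B ⊔ Lᵐᵒᵖ ∙ q) :=
    hf.opposite_of h hp hq hqA (by rwa [hqp])
  have o₄ : g.Opposite (A ⊔ Lᵐᵒᵖ ∙ c) (B ⊔ Lᵐᵒᵖ ∙ q) :=
    hf.opposite_of h hf.left hq hqA (by rw [hqc']; exact one_ne_zero)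
  have hcoat : IsCoatom (A.submoduleOf (A ⊔ Lᵐᵒᵖ ∙ c)) := by
    refine isCoatom_of_sup_span_singleton_eq_top
      (c := ⟨c, mem_sup_right (mem_span_singleton_self c)⟩) hf.notMem (eq_top_iff.2 ?_)
    rintro ⟨r, hr⟩ -
    obtain ⟨a, ha, _, hs, rfl⟩ := mem_sup.1 hr
    obtain ⟨l, rfl⟩ := mem_span_singleton.1 hs
    exact mem_sup.2 ⟨⟨a, mem_sup_left ha⟩, ha, l • ⟨c, _⟩,
      smul_mem _ _ (mem_span_singleton_self _), rfl⟩
  obtain ⟨k, hk, hkc⟩ := exists_homology hcoat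
    (c := ⟨c, mem_sup_right (mem_span_singleton_self c)⟩) hf.notMem hD
  refine ⟨hp, hq, o₂.symm, o₃, o₄.symm, hcoat, hf.notMem, hD, k, hk, hkc, fun S => ?_⟩
  -- The first two perspectivities are induced by `θ`, which fixes `A` and maps `c` to `p`, because
  -- `f(y, p) = f(y, c)`. The last two are induced by `k ∘ θ⁻¹`, which maps `p` to `c D`, because
  -- `f(q, c D) = D = f(q, p)`.
  obtain ⟨θ, hθ⟩ := exists_equiv_sup_span_singleton hf.notMem hpA'
  have hdec : ∀ r : ↥(A ⊔ Lᵐᵒᵖ ∙ c), ∃ a : V, ∃ l : Lᵐᵒᵖ, (r : V) = a + l • c ∧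
      (θ r : V) = a + l • p ∧ (k r : V) = a + l • (c <• D) := by
    intro r
    obtain ⟨a, ha, _, hs, hr⟩ := mem_sup.1 r.2
    obtain ⟨l, rfl⟩ := mem_span_singleton.1 hs
    refine ⟨a, l, hr.symm, hθ a ha l r hr.symm, ?_⟩
    have h1 : r = ⟨a, mem_sup_left ha⟩ + l • ⟨c, mem_sup_right (mem_span_singleton_self c)⟩ :=
      Subtype.ext hr.symm
    have h2 := hk ⟨a, mem_sup_left ha⟩ ha
    rw [h1, map_add, map_smul, h2, hkc]
    rfl
  have key : ∀ {s r r' : V}, r ∈ g.perp B → r' ∈ g.perp B → g.herm s r = g.herm s r' →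
      ∀ a : V, ∀ l : Lᵐᵒᵖ, ∀ m ∈ B ⊔ Lᵐᵒᵖ ∙ s, g.herm m (a + l • r) = g.herm m (a + l • r') := by
    intro s r r' hr hr' hs a l m hm
    have h1 : l • (r - r') ∈ g.perp (B ⊔ Lᵐᵒᵖ ∙ s) := by
      refine smul_mem _ _ ?_
      rw [perp_sup]
      exact ⟨sub_mem hr hr', mem_perp_span_singleton.2 (by rw [herm_sub_right, hs, sub_self])⟩
    have h2 := h1 m hm
    rwa [smul_sub, ← add_sub_add_left_eq_sub _ _ a, herm_sub_right, sub_eq_zero] at h2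
  have hθ₁ : ∀ r : ↥(A ⊔ Lᵐᵒᵖ ∙ c), ∀ m ∈ B ⊔ Lᵐᵒᵖ ∙ y, g.herm m (θ r : V) = g.herm m (r : V) := by
    intro r m hm
    obtain ⟨a, l, h1, h2, -⟩ := hdec r
    rw [h1, h2]
    exact key hpB hcB (by rw [hpy, hf.herm_eq_one]) a l m hm
  have hθ₂ : ∀ r : ↥(A ⊔ Lᵐᵒᵖ ∙ p), ∀ m ∈ B ⊔ Lᵐᵒᵖ ∙ q,
      g.herm m ((θ.symm ≪≫ₗ k) r : V) = g.herm m (r : V) := by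
    intro r m hm
    obtain ⟨a, l, -, h2, h3⟩ := hdec (θ.symm r)
    rw [LinearEquiv.apply_symm_apply] at h2
    rw [LinearEquiv.trans_apply, h2, h3]
    exact key (smul_mem _ _ hcB) hpB (by rw [herm_smul_right, hqc', one_mul, hqp]) a l m hm
  simp only [Function.comp_apply]
  rw [perspectivity_comp_perspectivity o₂ hθ₁, perspectivity_comp_perspectivity o₄ hθ₂,
    ← Submodule.map_comp]
  congr 1
  ext r
  simp

end Frame

end SigmaForm

theorem IsHomology.unique {L M : Type*} [DivisionRing L] [AddCommGroup M] [Module Lᵐᵒᵖ M]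
    {H : Submodule Lᵐᵒᵖ M} {c : M} {d : L} {φ ψ : Submodule Lᵐᵒᵖ M → Submodule Lᵐᵒᵖ M}
    (hφ : IsHomology H c d φ) (hψ : IsHomology H c d ψ) : φ = ψ := by
  obtain ⟨hH, hc, -, h, h1, h2, h3⟩ := hφ
  obtain ⟨-, -, -, k, k1, k2, k3⟩ := hψ
  have : (h : M →ₗ[Lᵐᵒᵖ] M) = k :=
    LinearMap.ext_of_sup_span_singleton_eq_top (hH.sup_span_singleton_eq_top hc)
      (fun x hx => (h1 x hx).trans (k1 x hx).symm) (h2.trans k2.symm)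
  funext S
  rw [h3, k3, this]

/-! ### Products of two values as factors of projectivities -/

namespace SigmaForm

variable {L V : Type*} [DivisionRing L] [StarRing L] [AddCommGroup V] [Module Lᵐᵒᵖ V]
variable {g : SigmaForm L V} {n : ℕ} {M : Submodule Lᵐᵒᵖ V}

/-- A product of two nonzero values has the form of the elements of the norm set. -/
theorem exists_normForm {S : Submodule Lᵐᵒᵖ V} {x y : L} (hx : x ≠ 0) {v w : V} (hv : v ∈ S)
    (hvx : g.IsValue v x) (hw : w ∈ S) (hwy : g.IsValue w y) :
    ∃ v' ∈ S, ∃ w' ∈ S, ∃ s t, g.IsValue v' s ∧ g.IsValue w' t ∧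
      x * y = t * s + g.herm w' v' + 1 := by
  have hsx : star x ≠ 0 := star_ne_zero.2 hx
  -- With `u = v x⁻¹` of value `a = (x^σ)⁻¹`, the choice is `v' = w - u` and `w' = u a⁻¹`. Then `x`
  -- is a value of `w'` and `f(w', ·) = x f(u, ·)`, so the terms with `f(u, w)` and `a` cancel, and
  -- `f(u, u) = a + x⁻¹` produces the `-1` that cancels the summand `1`.
  have ha : g.IsValue (v <• x⁻¹) (star x)⁻¹ := by
    have := hvx.smul x⁻¹
    rwa [star_inv₀, mul_assoc, mul_inv_cancel₀ hx, mul_one] at this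
  obtain ⟨a, hadef⟩ : ∃ a, a = (star x)⁻¹ := ⟨_, rfl⟩
  obtain ⟨u, hu⟩ : ∃ u, u = v <• x⁻¹ := ⟨_, rfl⟩
  rw [← hadef, ← hu] at ha
  have h2 : star a⁻¹ = x := by rw [hadef, inv_inv, star_star]
  have huS : u ∈ S := hu ▸ S.smul_mem _ hv
  refine ⟨w - u, sub_mem hw huS, u <• a⁻¹, S.smul_mem _ huS, y + a - g.herm u w, x, ?_, ?_, ?_⟩
  · have h1 := ha.neg.add hwy
    rw [herm_neg_left, ← sub_eq_add_neg, add_comm (-u), ← sub_eq_add_neg, add_comm a] at h1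
    exact h1
  · have h1 := ha.smul a⁻¹
    have ha0 : a ≠ 0 := hadef ▸ inv_ne_zero hsx
    rwa [mul_assoc, mul_inv_cancel₀ ha0, mul_one, h2] at h1
  · have h3 : star a = x⁻¹ := by rw [hadef, star_inv₀, star_star]
    rw [herm_smul_left, h2, herm_sub_right, ha.herm_self, h3]
    have h4 : x * (y + a - g.herm u w) + x * (g.herm u w - (a + x⁻¹)) + 1 =
        x * y + (1 - x * x⁻¹) := by
      simp only [mul_add, mul_sub]
      abel
    rw [h4, mul_inv_cancel₀ hx, sub_self, add_zero]

/-- Opposition identifies `M` with the dual of `O`, so some `m ∈ M` pairs with `O` as `v` does;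
subtracting it does not change the value. -/
theorem Opposite.exists_mem_perp_of_value {O : Submodule Lᵐᵒᵖ V} (ho : g.Opposite M O) {x : L}
    {v : V} (hv : v ∈ g.perp M) (hx : g.IsValue v x) :
    ∃ v' ∈ g.perp M ⊓ g.perp O, g.IsValue v' x := by
  have := ho.finite_right
  obtain ⟨m, hm⟩ := ho.pairingEquiv.surjective (g.pairing O v)
  have h1 : ∀ t ∈ O, g.herm t (m : V) = g.herm t v := pairing_eq_iff.1 hm
  refine ⟨v + -(m : V), ⟨add_mem hv (neg_mem (ho.singular_left.le_perp m.2)), fun t ht => ?_⟩, ?_⟩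
  · rw [herm_add_right, herm_neg_right, h1 t ht, add_neg_cancel]
  · refine hx.add_of_herm_eq_zero (quad_neg (ho.singular_left m m.2)) ?_
    rw [herm_neg_right, g.herm_eq_zero_comm (hv m m.2), neg_zero]

theorem IsFrame.mem_specialProjectivityGroup (h : g.HasRank n) {A B : Submodule Lᵐᵒᵖ V} {c y : V}
    (hf : g.IsFrame A B c y) {d : L}
    (hd : d ∈ g.valueSet (A ⊔ Lᵐᵒᵖ ∙ c) * g.valueSet (A ⊔ Lᵐᵒᵖ ∙ c))
    {φ : Submodule Lᵐᵒᵖ ↥(A ⊔ Lᵐᵒᵖ ∙ c) ≃o Submodule Lᵐᵒᵖ ↥(A ⊔ Lᵐᵒᵖ ∙ c)}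
    (hφ : IsHomology (A.submoduleOf (A ⊔ Lᵐᵒᵖ ∙ c))
      ⟨c, mem_sup_right (mem_span_singleton_self c)⟩ d φ) :
    φ ∈ g.specialProjectivityGroup (A ⊔ Lᵐᵒᵖ ∙ c) := by
  obtain ⟨a, ⟨ha0, v₁, hv₁, ha⟩, b, ⟨-, v₂, hv₂, hb⟩, rfl⟩ := Set.mem_mul.1 hd
  obtain ⟨v₁, hv₁, ha⟩ := hf.opposite.exists_mem_perp_of_value hv₁ ha
  obtain ⟨v₂, hv₂, hb⟩ := hf.opposite.exists_mem_perp_of_value hv₂ hb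
  obtain ⟨v, hv, w, hw, s, t, hs, ht, hst⟩ := exists_normForm ha0 hv₁ ha hv₂ hb
  rw [perp_sup, perp_sup] at hv hw
  obtain ⟨-, -, o₂, o₃, o₄, hψ⟩ := hf.homology h hv.1.1 hv.2.1 (mem_perp_span_singleton.1 hv.1.2)
    (mem_perp_span_singleton.1 hv.2.2) hs hw.1.1 hw.2.1 (mem_perp_span_singleton.1 hw.1.2)
    (mem_perp_span_singleton.1 hw.2.2) ht (hst ▸ hφ.2.2.1)
  rw [← hst] at hψ
  refine ⟨2, ?_⟩
  rw [hφ.unique hψ]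
  exact .step (.step (.step (.step (.refl _) hf.opposite) o₂) o₃) o₄

/-- In any opposite subspace `O`, take `y` in `O ⊓ A^⊥`, scaled so that `f(y, c) = 1`, and `B = O ⊓
c^⊥`. -/
theorem IsRich.exists_isFrame (h : g.IsRich n) (hM : g.IsMaximalSingular M) {A : Submodule Lᵐᵒᵖ V}
    {c : V} (hMA : M = A ⊔ Lᵐᵒᵖ ∙ c) (hc : c ∉ A) : ∃ B y, g.IsFrame A B c y := by
  obtain ⟨O, hO, hOM⟩ := h.exists_disjoint hM
  have ho := (h.opposite_iff hM hO).2 hOM.symm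
  have := h.finite hM.1
  have := h.finite hO.1
  have hAM : A ≤ M := hMA ▸ le_sup_left
  have hcM : c ∈ M := hMA ▸ mem_sup_right (mem_span_singleton_self c)
  have := h.finite (hM.1.mono hAM)
  have hn : finrank Lᵐᵒᵖ A + 1 = n := by
    rw [← h.finrank_eq hM, hMA, finrank_sup_span_singleton_eq A hc]
  obtain ⟨y, hyO, hyA, hy0⟩ := exists_mem_perp_ne_zero (g := g) (U := A) (X := O)
    (by rw [h.finrank_eq hO]; omega)
  have hyM : y ∉ M := fun hyM => hy0 (disjoint_def.1 hOM y hyO hyM)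
  have hcy := h.herm_ne_zero hM hAM hn hcM hc (hO.1 y hyO) hyA hyM
  have hc0 : c ≠ 0 := fun h0 => hc (h0 ▸ A.zero_mem)
  set z := y <• (g.herm c y)⁻¹ with hz
  have hcz : g.herm c z = 1 := by rw [hz, herm_smul_right, mul_inv_cancel₀ hcy]
  have hzO : z ∈ O := O.smul_mem _ hyO
  have h1 := g.finrank_le_perp_add (Lᵐᵒᵖ ∙ c) O
  rw [finrank_span_singleton hc0] at h1
  have hzB : z ∉ g.perp (Lᵐᵒᵖ ∙ c) ⊓ O := fun hzB => by
    have := mem_perp_span_singleton.1 hzB.1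
    rw [hcz] at this
    exact one_ne_zero this
  have hOB : O = (g.perp (Lᵐᵒᵖ ∙ c) ⊓ O) ⊔ Lᵐᵒᵖ ∙ z :=
    Submodule.eq_sup_span_singleton inf_le_right h1 hzO hzB
  refine ⟨g.perp (Lᵐᵒᵖ ∙ c) ⊓ O, z, hMA ▸ hM, hOB ▸ hO, hOB ▸ hMA ▸ ho, ?_, smul_mem _ _ hyA, ?_⟩
  · rw [← star_herm, hcz, star_one]
  · exact fun s hs => g.herm_eq_zero_comm (mem_perp_span_singleton.1 hs.1)

theorem IsRich.le_specialProjectivityGroup (h : g.IsRich n) (hM : g.IsMaximalSingular M) :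
    Subgroup.closure (homologiesWithFactorIn (g.valueSet M * g.valueSet M) M) ≤
      g.specialProjectivityGroup M := by
  rw [Subgroup.closure_le]
  rintro φ ⟨H, ⟨c, hcM⟩, d, hd, hφ⟩
  obtain ⟨A, hAM, rfl⟩ : ∃ A ≤ M, H = A.submoduleOf M := ⟨H.map M.subtype, map_subtype_le M H,
    (comap_map_eq_of_injective M.injective_subtype H).symm⟩
  have hc : c ∉ A := hφ.2.1
  have hMA : M = A ⊔ Lᵐᵒᵖ ∙ c := by
    refine le_antisymm (fun x hx => ?_) (sup_le hAM ((span_singleton_le_iff_mem _ _).2 hcM))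
    have hx' : (⟨x, hx⟩ : M) ∈ A.submoduleOf M ⊔ Lᵐᵒᵖ ∙ ⟨c, hcM⟩ := by
      rw [hφ.1.sup_span_singleton_eq_top hφ.2.1]
      trivial
    obtain ⟨a, ha, _, hs, hax⟩ := mem_sup.1 hx'
    obtain ⟨l, rfl⟩ := mem_span_singleton.1 hs
    exact mem_sup.2 ⟨a, ha, l • c, mem_span_singleton.2 ⟨l, rfl⟩, congrArg Subtype.val hax⟩
  obtain ⟨B, y, hf⟩ := h.exists_isFrame hM hMA hc
  subst hMA
  exact hf.mem_specialProjectivityGroup h.toHasRank hd hφ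

theorem IsRich.specialProjectivityGroup_eq (h : g.IsRich n) (hM : g.IsMaximalSingular M) :
    g.specialProjectivityGroup M =
      Subgroup.closure (homologiesWithFactorIn (g.valueSet M * g.valueSet M) M) :=
  (h.specialProjectivityGroup_le hM).antisymm (h.le_specialProjectivityGroup hM)

end SigmaForm

/-! ### The norm set of an anisotropic form and the small exceptions -/

namespace SigmaForm

variable {L V : Type*} [DivisionRing L] [StarRing L] [AddCommGroup V] [Module Lᵐᵒᵖ V]
variable {g : SigmaForm L V}

variable (g) in
/-- All nonzero values of the pseudo-quadratic form. -/
def values : Set L := {x | x ≠ 0 ∧ ∃ v, g.IsValue v x}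

theorem valueSet_bot : g.valueSet ⊥ = g.values := by
  have : g.perp ⊥ = ⊤ := eq_top_iff.2 fun v _ s hs => by
    rw [(mem_bot Lᵐᵒᵖ).1 hs, herm_zero_left]
  simp [valueSet, values, this]

theorem Anisotropic.notMem_traceGroup (hg : g.Anisotropic) {v : V} (hv : v ≠ 0) {x : L}
    (hx : g.IsValue v x) : x ∉ traceGroup L := fun h =>
  hv (hg v (quad_eq_zero_iff.2 (hx.congr (by simpa using h))))

theorem Anisotropic.value_ne_zero (hg : g.Anisotropic) {v : V} (hv : v ≠ 0) {x : L}
    (hx : g.IsValue v x) : x ≠ 0 := fun h =>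
  hg.notMem_traceGroup hv hx (h ▸ zero_mem _)

/-- The nonzero elements of the norm set are the products of two nonzero values. -/
theorem Anisotropic.mem_normSet_iff (hg : g.Anisotropic) (hne : g.values.Nonempty) {d : L} :
    d ∈ normSet g ∧ d ≠ 0 ↔ d ∈ g.values * g.values := by
  constructor
  · rintro ⟨⟨v, w, t, u, rfl⟩, h0⟩
    have hv := isValue_toFun_add (g := g) v t
    have hw := isValue_toFun_add (g := g) w u
    rw [normD] at h0 ⊢
    set x := g.toFun v v + t - star t
    set z := g.toFun w w + u - star u
    -- If `z = 0`, anisotropy gives `w = 0`, and the element is `1`, the product of any nonzero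
    -- value and its inverse.
    by_cases hz : z = 0
    · rw [hz] at hw
      rw [hz, hg w (quad_eq_zero_iff.2 hw), herm_zero_left, zero_mul, zero_add, zero_add]
      rw [← valueSet_bot] at hne ⊢
      exact one_mem_valueSet_mul hne
    · have h1 := (hw.smul (star z⁻¹)).star
      rw [star_star, inv_mul_cancel₀ hz, one_mul, star_star] at h1
      have h2 := h1.add hv
      rw [herm_smul_left, star_star] at h2
      have h3 : z * x + g.herm w v + 1 = z * (z⁻¹ + x + z⁻¹ * g.herm w v) := by
        rw [mul_add, mul_add, mul_inv_cancel₀ hz, mul_inv_cancel_left₀ hz]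
        abel
      rw [h3] at h0 ⊢
      exact Set.mul_mem_mul ⟨hz, w, hw⟩ ⟨right_ne_zero_of_mul h0, _, h2⟩
  · intro hd
    obtain ⟨x, ⟨hx0, v, hx⟩, y, ⟨hy0, w, hy⟩, rfl⟩ := Set.mem_mul.1 hd
    refine ⟨?_, mul_ne_zero hx0 hy0⟩
    obtain ⟨v', -, w', -, s, t, hs, ht, he⟩ :=
      exists_normForm (S := ⊤) hx0 (mem_top (x := v)) hx (mem_top (x := w)) hy
    obtain ⟨a, rfl⟩ := hs.eq_add
    obtain ⟨b, rfl⟩ := ht.eq_add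
    exact ⟨v', w', a, b, he⟩

theorem values_nonempty (hg : g.Anisotropic) (hthick : (∃ a : L, star a ≠ a) ∨ Nontrivial V) :
    g.values.Nonempty := by
  rcases hthick with ⟨a, ha⟩ | hV
  · exact ⟨a - star a, sub_ne_zero.2 ha.symm, 0, isValue_zero_iff.2 (sub_star_mem_traceGroup a)⟩
  · obtain ⟨v, hv⟩ := exists_ne (0 : V)
    exact ⟨_, hg.value_ne_zero hv (isValue_toFun v), v, isValue_toFun v⟩

theorem conj_mem_values {x : L} (hx : x ∈ g.values) {d : L} (hd : d ≠ 0) :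
    star d * x * d ∈ g.values := by
  rw [← valueSet_bot] at hx ⊢
  exact conj_mem_valueSet hx hd

theorem inv_mem_values {x : L} (hx : x ∈ g.values) : x⁻¹ ∈ g.values := by
  rw [← valueSet_bot] at hx ⊢
  exact inv_mem_valueSet hx

/-- Adding trace elements to a value must not change it, so `σ = id` and `L` is commutative.
Conjugation then gives `d² = 1` for all `d ≠ 0`. Over the field of three elements, equal values at
`v`, `w`, `v + w` and `v - w` would make `2` vanish, so `V` has dimension one. -/
theorem card_of_subsingleton_values_of_nontrivial (hg : g.Anisotropic) [Nontrivial V]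
    (hs : g.values.Subsingleton) :
    Nat.card L = 2 ∨ (Nat.card L = 3 ∧ Module.finrank Lᵐᵒᵖ V = 1) := by
  classical
  obtain ⟨v, hv⟩ := exists_ne (0 : V)
  have hval : ∀ v ≠ 0, g.toFun v v ∈ g.values := fun v hv =>
    ⟨hg.value_ne_zero hv (isValue_toFun v), v, isValue_toFun v⟩
  have hstar : ∀ t : L, star t = t := by
    intro t
    have h1 := isValue_toFun_add (g := g) v t
    have h2 := hs ⟨hg.value_ne_zero hv h1, v, h1⟩ (hval v hv)
    rw [add_sub_assoc, add_eq_left, sub_eq_zero] at h2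
    exact h2.symm
  have hcomm : ∀ a b : L, a * b = b * a := fun a b => by
    rw [← hstar (a * b), star_mul, hstar, hstar]
  have hx0 := (hval v hv).1
  have hd : ∀ d : L, d ≠ 0 → d = 1 ∨ d = -1 := by
    intro d hd
    have h1 := hs (conj_mem_values (hval v hv) hd) (hval v hv)
    rw [hstar, hcomm d, mul_assoc, mul_eq_left₀ hx0] at h1
    exact mul_self_eq_one_iff.1 h1
  by_cases h2 : (1 : L) = -1
  · left
    have huniv : (Set.univ : Set L) = (({0, 1} : Finset L) : Set L) := by
      ext d
      by_cases h0 : d = 0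
      · simp [h0]
      · rcases hd d h0 with h | h
        · simp [h]
        · simp [h, ← h2]
    rw [← Set.ncard_univ, huniv, Set.ncard_coe_finset, Finset.card_pair zero_ne_one]
  · right
    constructor
    · have huniv : (Set.univ : Set L) = (({0, 1, -1} : Finset L) : Set L) := by
        ext d
        by_cases h0 : d = 0
        · simp [h0]
        · rcases hd d h0 with h | h <;> simp [h]
      rw [← Set.ncard_univ, huniv, Set.ncard_coe_finset, Finset.card_insert_of_notMem,
        Finset.card_pair h2]
      simp
    · refine finrank_eq_one v hv fun w => ?_
      by_contra! hw
      have h3 : v + w ≠ 0 := fun h0 => hw (-1) (by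
        rw [neg_one_smul]
        exact (eq_neg_of_add_eq_zero_right h0).symm)
      have h4 : v + -w ≠ 0 := fun h0 => hw 1 (by
        rw [one_smul]
        exact add_neg_eq_zero.1 h0)
      have hw0 : w ≠ 0 := fun h0 => hw 0 (by rw [zero_smul, h0])
      have h5 := (isValue_toFun (g := g) v).add (isValue_toFun w)
      have h6 := (isValue_toFun (g := g) v).add (isValue_toFun w).neg
      have h7 := hs ⟨hg.value_ne_zero h3 h5, _, h5⟩ (hval v hv)
      have h8 := hs ⟨hg.value_ne_zero h4 h6, _, h6⟩ (hval v hv)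
      rw [hs (hval w hw0) (hval v hv), add_assoc, add_eq_left] at h7 h8
      rw [herm_neg_right, ← sub_eq_add_neg, sub_eq_zero] at h8
      rw [← h8, ← two_mul] at h7
      have h9 : (2 : L) = 0 := (mul_eq_zero.1 h7).resolve_right hx0
      exact h2 (eq_neg_of_add_eq_zero_left (by rw [one_add_one_eq_two, h9]))

/-- The only nonzero trace element equals its negative and its inverse, so it is `1` in
characteristic two. Conjugation gives `d^σ d = 1` for `d ≠ 0`, so only `0` and `1` are fixed by `σ`,
and any two elements not fixed differ by a fixed one. -/
theorem card_of_subsingleton_values_of_star_ne (hs : g.values.Subsingleton) {a : L}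
    (ha : star a ≠ a) : Nat.card L = 4 := by
  classical
  have htr : ∀ t : L, star t ≠ t → t - star t ∈ g.values := fun t ht =>
    ⟨sub_ne_zero.2 ht.symm, 0, isValue_zero_iff.2 (sub_star_mem_traceGroup t)⟩
  have hγ := htr a ha
  have hneg : -(a - star a) ∈ g.values := by
    have := htr (star a) (by rw [star_star]; exact ha.symm)
    rwa [star_star, ← neg_sub] at this
  have h2 : (2 : L) = 0 := by
    have := hs hneg hγ
    rw [neg_eq_iff_add_eq_zero, ← two_mul] at this
    exact (mul_eq_zero.1 this).resolve_right hγ.1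
  have hchar : ∀ x : L, -x = x := fun x => by
    rw [neg_eq_iff_add_eq_zero, ← two_mul, h2, zero_mul]
  have hsq : ∀ x : L, x * x = 1 → x = 1 := fun x hx => by
    rcases mul_self_eq_one_iff.1 hx with h | h
    · exact h
    · rwa [hchar] at h
  have hγ1 : a - star a = 1 := by
    refine hsq _ ?_
    calc (a - star a) * (a - star a) = (a - star a)⁻¹ * (a - star a) := by
          rw [hs (inv_mem_values hγ) hγ]
      _ = 1 := inv_mul_cancel₀ hγ.1
  have hone : ∀ d : L, d ≠ 0 → star d * d = 1 := by
    intro d hd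
    have := hs (conj_mem_values hγ hd) hγ
    rwa [hγ1, mul_one] at this
  have hfix : ∀ t : L, star t = t → t = 0 ∨ t = 1 := by
    intro t ht
    by_cases h0 : t = 0
    · exact Or.inl h0
    · refine Or.inr (hsq t ?_)
      have := hone t h0
      rwa [ht] at this
  have hsa : star a = a - 1 := by rw [← hγ1]; abel
  have huniv : (Set.univ : Set L) = (({0, 1, a, a + 1} : Finset L) : Set L) := by
    ext t
    simp only [Set.mem_univ, Finset.coe_insert, Finset.coe_singleton, Set.mem_insert_iff,
      Set.mem_singleton_iff, true_iff]
    by_cases ht : star t = t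
    · rcases hfix t ht with h | h <;> simp [h]
    · have h1 := hs (htr t ht) hγ
      have h3 : star (t - a) = t - a := by
        rw [star_sub, ← sub_eq_zero]
        have : star t - star a - (t - a) = (a - star a) - (t - star t) := by abel
        rw [this, h1, sub_self]
      rcases hfix _ h3 with h | h
      · exact Or.inr (Or.inr (Or.inl (sub_eq_zero.1 h)))
      · exact Or.inr (Or.inr (Or.inr (by rw [← h]; abel)))
  have ha0 : a ≠ 0 := fun h => ha (by rw [h, star_zero])
  have ha1 : a ≠ 1 := fun h => ha (by rw [h, star_one])
  have ha2 : a + 1 ≠ 0 := fun h => ha1 (by rw [eq_neg_of_add_eq_zero_left h, hchar])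
  rw [← Set.ncard_univ, huniv, Set.ncard_coe_finset, Finset.card_insert_of_notMem,
    Finset.card_insert_of_notMem, Finset.card_pair]
  · simp
  · simp only [Finset.mem_insert, Finset.mem_singleton, not_or]
    exact ⟨ha1.symm, fun h => ha0 (by simpa using h.symm)⟩
  · simp only [Finset.mem_insert, Finset.mem_singleton, not_or]
    exact ⟨zero_ne_one, ha0.symm, ha2.symm⟩

/-- There are two different nonzero values, except in three small cases. -/
theorem values_nontrivial (hg : g.Anisotropic) (hthick : (∃ a : L, star a ≠ a) ∨ Nontrivial V)
    (h2 : Nat.card L ≠ 2) (h3 : ¬ (Nat.card L = 3 ∧ Module.finrank Lᵐᵒᵖ V = 1))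
    (h4 : ¬ (Nat.card L = 4 ∧ Subsingleton V)) : g.values.Nontrivial := by
  by_contra hs
  rw [Set.not_nontrivial_iff] at hs
  rcases subsingleton_or_nontrivial V with hV | hV
  · obtain ⟨a, ha⟩ := hthick.resolve_right (not_nontrivial_iff_subsingleton.2 hV)
    exact h4 ⟨card_of_subsingleton_values_of_star_ne hs ha, hV⟩
  · exact (card_of_subsingleton_values_of_nontrivial hg hs).elim h2 h3

end SigmaForm

/-! ### The standard form and its frame -/

section StandardSubspaces

variable {L V₀ : Type*} [DivisionRing L] [AddCommGroup V₀] [Module Lᵐᵒᵖ V₀] {n : ℕ}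

theorem mem_stdM₁ {v : StdSpace L V₀ n} : v ∈ stdM₁ L V₀ n ↔ v.1 = 0 ∧ v.2.2 = 0 := by
  constructor
  · intro hv
    have hle : stdM₁ L V₀ n ≤ LinearMap.ker (LinearMap.fst Lᵐᵒᵖ V₀ ((Fin n → L) × (Fin n → L))) ⊓
        LinearMap.ker (LinearMap.snd Lᵐᵒᵖ (Fin n → L) (Fin n → L) ∘ₗ
          LinearMap.snd Lᵐᵒᵖ V₀ ((Fin n → L) × (Fin n → L))) := by
      refine span_le.2 ?_
      rintro _ ⟨i, rfl⟩
      exact ⟨rfl, rfl⟩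
    exact hle hv
  · rintro ⟨h1, h2⟩
    have : v = ∑ i, eNeg L V₀ i <• v.2.1 i := by
      refine Prod.ext ?_ (Prod.ext ?_ ?_)
      · simp [h1, Prod.fst_sum, eNeg]
      · ext j
        simp [Prod.fst_sum, Prod.snd_sum, eNeg, Finset.sum_apply, Pi.single_apply]
      · simp [h2, Prod.snd_sum, eNeg]
    rw [this]
    exact sum_mem fun i _ => smul_mem _ _ (subset_span ⟨i, rfl⟩)

theorem mem_stdM₂ {v : StdSpace L V₀ n} : v ∈ stdM₂ L V₀ n ↔ v.1 = 0 ∧ v.2.1 = 0 := by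
  constructor
  · intro hv
    have hle : stdM₂ L V₀ n ≤ LinearMap.ker (LinearMap.fst Lᵐᵒᵖ V₀ ((Fin n → L) × (Fin n → L))) ⊓
        LinearMap.ker (LinearMap.fst Lᵐᵒᵖ (Fin n → L) (Fin n → L) ∘ₗ
          LinearMap.snd Lᵐᵒᵖ V₀ ((Fin n → L) × (Fin n → L))) := by
      refine span_le.2 ?_
      rintro _ ⟨i, rfl⟩
      exact ⟨rfl, rfl⟩
    exact hle hv
  · rintro ⟨h1, h2⟩
    have : v = ∑ i, ePos L V₀ i <• v.2.2 i := by
      refine Prod.ext ?_ (Prod.ext ?_ ?_)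
      · simp [h1, Prod.fst_sum, ePos]
      · simp [h2, Prod.fst_sum, Prod.snd_sum, ePos]
      · ext j
        simp [Prod.snd_sum, ePos, Finset.sum_apply, Pi.single_apply]
    rw [this]
    exact sum_mem fun i _ => smul_mem _ _ (subset_span ⟨i, rfl⟩)

theorem stdM₁_eq_sup (j : Fin n) :
    stdM₁ L V₀ n = span Lᵐᵒᵖ (eNeg L V₀ '' {i | i ≠ j}) ⊔ Lᵐᵒᵖ ∙ eNeg L V₀ j := by
  rw [stdM₁, sup_comm, ← span_insert, ← Set.image_insert_eq, ← Set.image_univ]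
  congr 2
  ext i
  simp [em]

theorem stdM₂_eq_sup (j : Fin n) :
    stdM₂ L V₀ n = span Lᵐᵒᵖ (ePos L V₀ '' {i | i ≠ j}) ⊔ Lᵐᵒᵖ ∙ ePos L V₀ j := by
  rw [stdM₂, sup_comm, ← span_insert, ← Set.image_insert_eq, ← Set.image_univ]
  congr 2
  ext i
  simp [em]

theorem stdAxis_eq (j : Fin n) :
    stdAxis L V₀ j = (span Lᵐᵒᵖ (eNeg L V₀ '' {i | i ≠ j})).submoduleOf (stdM₁ L V₀ n) := by
  rw [submoduleOf, ← comap_map_eq_of_injective (stdM₁ L V₀ n).injective_subtype (stdAxis L V₀ j),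
    stdAxis, map_span, ← Set.image_comp]
  rfl

end StandardSubspaces

namespace SigmaForm

variable {L V₀ : Type*} [DivisionRing L] [StarRing L] [AddCommGroup V₀] [Module Lᵐᵒᵖ V₀]
variable {g₀ : SigmaForm L V₀} {n : ℕ}

theorem stdForm_toFun (v w : StdSpace L V₀ n) :
    (stdForm n g₀).toFun v w = ∑ i, star (v.2.1 i) * w.2.2 i + g₀.toFun v.1 w.1 := rfl

theorem stdForm_herm (v w : StdSpace L V₀ n) : (stdForm n g₀).herm v w =
    ∑ i, star (v.2.1 i) * w.2.2 i + ∑ i, star (v.2.2 i) * w.2.1 i + g₀.herm v.1 w.1 := by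
  simp only [herm, stdForm_toFun, star_add, star_sum, star_mul, star_star]
  abel

theorem stdForm_herm_eNeg (i : Fin n) (v : StdSpace L V₀ n) :
    (stdForm n g₀).herm (eNeg L V₀ i) v = v.2.2 i := by
  simp [stdForm_herm, eNeg, Pi.single_apply, apply_ite star, ite_mul]

theorem stdForm_herm_ePos (i : Fin n) (v : StdSpace L V₀ n) :
    (stdForm n g₀).herm (ePos L V₀ i) v = v.2.1 i := by
  simp [stdForm_herm, ePos, Pi.single_apply, apply_ite star, ite_mul]

theorem stdForm_isValue_iff {v : StdSpace L V₀ n} (hv : v.2.1 = 0 ∨ v.2.2 = 0) {x : L} :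
    (stdForm n g₀).IsValue v x ↔ g₀.IsValue v.1 x := by
  rcases hv with h | h <;> simp [IsValue, stdForm_toFun, h]

theorem mem_perp_stdM₁ {v : StdSpace L V₀ n} :
    v ∈ (stdForm n g₀).perp (stdM₁ L V₀ n) ↔ v.2.2 = 0 := by
  refine ⟨fun h => funext fun i => ?_, fun h s hs => ?_⟩
  · rw [← stdForm_herm_eNeg (g₀ := g₀)]
    exact h _ (subset_span ⟨i, rfl⟩)
  · obtain ⟨h1, h2⟩ := mem_stdM₁.1 hs
    simp [stdForm_herm, h, h1, h2]

theorem mem_perp_stdM₂ {v : StdSpace L V₀ n} :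
    v ∈ (stdForm n g₀).perp (stdM₂ L V₀ n) ↔ v.2.1 = 0 := by
  refine ⟨fun h => funext fun i => ?_, fun h s hs => ?_⟩
  · rw [← stdForm_herm_ePos (g₀ := g₀)]
    exact h _ (subset_span ⟨i, rfl⟩)
  · obtain ⟨h1, h2⟩ := mem_stdM₂.1 hs
    simp [stdForm_herm, h, h1, h2]

theorem isMaximalSingular_of_perp {V : Type*} [AddCommGroup V] [Module Lᵐᵒᵖ V]
    {g : SigmaForm L V} {M : Submodule Lᵐᵒᵖ V} (hM : g.IsSingular M)
    (h : ∀ v ∈ g.perp M, g.quad v = 0 → v ∈ M) : g.IsMaximalSingular M :=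
  ⟨hM, fun _ hS hMS v hv => h v (fun _ hs => hS.herm_eq_zero (hMS hs) hv) (hS v hv)⟩

theorem isMaximalSingular_stdM₁ (hg₀ : g₀.Anisotropic) :
    (stdForm n g₀).IsMaximalSingular (stdM₁ L V₀ n) := by
  refine isMaximalSingular_of_perp (fun v hv => ?_) fun v hv h0 => ?_
  · obtain ⟨h1, h2⟩ := mem_stdM₁.1 hv
    rw [quad_eq_zero_iff, stdForm_isValue_iff (Or.inr h2), h1, isValue_zero_iff]
    exact zero_mem _
  · rw [mem_perp_stdM₁] at hv
    rw [quad_eq_zero_iff, stdForm_isValue_iff (Or.inr hv), ← quad_eq_zero_iff] at h0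
    exact mem_stdM₁.2 ⟨hg₀ _ h0, hv⟩

theorem isMaximalSingular_stdM₂ (hg₀ : g₀.Anisotropic) :
    (stdForm n g₀).IsMaximalSingular (stdM₂ L V₀ n) := by
  refine isMaximalSingular_of_perp (fun v hv => ?_) fun v hv h0 => ?_
  · obtain ⟨h1, h2⟩ := mem_stdM₂.1 hv
    rw [quad_eq_zero_iff, stdForm_isValue_iff (Or.inl h2), h1, isValue_zero_iff]
    exact zero_mem _
  · rw [mem_perp_stdM₂] at hv
    rw [quad_eq_zero_iff, stdForm_isValue_iff (Or.inl hv), ← quad_eq_zero_iff] at h0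
    exact mem_stdM₂.2 ⟨hg₀ _ h0, hv⟩

/-- The rank is recorded as the dimension of `M₁`, since its numerical value is not needed. -/
theorem stdForm_hasRank (hg₀ : g₀.Anisotropic) (n : ℕ) :
    (stdForm n g₀).HasRank (finrank Lᵐᵒᵖ (stdM₁ L V₀ n)) where
  exists_maximal := ⟨_, isMaximalSingular_stdM₁ hg₀,
    Module.Finite.span_of_finite _ (Set.finite_range _), rfl⟩
  nondegenerate v hv h := by
    have h1 : v.2.2 = 0 := funext fun i => by
      rw [← stdForm_herm_eNeg (g₀ := g₀)]
      exact herm_eq_zero_comm _ (h _)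
    have h2 : v.2.1 = 0 := funext fun i => by
      rw [← stdForm_herm_ePos (g₀ := g₀)]
      exact herm_eq_zero_comm _ (h _)
    rw [quad_eq_zero_iff, stdForm_isValue_iff (Or.inr h1), ← quad_eq_zero_iff] at hv
    exact Prod.ext (hg₀ _ hv) (Prod.ext h2 h1)

theorem valueSet_stdM₁ : (stdForm n g₀).valueSet (stdM₁ L V₀ n) = g₀.values := by
  ext x
  refine and_congr_right fun _ => ⟨?_, ?_⟩
  · rintro ⟨v, hv, hx⟩
    rw [mem_perp_stdM₁] at hv
    exact ⟨v.1, (stdForm_isValue_iff (Or.inr hv)).1 hx⟩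
  · rintro ⟨v, hx⟩
    exact ⟨(v, 0, 0), mem_perp_stdM₁.2 rfl, (stdForm_isValue_iff (Or.inr rfl)).2 hx⟩

theorem stdForm_isRich (hg₀ : g₀.Anisotropic) (n : ℕ) (h : g₀.values.Nontrivial) :
    (stdForm n g₀).IsRich (finrank Lᵐᵒᵖ (stdM₁ L V₀ n)) where
  toHasRank := stdForm_hasRank hg₀ n
  nontrivial_valueSet M hM := by
    rw [(stdForm_hasRank hg₀ n).valueSet_eq hM (isMaximalSingular_stdM₁ hg₀), valueSet_stdM₁]
    exact h

theorem stdM₃_eq_sup (j : Fin n) (v₀ : V₀) (t : L) :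
    stdM₃ g₀ j v₀ t = span Lᵐᵒᵖ (eNeg L V₀ '' {i | i ≠ j}) ⊔
      Lᵐᵒᵖ ∙ (eNeg L V₀ j + (v₀, 0, 0) - ePos L V₀ j <• (g₀.toFun v₀ v₀ + t - star t)) := by
  rw [stdM₃, span_insert, sup_comm]
  congr 3
  refine Prod.ext ?_ (Prod.ext ?_ ?_)
  · simp [eNeg, ePos]
  · simp [eNeg, ePos]
  · ext i
    rcases eq_or_ne i j with rfl | hi
    · simp [eNeg, ePos]
    · simp [eNeg, ePos, hi]

theorem stdM₄_eq_sup (j : Fin n) (w₀ : V₀) (u : L) :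
    stdM₄ g₀ j w₀ u = span Lᵐᵒᵖ (ePos L V₀ '' {i | i ≠ j}) ⊔
      Lᵐᵒᵖ ∙ (ePos L V₀ j + (w₀, 0, 0) - eNeg L V₀ j <• star (g₀.toFun w₀ w₀ + u - star u)) := by
  rw [stdM₄, span_insert, sup_comm]
  congr 3
  refine Prod.ext ?_ (Prod.ext ?_ ?_)
  · simp [eNeg, ePos]
  · ext i
    rcases eq_or_ne i j with rfl | hi
    · simp [eNeg, ePos]
    · simp [eNeg, ePos, hi]
  · simp [eNeg, ePos]

theorem mem_perp_span_eNeg {j : Fin n} {v : StdSpace L V₀ n} (h : ∀ i ≠ j, v.2.2 i = 0) :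
    v ∈ (stdForm n g₀).perp (span Lᵐᵒᵖ (eNeg L V₀ '' {i | i ≠ j})) := by
  have : span Lᵐᵒᵖ (eNeg L V₀ '' {i | i ≠ j}) ≤ (stdForm n g₀).perp (Lᵐᵒᵖ ∙ v) := by
    refine span_le.2 ?_
    rintro _ ⟨i, hi, rfl⟩
    refine mem_perp_span_singleton.2 (herm_eq_zero_comm _ ?_)
    rw [stdForm_herm_eNeg, h i hi]
  exact le_perp_comm this (mem_span_singleton_self v)

theorem mem_perp_span_ePos {j : Fin n} {v : StdSpace L V₀ n} (h : ∀ i ≠ j, v.2.1 i = 0) :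
    v ∈ (stdForm n g₀).perp (span Lᵐᵒᵖ (ePos L V₀ '' {i | i ≠ j})) := by
  have : span Lᵐᵒᵖ (ePos L V₀ '' {i | i ≠ j}) ≤ (stdForm n g₀).perp (Lᵐᵒᵖ ∙ v) := by
    refine span_le.2 ?_
    rintro _ ⟨i, hi, rfl⟩
    refine mem_perp_span_singleton.2 (herm_eq_zero_comm _ ?_)
    rw [stdForm_herm_ePos, h i hi]
  exact le_perp_comm this (mem_span_singleton_self v)

theorem opposite_stdM₁_stdM₂ (hg₀ : g₀.Anisotropic) :
    (stdForm n g₀).Opposite (stdM₁ L V₀ n) (stdM₂ L V₀ n) := by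
  rw [(stdForm_hasRank hg₀ n).opposite_iff (isMaximalSingular_stdM₁ hg₀)
    (isMaximalSingular_stdM₂ hg₀), disjoint_def]
  intro v h1 h2
  rw [mem_stdM₁] at h1
  rw [mem_stdM₂] at h2
  exact Prod.ext h1.1 (Prod.ext h2.2 h1.2)

theorem stdForm_isFrame (hg₀ : g₀.Anisotropic) (j : Fin n) :
    (stdForm n g₀).IsFrame (span Lᵐᵒᵖ (eNeg L V₀ '' {i | i ≠ j}))
      (span Lᵐᵒᵖ (ePos L V₀ '' {i | i ≠ j})) (eNeg L V₀ j) (ePos L V₀ j) where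
  left := stdM₁_eq_sup (V₀ := V₀) (L := L) j ▸ isMaximalSingular_stdM₁ hg₀
  right := stdM₂_eq_sup (V₀ := V₀) (L := L) j ▸ isMaximalSingular_stdM₂ hg₀
  opposite := by
    rw [← stdM₁_eq_sup, ← stdM₂_eq_sup]
    exact opposite_stdM₁_stdM₂ hg₀
  herm_eq_one := by rw [stdForm_herm_ePos]; simp [eNeg]
  mem_perp_left := mem_perp_span_eNeg fun i hi => by simp [ePos, hi]
  mem_perp_right := mem_perp_span_ePos fun i hi => by simp [eNeg, hi]

/-- The self-projectivity of the standard maximal singular subspace is a homology. -/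
theorem stdForm_homology (hg₀ : g₀.Anisotropic) (j : Fin n) (v₀ w₀ : V₀) (t u : L)
    (hD : normD g₀ v₀ w₀ t u ≠ 0) :
    (stdForm n g₀).IsMaximalSingular (stdM₃ g₀ j v₀ t) ∧
    (stdForm n g₀).IsMaximalSingular (stdM₄ g₀ j w₀ u) ∧
    (stdForm n g₀).Opposite (stdM₂ L V₀ n) (stdM₃ g₀ j v₀ t) ∧
    (stdForm n g₀).Opposite (stdM₃ g₀ j v₀ t) (stdM₄ g₀ j w₀ u) ∧
    (stdForm n g₀).Opposite (stdM₄ g₀ j w₀ u) (stdM₁ L V₀ n) ∧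
    IsHomology (stdAxis L V₀ j) (stdCentre L V₀ j) (normD g₀ v₀ w₀ t u)
      ((stdForm n g₀).perspectivity (stdM₄ g₀ j w₀ u) (stdM₁ L V₀ n) ∘
        (stdForm n g₀).perspectivity (stdM₃ g₀ j v₀ t) (stdM₄ g₀ j w₀ u) ∘
        (stdForm n g₀).perspectivity (stdM₂ L V₀ n) (stdM₃ g₀ j v₀ t) ∘
        (stdForm n g₀).perspectivity (stdM₁ L V₀ n) (stdM₂ L V₀ n)) := by
  have hval : ∀ v t, (stdForm n g₀).IsValue (v, 0, 0) (g₀.toFun v v + t - star t) := fun v t =>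
    (stdForm_isValue_iff (Or.inl rfl)).2 (isValue_toFun_add v t)
  have hD' : (stdForm n g₀).herm (w₀, 0, 0) (v₀, 0, 0) = g₀.herm w₀ v₀ := by simp [stdForm_herm]
  have key := (stdForm_isFrame hg₀ j).homology (stdForm_hasRank hg₀ n)
    (v := (v₀, 0, 0)) (w := (w₀, 0, 0))
    (mem_perp_span_eNeg fun _ _ => rfl) (mem_perp_span_ePos fun _ _ => rfl)
    (by rw [stdForm_herm_eNeg]; rfl) (by rw [stdForm_herm_ePos]; rfl) (hval v₀ t)
    (mem_perp_span_eNeg fun _ _ => rfl) (mem_perp_span_ePos fun _ _ => rfl)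
    (by rw [stdForm_herm_eNeg]; rfl) (by rw [stdForm_herm_ePos]; rfl) (hval w₀ u)
    (by rw [hD']; exact hD)
  rw [hD', ← stdM₃_eq_sup, ← stdM₄_eq_sup, ← stdM₂_eq_sup] at key
  rw [stdAxis_eq]
  -- The types of the perspectivities depend on `M₁`, so `M₁` and its centre are generalised before
  -- `M₁ = A ⊔ ⟨c⟩` is substituted.
  have hc : (stdCentre L V₀ j : StdSpace L V₀ n) = eNeg L V₀ j := rfl
  have h1 := stdM₁_eq_sup (L := L) (V₀ := V₀) j
  generalize stdCentre L V₀ j = c at hc ⊢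
  generalize stdM₁ L V₀ n = M at h1 c hc ⊢
  subst h1
  obtain rfl : c = ⟨_, mem_sup_right (mem_span_singleton_self _)⟩ := Subtype.ext hc
  exact key

end SigmaForm

theorem homologiesWithFactorIn_congr {L M : Type*} [DivisionRing L] [AddCommGroup M]
    [Module Lᵐᵒᵖ M] {N N' : Set L} (h : ∀ d, d ≠ 0 → (d ∈ N ↔ d ∈ N')) :
    homologiesWithFactorIn N M = homologiesWithFactorIn N' M := by
  ext φ
  constructor
  · rintro ⟨H, c, d, hd, hφ⟩
    exact ⟨H, c, d, (h d hφ.2.2.1).1 hd, hφ⟩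
  · rintro ⟨H, c, d, hd, hφ⟩
    exact ⟨H, c, d, (h d hφ.2.2.1).2 hd, hφ⟩

/-- `Nat.card` is `0` for infinite `L` and `finrank` is `0` in infinite dimension, so the excluded
cases are genuinely those of the finite fields listed, with `dim V₀ = 1` in the second. -/
theorem mainTheorem5 {L V₀ : Type*} [DivisionRing L] [StarRing L] [AddCommGroup V₀]
    [Module Lᵐᵒᵖ V₀] (g₀ : SigmaForm L V₀) (hg₀ : g₀.Anisotropic) (n : ℕ) (hn : 3 ≤ n)
    -- the polar space is thick
    (hthick : (∃ a : L, star a ≠ a) ∨ Nontrivial V₀) :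
    -- here the polar space is assumed to be neither a quadric over `𝔽₂`, nor a parabolic quadric
    -- over `𝔽₃`, nor a Hermitian variety with trivial anisotropic part over `𝔽₄`
    (Nat.card L ≠ 2 →
      ¬ (Nat.card L = 3 ∧ Module.finrank Lᵐᵒᵖ V₀ = 1) →
      ¬ (Nat.card L = 4 ∧ Subsingleton V₀) →
      ∀ M : Submodule Lᵐᵒᵖ (StdSpace L V₀ n), (stdForm n g₀).IsMaximalSingular M →
        (stdForm n g₀).specialProjectivityGroup M =
          Subgroup.closure (homologiesWithFactorIn (normSet g₀) M)) ∧
    (∀ (j : Fin n) (v₀ w₀ : V₀) (t u : L), normD g₀ v₀ w₀ t u ≠ 0 →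
      (stdForm n g₀).IsMaximalSingular (stdM₁ L V₀ n) ∧
      (stdForm n g₀).IsMaximalSingular (stdM₂ L V₀ n) ∧
      (stdForm n g₀).IsMaximalSingular (stdM₃ g₀ j v₀ t) ∧
      (stdForm n g₀).IsMaximalSingular (stdM₄ g₀ j w₀ u) ∧
      (stdForm n g₀).Opposite (stdM₁ L V₀ n) (stdM₂ L V₀ n) ∧
      (stdForm n g₀).Opposite (stdM₂ L V₀ n) (stdM₃ g₀ j v₀ t) ∧
      (stdForm n g₀).Opposite (stdM₃ g₀ j v₀ t) (stdM₄ g₀ j w₀ u) ∧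
      (stdForm n g₀).Opposite (stdM₄ g₀ j w₀ u) (stdM₁ L V₀ n) ∧
      IsHomology (stdAxis L V₀ j) (stdCentre L V₀ j) (normD g₀ v₀ w₀ t u)
        ((stdForm n g₀).perspectivity (stdM₄ g₀ j w₀ u) (stdM₁ L V₀ n) ∘
          (stdForm n g₀).perspectivity (stdM₃ g₀ j v₀ t) (stdM₄ g₀ j w₀ u) ∘
          (stdForm n g₀).perspectivity (stdM₂ L V₀ n) (stdM₃ g₀ j v₀ t) ∘
          (stdForm n g₀).perspectivity (stdM₁ L V₀ n) (stdM₂ L V₀ n))) := by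
  refine ⟨fun h2 h3 h4 M hM => ?_, fun j v₀ w₀ t u hD => ?_⟩
  · have hrich := SigmaForm.stdForm_isRich hg₀ n
      (SigmaForm.values_nontrivial hg₀ hthick h2 h3 h4)
    rw [hrich.specialProjectivityGroup_eq hM, hrich.valueSet_eq hM
      (SigmaForm.isMaximalSingular_stdM₁ hg₀), SigmaForm.valueSet_stdM₁]
    congr 1
    -- The norm set may contain `0`, but the factor of a homology is nonzero, so only its nonzero
    -- elements matter.
    refine homologiesWithFactorIn_congr fun d hd => ?_
    rw [← hg₀.mem_normSet_iff (SigmaForm.values_nonempty hg₀ hthick), and_iff_left hd]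
  · obtain ⟨h3, h4, o23, o34, o41, hh⟩ := SigmaForm.stdForm_homology hg₀ j v₀ w₀ t u hD
    exact ⟨SigmaForm.isMaximalSingular_stdM₁ hg₀, SigmaForm.isMaximalSingular_stdM₂ hg₀, h3, h4,
      SigmaForm.opposite_stdM₁_stdM₂ hg₀, o23, o34, o41, hh⟩
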